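/- **Setting.** Let $T=(V,E)$ be a directed rooted tree with $|V|=n\ge 2$ nodes in which every node has degree (indegree plus outdegree) at most $d$, where $d\ge 2$. The node set $V$ is known, the edge set $E$ is not. For nodes $i,j$ let $Q(i,j)=1$ if there is a directed path (with at least one edge) from $i$ to $j$ in $T$, and $Q(i,j)=0$ otherwise. Let $\varepsilon\in[0,1/2)$. For $k=1,\dots,m$ the $k$-th noisy query on $(i,j)$ returns $\widetilde Q^{(k)}(i,j)$, which equals $Q(i,j)$ with probability $1-\varepsilon$ and $1-Q(i,j)$ with probability $\varepsilon$, independently for all $k,i,j$. **Algorithm (noisy reconstruction, parameter $m$).** Put $Q'(i,j)=1$ if $\sum_{k=1}^m\widetilde Q^{(k)}(i,j)>m/2$ and $Q'(i,j)=0$ otherwise, and run the following recursive procedure on $V$, where each use of a value $Q'(i,j)$ costs $m$ noisy queries. "Ancestor" and "sorted" refer to $Q'$: $i$ is an ancestor of $j$ if $Q'(i,j)=1$, and sorting is merge sort with $i$ before $j$ if $Q'(i,j)=1$. *Reconstruct tree$(V)$.* If $|V|=1$, return $\emptyset$. Otherwise repeat the following round until it yields an edge. 1. Draw $i,j\in V$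 independently and uniformly. Determine the vertex sequence $x_1,\dots,x_P$ of the path between $i$ and $j$ in the undirected skeleton, and the position $a$ in it of the lowest common ancestor of $i$ and $j$. If $i=j$, the sequence is just $i$. If $i$ is an ancestor of $j$, it is $i$, then the sorted list of the nodes $k\in V\setminus\{i,j\}$ with $Q'(i,k)=Q'(k,j)=1$, then $j$, with $a=1$; if $j$ is an ancestor of $i$, exchange $i$ and $j$. Otherwise, sort the ancestors of $i$ in $V$, let $x$ be the last of them that is an ancestor of $j$, and join the directed paths from $x$ to $i$ (reversed) and from $x$ to $j$, each found as before. 2. Assign every node $k$ not on this path to a node of the path (its bag): by binary search, find on each of the two directed paths $x_a,x_{a-1},\dots,x_1$ and $x_a,\dots,x_P$ the last ancestor of $k$ (the first node $x_a$, if there is no ancestor). If the result for the first path is not $x_a$, it is the bag of $k$; otherwise the result for the second path is. 3. For $r=1,\dots,P-1$ in this order, let $s_r$ be the number of nodes in the bags of $x_1,\dots,x_r$ (including $x_1,\dots,x_r$). At the first $r$ with $\lfloor |V|/d\rfloor\le s_r\le\lceil (d-1)|V|/d\rceil$ the round yields the edge joining $x_r$ and $x_{r+1}$, directed away from $x_a$.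 When a round has yielded an edge $e=(u,v)$, let $V_2$ consist of $v$ and all $k\in V$ with $Q'(v,k)=1$, let $V_1=V\setminus V_2$, and return the union of $\{e\}$ and the results of the recursive calls on $V_1$ and on $V_2$. **Theorem.** There is an absolute constant $c_1>0$ such that for every $c_2\ge c_1$ there is a constant $K>0$ (depending only on $c_2$) with the following property. For all $T,n,d,\varepsilon$ as above, every $\delta\in(0,1)$, and every natural number $m$ with $$c_1\,\frac{\log d+\log n+\log\frac1\delta}{(1/2-\varepsilon)^2}\;\le\; m\;\le\; c_2\,\frac{\log d+\log n+\log\frac1\delta}{(1/2-\varepsilon)^2},$$ with probability at least $1-\delta$ (over the noise and the random draws of the algorithm) the algorithm halts, returns exactly the edge set $E$, and both the number of noisy queries that it has asked and its running time (each noisy query and each elementary operation takes one unit of time) are at most $$K\cdot\frac1\delta\cdot\frac{1}{(1/2-\varepsilon)^2}\; d\,n\log^2 n\,\Bigl(\log d+\log n+\log\tfrac1\delta\Bigr).$$ -/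

import Mathlib

open scoped ENNReal

namespace TreeQuery

/-! ### Directed rooted trees, path queries and noise -/

/-- `E` is the edge set of a directed rooted tree with vertex set `V`: there is a root without
parents, every other vertex has exactly one parent, and all vertices are reachable from the
root. -/
def IsRootedTree {V : Type} (E : Finset (V × V)) : Prop :=
  ∃ root : V, (∀ u, (u, root) ∉ E) ∧ (∀ v, v ≠ root → ∃! u, (u, v) ∈ E) ∧
    ∀ v, Relation.ReflTransGen (fun a b => (a, b) ∈ E) root v

/-- The degree of a vertex: indegree plus outdegree. -/
def degree {V : Type} [DecidableEq V] (E : Finset (V × V)) (v : V) : ℕ :=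
  (E.filter fun e => e.1 = v).card + (E.filter fun e => e.2 = v).card

open Classical in
/-- The path query: is there a directed path (with at least one edge) from `i` to `j`? -/
noncomputable def pathQuery {V : Type} (E : Finset (V × V)) (i j : V) : Bool :=
  decide (Relation.TransGen (fun a b => (a, b) ∈ E) i j)

/-- The law of a family of independent bits indexed by `ι`, each equal to `true` with
probability `ε`. -/
noncomputable def noiseLaw (ε : unitInterval) (ι : Type) [Fintype ι] [DecidableEq ι] :
    PMF (ι → Bool) :=
  PMF.ofFintype
    (fun η => ∏ x, if η x then ENNReal.ofReal (ε : ℝ) else ENNReal.ofReal (1 - (ε : ℝ))) (by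
      have h := Finset.prod_univ_sum (fun _ : ι => (Finset.univ : Finset Bool))
        (fun (_ : ι) (b : Bool) =>
          if b then ENNReal.ofReal (ε : ℝ) else ENNReal.ofReal (1 - (ε : ℝ)))
      rw [Fintype.piFinset_univ] at h
      rw [← h]
      refine Finset.prod_eq_one fun x _ => ?_
      have h0 : (0 : ℝ) ≤ ε := ε.2.1
      have h1 : (0 : ℝ) ≤ 1 - ε := sub_nonneg.2 ε.2.2
      simp [← ENNReal.ofReal_add h0 h1])

/-- The answer to the `k`-th call of the noisy path query on `(i, j)`: the true answer, flipped
if the noise bit `η (k, i, j)` is `true`. -/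
noncomputable def noisyPathQuery {V : Type} {m : ℕ} (E : Finset (V × V))
    (η : Fin m × V × V → Bool) (k : Fin m) (i j : V) : Bool :=
  xor (pathQuery E i j) (η (k, i, j))

/-- The majority vote: `true` if more than `m / 2` of the `m` answers are `true`. -/
def majority {V : Type} {m : ℕ} (Qn : Fin m → V → V → Bool) (i j : V) : Bool :=
  decide ((m : ℚ) / 2 < ((Finset.univ.filter fun k => Qn k i j = true).card : ℚ))

/-! ### Randomized programs that ask queries

A program sees the hidden tree only through its calls of `query`. -/

/-- Randomized programs on the vertex type `V` with output in `α`. -/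
inductive Prog (V : Type) (α : Type) : Type
  /-- halt with an output -/
  | ret (a : α) : Prog V α
  /-- halt without an output -/
  | abort : Prog V α
  /-- spend `t` units of time, then continue -/
  | charge (t : ℕ) (p : Prog V α) : Prog V α
  /-- ask whether there is a path from `i` to `j`, then continue with the answer -/
  | query (i j : V) (p : Bool → Prog V α) : Prog V α
  /-- draw a uniformly random entry of the list, then continue with it -/
  | pick (vs : List V) (p : V → Prog V α) : Prog V α

namespace Prog

/-- Sequential composition. -/
def bind {V α β : Type} : Prog V α → (α → Prog V β) → Prog V β
  | ret a, f => f a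
  | abort, _ => abort
  | charge t p, f => charge t (bind p f)
  | query i j p, f => query i j fun b => bind (p b) f
  | pick vs p, f => pick vs fun v => bind (p v) f

instance {V : Type} : Monad (Prog V) where
  pure := ret
  bind := bind

end Prog

/-- Ask one query. -/
def ask {V : Type} (i j : V) : Prog V Bool := .query i j .ret

/-- Spend `t` units of time. -/
def spend {V : Type} (t : ℕ) : Prog V Unit := .charge t (.ret ())

/-- Draw a uniformly random entry of a list. -/
def draw {V : Type} (vs : List V) : Prog V V := .pick vs .ret

/-- The outcome of a halting run: the output, the number of noisy queries asked, and the running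
time. -/
structure Outcome (α : Type) where
  output : α
  queries : ℕ
  time : ℕ

/-- Add to the costs of a run (`none` is a run without output). -/
def addCost {α : Type} (q t : ℕ) : Option (Outcome α) → Option (Outcome α) :=
  Option.map fun o => ⟨o.output, o.queries + q, o.time + t⟩

/-- The law of the outcome of a program if queries are answered by `Q`, where each answer is
computed from `m` noisy answers: it counts as `m` noisy queries and takes `m + 1` units of time.
A random draw takes one unit of time. -/
noncomputable def Prog.run {V α : Type} (Q : V → V → Bool) (m : ℕ) :
    Prog V α → PMF (Option (Outcome α))
  | .ret a => PMF.pure (some ⟨a, 0, 0⟩)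
  | .abort => PMF.pure none
  | .charge t p => (p.run Q m).map (addCost 0 t)
  | .query i j p => ((p (Q i j)).run Q m).map (addCost m (m + 1))
  | .pick vs p =>
      open Classical in
      if h : (vs : Multiset V) ≠ 0 then
        ((PMF.ofMultiset (vs : Multiset V) h).bind fun v => (p v).run Q m).map (addCost 0 1)
      else PMF.pure none

/-! ### The reconstruction algorithm

Lists that are accessed by position stand for arrays; vertices index arrays too, so that an array
access and a test whether a vertex lies on a recorded path take one unit of time.
All positions are counted from `0`. -/

section Algorithm

variable {V : Type} [DecidableEq V]

/-- Merge two sorted lists for the order in which `x` precedes `y` if the query `(x, y)` is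
answered with `true`. -/
def mergeLists : List V → List V → Prog V (List V)
  | [], ys => pure ys
  | x :: xs, [] => pure (x :: xs)
  | x :: xs, y :: ys => do
      spend 1
      let b ← ask x y
      if b then
        let zs ← mergeLists xs (y :: ys)
        pure (x :: zs)
      else
        let zs ← mergeLists (x :: xs) ys
        pure (y :: zs)
termination_by xs ys => xs.length + ys.length

/-- Merge sort for this order. -/
def sortNodes (xs : List V) : Prog V (List V) :=
  if _h : xs.length < 2 then pure xs
  else do
    spend xs.length
    let ys ← sortNodes (xs.take (xs.length / 2))
    let zs ← sortNodes (xs.drop (xs.length / 2))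
    mergeLists ys zs
termination_by xs.length
decreasing_by
  · simp only [List.length_take]; omega
  · simp only [List.length_drop]; omega

/-- The vertices `k ∉ {i, j}` of the list for which `(i, k)` and `(k, j)` are answered with
`true`. -/
def nodesBetween (i j : V) : List V → Prog V (List V)
  | [] => pure []
  | k :: ks => do
      spend 1
      if k = i ∨ k = j then nodesBetween i j ks
      else
        let b ← ask i k
        if b then
          let c ← ask k j
          let rest ← nodesBetween i j ks
          pure (if c then k :: rest else rest)
        else nodesBetween i j ks

/-- The vertices `j ≠ i` of the list for which `(j, i)` is answered with `true`. -/
def nodesAbove (i : V) : List V → Prog V (List V)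
  | [] => pure []
  | j :: js => do
      spend 1
      if j = i then nodesAbove i js
      else
        let b ← ask j i
        let rest ← nodesAbove i js
        pure (if b then j :: rest else rest)

/-- Find path from root: the proper ancestors of `i`, sorted. -/
def findPathFromRoot (vs : List V) (i : V) : Prog V (List V) := do
  let anc ← nodesAbove i vs
  sortNodes anc

/-- The last `k` in the list for which `(k, j)` is answered with `true` (`best` if there is
none). -/
def lastAbove (j : V) : Option V → List V → Prog V (Option V)
  | best, [] => pure best
  | best, k :: ks => do
      spend 1
      let b ← ask k j
      lastAbove j (if b then some k else best) ks

/-- Find lowest common ancestor: the last ancestor of `j` on the path from the root to `i`. -/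
def findCommonAncestor (vs : List V) (i j : V) : Prog V (Option V) := do
  let path ← findPathFromRoot vs i
  lastAbove j none path

/-- Reconstruct multidirectional path: the sequence of vertices of the multidirectional path
between `i` and `j`, and the position in it of their lowest common ancestor. For `i = j` the path
is the single vertex `i`. (The value for a missing common ancestor is arbitrary: that case does not
occur if all answers are correct.) -/
def multidirPath (vs : List V) (i j : V) : Prog V (List V × ℕ) :=
  if i = j then pure ([i], 0)
  else do
    let b ← ask i j
    if b then
      let mid ← nodesBetween i j vs
      let mid ← sortNodes mid
      pure (i :: (mid ++ [j]), 0)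
    else
      let c ← ask j i
      if c then
        let mid ← nodesBetween j i vs
        let mid ← sortNodes mid
        pure (j :: (mid ++ [i]), 0)
      else
        let anc ← findCommonAncestor vs i j
        match anc with
        | none => pure ([i], 0)
        | some a =>
          let left ← nodesBetween a i vs
          let left ← sortNodes left
          let right ← nodesBetween a j vs
          let right ← sortNodes right
          spend (left.length + right.length)
          pure (i :: (left.reverse ++ a :: (right ++ [j])), left.length + 1)

/-- The binary search of `findBag`, between the positions `l` and `r`. -/
def findBagLoop (path : List V) (k : V) (l r : ℕ) : Prog V ℕ :=
  if _h : l + 1 < r then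
    match path[(l + r) / 2]? with
    | none => pure l
    | some x => do
        spend 1
        let b ← ask x k
        if b then findBagLoop path k ((l + r) / 2) r
        else findBagLoop path k l ((l + r) / 2)
  else pure l
termination_by r - l
decreasing_by all_goals omega

/-- Find bag: binary search for the last position on a directed path whose vertex is an ancestor
of `k` (position `0` if there is none). -/
def findBag (path : List V) (k : V) : Prog V ℕ := findBagLoop path k 0 path.length

/-- The array of bag sizes, where `a` is the position of the lowest common ancestor on `path`.
The search in the reversed left part of the path counts positions backwards from `a`. -/
def bagSizes (path : List V) (a : ℕ) : List V → List ℕ → Prog V (List ℕ)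
  | [], size => pure size
  | k :: ks, size => do
      spend 1
      if k ∈ path then bagSizes path a ks size
      else
        let l ← findBag (path.take (a + 1)).reverse k
        let r ← findBag (path.drop a) k
        bagSizes path a ks (size.modify (if l = 0 then a + r else a - l) (· + 1))

/-- Scan the edges of the path, from position `r` on, for the first one that splits the `n`
vertices evenly; `leftsize` is the size of the bags before position `r`. The edge is returned with
its direction in the tree, which is towards smaller positions before the lowest common ancestor
`a`, and towards larger ones from there on. -/
def findSeparator (n d a : ℕ) : ℕ → ℕ → List V → List ℕ → Option (V × V)
  | r, leftsize, x :: y :: xs, b :: bs =>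
      if ⌊(n : ℚ) / d⌋ ≤ ((leftsize + b : ℕ) : ℤ) ∧
          ((leftsize + b : ℕ) : ℤ) ≤ ⌈((d : ℚ) - 1) * n / d⌉ then
        some (if r < a then (y, x) else (x, y))
      else findSeparator n d a (r + 1) (leftsize + b) (y :: xs) bs
  | _, _, _, _ => none

/-- Split tree: the pair `(V₁, V₂)`, where `V₂` contains `j` and the vertices `k` for which
`(j, k)` is answered with `true`, and `V₁` the others. -/
def splitTree (j : V) : List V → Prog V (List V × List V)
  | [] => pure ([], [])
  | k :: ks => do
      spend 1
      if k = j then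
        let s ← splitTree j ks
        pure (s.1, k :: s.2)
      else
        let b ← ask j k
        let s ← splitTree j ks
        pure (if b then (s.1, k :: s.2) else (k :: s.1, s.2))

/-- One round: draw two vertices, reconstruct the multidirectional path between them, and look for
an even separator on it. -/
def searchRound (d : ℕ) (vs : List V) : Prog V (Option (V × V)) := do
  let i ← draw vs
  let j ← draw vs
  let (path, a) ← multidirPath vs i j
  spend path.length
  let size ← bagSizes path a vs (List.replicate path.length 1)
  spend path.length
  pure (findSeparator vs.length d a 0 0 path size)

/-- Reconstruct tree, run with at most `fuel` nested iterations of the loop and recursive calls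
(without output if these do not suffice). A round that finds no even separator is repeated on the
same vertex set. -/
def reconstructTree (d : ℕ) : ℕ → List V → Prog V (Finset (V × V))
  | 0, _ => .abort
  | fuel + 1, vs => do
      spend 1
      if vs.length = 1 then pure ∅
      else
        let sep ← searchRound d vs
        match sep with
        | none => reconstructTree d fuel vs
        | some e =>
          let (V₁, V₂) ← splitTree e.2 vs
          let E₁ ← reconstructTree d fuel V₁
          let E₂ ← reconstructTree d fuel V₂
          spend vs.length
          pure (E₁ ∪ E₂ ∪ {e})

end Algorithm

/-! ### Reconstruction from noisy queries -/

section Noisy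

variable {V : Type} [Fintype V] [DecidableEq V]

/-- The joint law, over the noise and the random draws, of the outcome of reconstructing the tree
with edge set `E` from noisy queries, by running `reconstructTree` on the majority votes over `m`
noisy queries per node pair. -/
noncomputable def reconstructNoisyTree (E : Finset (V × V)) (ε : unitInterval) (m d : ℕ)
    (vs : List V) (fuel : ℕ) : PMF (Option (Outcome (Finset (V × V)))) :=
  (noiseLaw ε (Fin m × V × V)).bind fun η =>
    (reconstructTree d fuel vs).run (majority (noisyPathQuery E η)) m

/-- The probability that this algorithm, without a bound on the number of iterations, halts with an
outcome in `S`. -/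
noncomputable def probHalts (E : Finset (V × V)) (ε : unitInterval) (m d : ℕ) (vs : List V)
    (S : Set (Outcome (Finset (V × V)))) : ℝ≥0∞ :=
  ⨆ fuel : ℕ, (reconstructNoisyTree E ε m d vs fuel).toOuterMeasure (some '' S)

end Noisy

/-- The number of queries per node pair, up to a constant factor. -/
noncomputable def voteScale (n d : ℕ) (ε δ : ℝ) : ℝ :=
  1 / (1 / 2 - ε) ^ 2 * (Real.log d + Real.log n + Real.log (1 / δ))

/-- The complexity, up to a constant factor. -/
noncomputable def costScale (n d : ℕ) (ε δ : ℝ) : ℝ :=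
  1 / δ * (1 / (1 / 2 - ε) ^ 2) * (d * n * Real.log n ^ 2) *
    (Real.log d + Real.log n + Real.log (1 / δ))

end TreeQuery

/-!
The proof separates the noise from the random draws of the algorithm.

*Noise.* A majority vote on one pair of vertices is wrong only if at least half of the `m` answers
are flipped, which by Chernoff's bound has probability at most `exp (-2 (1/2 - ε)² m)`
(`mean_wrong_vote_le`). By the choice of `m`, the union bound over all pairs leaves a total
probability of at most `δ / 4` (`mean_wrong_votes_le`, `wrong_votes_bound_le`). If all votes are
right, then the algorithm runs with correct answers, and anything it outputs is the edge set
(`IsRootedTree.sound_reconstructTree`). It remains to bound its cost and to see that it halts.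

*One round.* With correct answers, a round on the vertex set `S` costs `O(|S| log |S|)` queries,
and it finds an edge exactly if some even separator lies on the path between the two drawn
vertices (`IsRootedTree.exists_yields_roundFrom`). Let `M` be the total size of those branches at a
centroid of `S` that have at least `|S| / d` vertices. Each of these branches is cut off by an even
separator, so a round succeeds with probability at least of the order of `M / |S|`, and `M / |S|`
is at least of the order of `1 / d`. The mean cost of the rounds spent on `S` is the cost of one
round divided by this probability.

*Amortization.* Even separators may be quite uneven: one part may have as few as `|S| / d`
vertices. The potential is the entropy `N log N`, which decreases by at least `a log (N / a)` when
`N` vertices are cut into parts of sizes `a ≤ N / 2` and `N - a`, hence by the order of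
`(N / d) log d` in the worst case. If every cut needed `d` rounds, then paying for them in this
way would lose a factor `d / log d`. If `M` is a constant fraction of `|S|`, a constant number of
rounds suffices on average, and `d` times the entropy gain of a single cut pays for them. Otherwise
the tree `S` is called bad, and nearly all of its mass lies in small branches at the centroid.
Then consider the next cuts, about `d / 64` in number, of the part that contains the
centroid; this part keeps most of the vertices. Let `t` be a time `k` cuts before the last bad time
of this stretch. Each cut touches one branch, so at least `d / 2` of the branches that are small at
the last bad time have not been touched since time `t`. They are smaller than the later threshold,
and therefore the order of `k |S| / d` vertices that are cut off in between force `M` to be of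
order `k |S| / d` at time `t` (`CutSteps.largeMass_before_bad`). So the waiting times sum to a
harmonic series `O(d log d)` (`CutSteps.sum_waiting_le`), at a cost proportional to
`d |S| log d`, which the entropy gain of this stretch of cuts, times `d`, pays for. The result is
the bound `O(d n log n)` for the mean of the sum of `|S|` over all rounds
(`IsRootedTree.decompositionWeight_le`).

*Conclusion.* The mean cost with correct answers is `O(m d n log² n)`
(`IsRootedTree.mean_cost_le`). The probability of exceeding a given number of nested iterations
tends to `0` geometrically (`IsRootedTree.abort_le`), because each round succeeds with probability
at least `1 / n²`. By Markov's inequality, the cost exceeds `4 / δ` times its mean with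
probability at most `δ / 4` (`IsRootedTree.one_le_run_add`).
-/

namespace TreeQuery

/-! ### The ancestor order of a rooted tree -/

section Order

variable {V : Type} {E : Finset (V × V)}

/-- The weak ancestor relation: there is a directed path, possibly without edges. -/
def AncEq (E : Finset (V × V)) : V → V → Prop :=
  Relation.ReflTransGen fun a b => (a, b) ∈ E

lemma AncEq.refl (i : V) : AncEq E i i := Relation.ReflTransGen.refl

lemma AncEq.trans {i j k : V} (h : AncEq E i j) (h' : AncEq E j k) : AncEq E i k :=
  Relation.ReflTransGen.trans h h'

lemma IsRootedTree.parent_unique (hE : IsRootedTree E) {u u' v : V} (h : (u, v) ∈ E)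
    (h' : (u', v) ∈ E) : u = u' := by
  obtain ⟨root, h0, h1, -⟩ := hE
  by_cases hv : v = root
  · exact absurd (hv ▸ h) (h0 u)
  · exact (h1 v hv).unique h h'

/-- The ancestors of a vertex form a chain. -/
lemma IsRootedTree.ancEq_total (hE : IsRootedTree E) {i j k : V} (hi : AncEq E i k)
    (hj : AncEq E j k) : AncEq E i j ∨ AncEq E j i := by
  have hU : Relator.RightUnique (Function.swap fun a b => (a, b) ∈ E) :=
    fun _ _ _ h h' => hE.parent_unique h h'
  have := Relation.ReflTransGen.total_of_right_unique hU (Relation.reflTransGen_swap.2 hi)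
    (Relation.reflTransGen_swap.2 hj)
  exact (this.imp Relation.reflTransGen_swap.1 Relation.reflTransGen_swap.1).symm

/-- A rooted tree has no directed cycles, by induction along the path from the root. -/
lemma IsRootedTree.irrefl (hE : IsRootedTree E) (v : V) :
    ¬ Relation.TransGen (fun a b => (a, b) ∈ E) v v := by
  have hE' := hE
  obtain ⟨root, h0, -, h2⟩ := hE'
  induction h2 v with
  | refl =>
    intro h
    obtain ⟨c, -, hc⟩ := Relation.TransGen.tail'_iff.1 h
    exact h0 _ hc
  | tail _ huv ih =>
    intro h
    obtain ⟨c, hc, hcv⟩ := Relation.TransGen.tail'_iff.1 h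
    obtain rfl := hE.parent_unique hcv huv
    exact ih (Relation.TransGen.head' huv hc)

lemma IsRootedTree.ancEq_antisymm (hE : IsRootedTree E) {i j : V} (h : AncEq E i j)
    (h' : AncEq E j i) : i = j := by
  rcases Relation.reflTransGen_iff_eq_or_transGen.1 h with h1 | h1
  · exact h1.symm
  · exact absurd (h1.trans_left h') (hE.irrefl i)

lemma IsRootedTree.transGen_iff (hE : IsRootedTree E) {i j : V} :
    Relation.TransGen (fun a b => (a, b) ∈ E) i j ↔ AncEq E i j ∧ i ≠ j := by
  constructor
  · intro h
    exact ⟨h.to_reflTransGen, fun hij => hE.irrefl j (hij ▸ h)⟩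
  · rintro ⟨h, hij⟩
    rcases Relation.reflTransGen_iff_eq_or_transGen.1 h with h1 | h1
    · exact absurd h1.symm hij
    · exact h1

lemma IsRootedTree.pathQuery_iff (hE : IsRootedTree E) {i j : V} :
    pathQuery E i j = true ↔ AncEq E i j ∧ i ≠ j := by
  rw [← hE.transGen_iff]
  simp [pathQuery]

lemma IsRootedTree.ancEq_iff (hE : IsRootedTree E) {i j : V} :
    AncEq E i j ↔ pathQuery E i j = true ∨ i = j := by
  rw [hE.pathQuery_iff]
  constructor
  · intro h
    by_cases hij : i = j
    · exact Or.inr hij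
    · exact Or.inl ⟨h, hij⟩
  · rintro (h | rfl)
    · exact h.1
    · exact AncEq.refl i

/-- A pair of vertices with nothing in between is an edge. -/
lemma IsRootedTree.edge_of_covers (hE : IsRootedTree E) {i j : V} (h : AncEq E i j) (hij : i ≠ j)
    (hc : ∀ z, AncEq E i z → AncEq E z j → z = i ∨ z = j) : (i, j) ∈ E := by
  obtain ⟨c, hic, hcj⟩ := Relation.TransGen.tail'_iff.1 (hE.transGen_iff.2 ⟨h, hij⟩)
  rcases hc c hic (Relation.ReflTransGen.single hcj) with rfl | rfl
  · exact hcj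
  · exact absurd (Relation.TransGen.single hcj) (hE.irrefl _)

lemma IsRootedTree.edge_ne (hE : IsRootedTree E) {u v : V} (h : (u, v) ∈ E) : u ≠ v := fun huv =>
  hE.irrefl v (Relation.TransGen.single (huv ▸ h))

lemma AncEq.of_edge {u v : V} (h : (u, v) ∈ E) : AncEq E u v := Relation.ReflTransGen.single h

/-- A proper ancestor of `v` is a weak ancestor of the parent of `v`. -/
lemma IsRootedTree.ancEq_parent (hE : IsRootedTree E) {u v w : V} (h : (u, v) ∈ E)
    (hw : AncEq E w v) (hwv : w ≠ v) : AncEq E w u := by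
  obtain ⟨c, hc, hcv⟩ := Relation.TransGen.tail'_iff.1 (hE.transGen_iff.2 ⟨hw, hwv⟩)
  exact hE.parent_unique hcv h ▸ hc

/-- A subtree: a set of vertices with a root, closed under taking paths from the root. -/
def IsSubtree (E : Finset (V × V)) (S : Finset V) : Prop :=
  ∃ r ∈ S, ∀ v ∈ S, AncEq E r v ∧ ∀ z, AncEq E r z → AncEq E z v → z ∈ S

lemma IsSubtree.nonempty {S : Finset V} (hS : IsSubtree E S) : S.Nonempty :=
  let ⟨r, hr, _⟩ := hS; ⟨r, hr⟩

lemma IsSubtree.card_pos {S : Finset V} (hS : IsSubtree E S) : 0 < S.card :=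
  Finset.card_pos.2 hS.nonempty

/-- Subtrees are convex. -/
lemma IsSubtree.convex {S : Finset V} (hS : IsSubtree E S) {i j z : V} (hi : i ∈ S) (hj : j ∈ S)
    (h : AncEq E i z) (h' : AncEq E z j) : z ∈ S := by
  obtain ⟨r, -, h1⟩ := hS
  exact (h1 j hj).2 z ((h1 i hi).1.trans h) h'

lemma IsRootedTree.isSubtree_univ [Fintype V] (hE : IsRootedTree E) :
    IsSubtree E Finset.univ := by
  obtain ⟨root, -, -, h2⟩ := hE
  exact ⟨root, Finset.mem_univ _, fun v _ => ⟨h2 v, fun _ _ _ => Finset.mem_univ _⟩⟩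

open Classical in
/-- The part of `S` below `v`, including `v`. -/
noncomputable def below (E : Finset (V × V)) (S : Finset V) (v : V) : Finset V :=
  S.filter fun k => AncEq E v k

open Classical in
/-- The part of `S` that is not below `v`. -/
noncomputable def rest (E : Finset (V × V)) (S : Finset V) (v : V) : Finset V :=
  S.filter fun k => ¬ AncEq E v k

@[simp] lemma mem_below {S : Finset V} {v k : V} : k ∈ below E S v ↔ k ∈ S ∧ AncEq E v k := by
  simp [below]

@[simp] lemma mem_rest {S : Finset V} {v k : V} : k ∈ rest E S v ↔ k ∈ S ∧ ¬ AncEq E v k := by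
  simp [rest]

lemma card_below_add_card_rest (S : Finset V) (v : V) :
    (below E S v).card + (rest E S v).card = S.card := by
  classical
  exact Finset.card_filter_add_card_filter_not (s := S) (fun k => AncEq E v k)

lemma IsSubtree.below {S : Finset V} (hS : IsSubtree E S) {v : V} (hv : v ∈ S) :
    IsSubtree E (below E S v) := by
  refine ⟨v, by simp [hv, AncEq.refl], fun k hk => ?_⟩
  rw [mem_below] at hk
  refine ⟨hk.2, fun z hz hz' => mem_below.2 ⟨hS.convex hv hk.1 hz hz', hz⟩⟩

lemma IsSubtree.rest {S : Finset V} (hS : IsSubtree E S) {v : V}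
    (h : (rest E S v).Nonempty) : IsSubtree E (rest E S v) := by
  obtain ⟨r, hr, h1⟩ := id hS
  obtain ⟨k, hk⟩ := h
  rw [mem_rest] at hk
  refine ⟨r, mem_rest.2 ⟨hr, fun h => hk.2 (h.trans (h1 k hk.1).1)⟩, fun w hw => ?_⟩
  rw [mem_rest] at hw
  exact ⟨(h1 w hw.1).1, fun z hz hz' =>
    mem_rest.2 ⟨(h1 w hw.1).2 z hz hz', fun h => hw.2 (h.trans hz')⟩⟩

open Classical in
/-- The edges of the tree with both ends in `S`. -/
noncomputable def inducedEdges (E : Finset (V × V)) (S : Finset V) : Finset (V × V) :=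
  E.filter fun e => e.1 ∈ S ∧ e.2 ∈ S

lemma mem_inducedEdges {S : Finset V} {u v : V} :
    (u, v) ∈ inducedEdges E S ↔ (u, v) ∈ E ∧ u ∈ S ∧ v ∈ S := by
  simp [inducedEdges]

/-- Cutting an edge leaves the induced edges of the two parts and the edge itself. -/
lemma IsRootedTree.inducedEdges_split [DecidableEq V] (hE : IsRootedTree E) {S : Finset V}
    {u v : V} (h : (u, v) ∈ E) (hu : u ∈ S) (hv : v ∈ S) :
    inducedEdges E (rest E S v) ∪ inducedEdges E (below E S v) ∪ {(u, v)} = inducedEdges E S := by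
  ext ⟨x, y⟩
  simp only [Finset.mem_union, mem_inducedEdges, mem_rest, mem_below, Finset.mem_singleton,
    Prod.mk.injEq]
  constructor
  · rintro ((h1 | h1) | ⟨rfl, rfl⟩)
    · exact ⟨h1.1, h1.2.1.1, h1.2.2.1⟩
    · exact ⟨h1.1, h1.2.1.1, h1.2.2.1⟩
    · exact ⟨h, hu, hv⟩
  · rintro ⟨h1, hx, hy⟩
    by_cases hvy : AncEq E v y
    · by_cases hyv : y = v
      · subst hyv
        exact Or.inr ⟨hE.parent_unique h1 h, rfl⟩
      · have := hE.ancEq_parent h1 hvy (Ne.symm hyv)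
        exact Or.inl (Or.inr ⟨h1, ⟨hx, this⟩, hy, hvy⟩)
    · exact Or.inl (Or.inl ⟨h1, ⟨hx, fun h' => hvy (h'.trans (AncEq.of_edge h1))⟩, hy, hvy⟩)

/-- `v` is the lower end of an edge of `S` whose removal leaves two parts with at least
`⌊|S| / d⌋` vertices each; that `v` is not the root of `S`, so that there is such an edge, is
expressed by the strict inequality. -/
def IsEven (E : Finset (V × V)) (d : ℕ) (S : Finset V) (v : V) : Prop :=
  v ∈ S ∧ (below E S v).card < S.card ∧ S.card / d ≤ (below E S v).card ∧
    (below E S v).card ≤ S.card - S.card / d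

lemma IsEven.rest_card_pos {d : ℕ} {S : Finset V} {v : V} (h : IsEven E d S v) :
    0 < (TreeQuery.rest E S v).card := by
  have := card_below_add_card_rest (E := E) S v
  have := h.2.1
  omega

lemma IsEven.below_card_pos {d : ℕ} {S : Finset V} {v : V} (h : IsEven E d S v) :
    0 < (TreeQuery.below E S v).card :=
  Finset.card_pos.2 ⟨v, by simp [h.1, AncEq.refl]⟩

lemma IsEven.rest_card_lt {d : ℕ} {S : Finset V} {v : V} (h : IsEven E d S v) :
    (TreeQuery.rest E S v).card < S.card := by
  have := card_below_add_card_rest (E := E) S v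
  have := h.below_card_pos
  omega

lemma IsEven.isSubtree_below {d : ℕ} {S : Finset V} {v : V} (hS : IsSubtree E S)
    (h : IsEven E d S v) : IsSubtree E (TreeQuery.below E S v) := hS.below h.1

lemma IsEven.isSubtree_rest {d : ℕ} {S : Finset V} {v : V} (hS : IsSubtree E S)
    (h : IsEven E d S v) : IsSubtree E (TreeQuery.rest E S v) :=
  hS.rest (Finset.card_pos.1 h.rest_card_pos)

/-! ### The branches at a vertex -/

open Classical in
/-- The labels of the branches at `c`: the children of `c`, and `none` for the branch that
contains the parent of `c`. -/
noncomputable def branchLabels (E : Finset (V × V)) (c : V) : Finset (Option V) :=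
  ((E.filter fun e => e.1 = c).image fun e => some e.2) ∪
    ((E.filter fun e => e.2 = c).image fun _ => none)

/-- The vertex `k` belongs to the branch at `c` with the given label. -/
def InBranch (E : Finset (V × V)) (c : V) : Option V → V → Prop
  | some v, k => AncEq E v k
  | none, k => ¬ AncEq E c k

open Classical in
/-- The part of `S` in a branch at `c`. -/
noncomputable def branch (E : Finset (V × V)) (c : V) (S : Finset V) (x : Option V) : Finset V :=
  S.filter fun k => InBranch E c x k

lemma mem_branch {c : V} {S : Finset V} {x : Option V} {k : V} :
    k ∈ branch E c S x ↔ k ∈ S ∧ InBranch E c x k := by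
  simp [branch]

lemma some_mem_branchLabels {c v : V} : some v ∈ branchLabels E c ↔ (c, v) ∈ E := by
  simp [branchLabels]

lemma none_mem_branchLabels {c : V} : none ∈ branchLabels E c ↔ ∃ u, (u, c) ∈ E := by
  simp [branchLabels]

open Classical in
lemma card_branchLabels_le_classical (c : V) : (branchLabels E c).card ≤ degree E c :=
  (Finset.card_union_le _ _).trans
    (Nat.add_le_add Finset.card_image_le Finset.card_image_le)

lemma card_branchLabels_le [DecidableEq V] (c : V) : (branchLabels E c).card ≤ degree E c := by
  convert card_branchLabels_le_classical c

lemma IsRootedTree.inBranch_unique (hE : IsRootedTree E) {c k : V} {x y : Option V}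
    (hx : x ∈ branchLabels E c) (hy : y ∈ branchLabels E c) (hkx : InBranch E c x k)
    (hky : InBranch E c y k) : x = y := by
  have key : ∀ v w, (c, v) ∈ E → (c, w) ∈ E → AncEq E v k → AncEq E w k → AncEq E v w → v = w := by
    intro v w hv hw hvk hwk hvw
    by_contra hne
    have h1 := hE.ancEq_parent hw hvw hne
    exact hE.edge_ne hv (hE.ancEq_antisymm (AncEq.of_edge hv) h1)
  cases x with
  | none =>
    cases y with
    | none => rfl
    | some w =>
      rw [some_mem_branchLabels] at hy
      exact absurd ((AncEq.of_edge hy).trans hky) hkx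
  | some v =>
    rw [some_mem_branchLabels] at hx
    cases y with
    | none => exact absurd ((AncEq.of_edge hx).trans hkx) hky
    | some w =>
      rw [some_mem_branchLabels] at hy
      rcases hE.ancEq_total hkx hky with h | h
      · exact congrArg some (key v w hx hy hkx hky h)
      · exact congrArg some (key w v hy hx hky hkx h).symm

lemma IsRootedTree.not_inBranch_self (hE : IsRootedTree E) {c : V} {x : Option V}
    (hx : x ∈ branchLabels E c) : ¬ InBranch E c x c := by
  cases x with
  | none => exact fun h => h (AncEq.refl c)
  | some v =>
    rw [some_mem_branchLabels] at hx
    exact fun h => hE.edge_ne hx (hE.ancEq_antisymm (AncEq.of_edge hx) h)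

lemma IsRootedTree.exists_inBranch (hE : IsRootedTree E) {c k : V} (hk : k ≠ c) :
    ∃ x ∈ branchLabels E c, InBranch E c x k := by
  by_cases h : AncEq E c k
  · obtain ⟨v, hcv, hvk⟩ := Relation.TransGen.head'_iff.1 (hE.transGen_iff.2 ⟨h, hk.symm⟩)
    exact ⟨some v, some_mem_branchLabels.2 hcv, hvk⟩
  · refine ⟨none, none_mem_branchLabels.2 ?_, h⟩
    obtain ⟨root, h0, h1, h2⟩ := hE
    by_cases hc : c = root
    · exact absurd (hc ▸ h2 k) h
    · exact (h1 c hc).exists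

/-- The branches at `c` partition the other vertices. -/
lemma IsRootedTree.sum_card_branch (hE : IsRootedTree E) {c : V} {S : Finset V} (hc : c ∈ S) :
    ∑ x ∈ branchLabels E c, (branch E c S x).card + 1 = S.card := by
  classical
  rw [← Finset.card_biUnion, ← Finset.card_erase_add_one hc]
  · congr 2
    ext k
    simp only [Finset.mem_biUnion, mem_branch, Finset.mem_erase]
    constructor
    · rintro ⟨x, hx, hkS, hk⟩
      exact ⟨fun h => hE.not_inBranch_self hx (h ▸ hk), hkS⟩
    · rintro ⟨hk, hkS⟩
      obtain ⟨x, hx, h⟩ := hE.exists_inBranch hk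
      exact ⟨x, hx, hkS, h⟩
  · intro x hx y hy hxy
    rw [Function.onFun, Finset.disjoint_left]
    intro k hkx hky
    exact hxy (hE.inBranch_unique hx hy (mem_branch.1 hkx).2 (mem_branch.1 hky).2)

/-- The part without `c` that an even split cuts off lies in one branch at `c`. -/
lemma IsRootedTree.rest_inBranch (hE : IsRootedTree E) {c v : V} {S : Finset V}
    (hne : (rest E S v).Nonempty) (h : AncEq E v c) :
    ∃ x ∈ branchLabels E c, ∀ k ∈ rest E S v, InBranch E c x k := by
  obtain ⟨k, hk⟩ := hne
  have hk' : ∀ k ∈ rest E S v, InBranch E c none k := fun k hk h' =>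
    (mem_rest.1 hk).2 (h.trans h')
  obtain ⟨x, hx, hx'⟩ := hE.exists_inBranch (c := c) (k := k) fun hkc =>
    hk' k hk (hkc ▸ AncEq.refl _)
  refine ⟨none, ?_, hk'⟩
  cases x with
  | none => exact hx
  | some w =>
    exact absurd ((AncEq.of_edge (some_mem_branchLabels.1 hx)).trans hx') (hk' k hk)

lemma IsRootedTree.below_inBranch (hE : IsRootedTree E) {c v : V} {S : Finset V}
    (h : ¬ AncEq E v c) :
    ∃ x ∈ branchLabels E c, ∀ k ∈ below E S v, InBranch E c x k := by
  obtain ⟨x, hx, hx'⟩ := hE.exists_inBranch (c := c) (k := v) fun hvc => h (hvc ▸ AncEq.refl _)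
  refine ⟨x, hx, fun k hk => ?_⟩
  have hvk := (mem_below.1 hk).2
  cases x with
  | none =>
    intro hck
    rcases hE.ancEq_total hvk hck with h' | h'
    · exact h h'
    · exact hx' h'
  | some w => exact AncEq.trans hx' hvk

/-- A vertex all of whose branches have at most half of the vertices. -/
lemma IsRootedTree.exists_centroid (hE : IsRootedTree E) {S : Finset V} (hS : IsSubtree E S) :
    ∃ c ∈ S, ∀ x ∈ branchLabels E c, 2 * (branch E c S x).card ≤ S.card := by
  classical
  obtain ⟨r, hr, h1⟩ := id hS
  -- the lowest vertex that has at least half of the vertices below it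
  obtain ⟨c, hc, hmin⟩ := Finset.exists_min_image
    (S.filter fun v => S.card ≤ 2 * (below E S v).card) (fun v => (below E S v).card)
    ⟨r, by
      have : below E S r = S := by
        ext k; simpa using fun hk => (h1 k hk).1
      simp only [Finset.mem_filter, this, hr, true_and]; omega⟩
  rw [Finset.mem_filter] at hc
  refine ⟨c, hc.1, fun x hx => ?_⟩
  cases x with
  | none =>
    have h2 := card_below_add_card_rest (E := E) S c
    have h3 : branch E c S none = rest E S c := by
      ext k; simp [mem_branch, InBranch]
    rw [h3]; omega
  | some v =>
    have hcv := some_mem_branchLabels.1 hx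
    have h3 : branch E c S (some v) = below E S v := by
      ext k; simp [mem_branch, InBranch]
    rw [h3]
    by_contra! hlt
    obtain ⟨k, hk⟩ : (below E S v).Nonempty := Finset.card_pos.1 (by omega)
    have hvS : v ∈ S := hS.convex hc.1 (mem_below.1 hk).1 (AncEq.of_edge hcv) (mem_below.1 hk).2
    have := hmin v (Finset.mem_filter.2 ⟨hvS, hlt.le⟩)
    have hlt' : (below E S v).card < (below E S c).card := by
      refine Finset.card_lt_card ⟨fun k hk => ?_, fun hsub => ?_⟩
      · rw [mem_below] at hk ⊢
        exact ⟨hk.1, (AncEq.of_edge hcv).trans hk.2⟩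
      · have := hsub (mem_below.2 ⟨hc.1, AncEq.refl c⟩)
        exact hE.not_inBranch_self hx (mem_below.1 this).2
    omega

/-- The edge between `c` and a branch of even size is an even separator: it separates the
vertices of the branch from the others. -/
lemma IsRootedTree.exists_even_of_branch (hE : IsRootedTree E) {d : ℕ} {c : V}
    {S : Finset V} (hS : IsSubtree E S) (hc : c ∈ S) {x : Option V} (hx : x ∈ branchLabels E c)
    (h0 : 0 < (branch E c S x).card) (h1 : S.card / d ≤ (branch E c S x).card)
    (h2 : (branch E c S x).card ≤ S.card - S.card / d) :
    ∃ v, IsEven E d S v ∧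
      ∀ i j, InBranch E c x i → ¬ InBranch E c x j → ¬ (AncEq E v i ↔ AncEq E v j) := by
  have hlt : (branch E c S x).card < S.card :=
    Finset.card_lt_card ⟨fun k hk => (mem_branch.1 hk).1, fun hsub =>
      hE.not_inBranch_self hx (mem_branch.1 (hsub hc)).2⟩
  cases x with
  | none =>
    have h2' := card_below_add_card_rest (E := E) S c
    have h3 : branch E c S none = rest E S c := by
      ext k; simp [mem_branch, InBranch]
    rw [h3] at h0 h1 h2
    have := Nat.div_le_self S.card d
    refine ⟨c, ⟨hc, by omega, by omega, by omega⟩, fun i j hi hj h => ?_⟩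
    exact hj fun hcj => hi (h.2 hcj)
  | some v =>
    have hcv := some_mem_branchLabels.1 hx
    have h3 : branch E c S (some v) = below E S v := by
      ext k; simp [mem_branch, InBranch]
    rw [h3] at h0 h1 h2 hlt
    obtain ⟨k, hk⟩ := Finset.card_pos.1 h0
    have hvS : v ∈ S := hS.convex hc (mem_below.1 hk).1 (AncEq.of_edge hcv) (mem_below.1 hk).2
    exact ⟨v, ⟨hvS, hlt, h1, h2⟩, fun i j hi hj h => hj (h.1 hi)⟩

end Order

/-! ### Sizes of the branches along a sequence of cuts -/

section Sizes

variable {ι : Type} {I : Finset ι} {d : ℕ}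

/-- The number of vertices of a tree, from the sizes `b` of the branches at one of its vertices. -/
def treeSize (I : Finset ι) (b : ι → ℕ) : ℕ := ∑ x ∈ I, b x + 1

/-- The total size of the branches with at least `⌊N / d⌋` vertices, where `N` is the size of the
tree. -/
def largeMass (d : ℕ) (I : Finset ι) (b : ι → ℕ) : ℕ :=
  ∑ x ∈ I with treeSize I b / d ≤ b x, b x

lemma largeMass_add_small (b : ι → ℕ) :
    largeMass d I b + ∑ x ∈ I with ¬ treeSize I b / d ≤ b x, b x + 1 = treeSize I b := by
  rw [largeMass, Finset.sum_filter_add_sum_filter_not, treeSize]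

lemma natDiv_le_real (N d : ℕ) : ((N / d : ℕ) : ℝ) ≤ (N : ℝ) / d := Nat.cast_div_le

lemma half_div_le_natDiv {N d : ℕ} (hd : 0 < d) (h : d ≤ N) :
    (N : ℝ) / (2 * d) ≤ ((N / d : ℕ) : ℝ) := by
  have h1 : N < d * (N / d) + d := by
    have := Nat.div_add_mod N d
    have := Nat.mod_lt N hd
    omega
  have h2 : 1 ≤ N / d := (Nat.one_le_div_iff hd).2 h
  have h3 : d ≤ d * (N / d) := Nat.le_mul_of_pos_right _ h2
  rw [div_le_iff₀ (by positivity)]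
  have h4 : N ≤ 2 * (d * (N / d)) := by omega
  have h5 : (N : ℝ) ≤ 2 * (d * ((N / d : ℕ) : ℝ)) := by exact_mod_cast h4
  linarith

/-- By averaging over at most `d` branches, some branch is large. -/
lemma div_le_largeMass (hd : 2 ≤ d) (hI : I.card ≤ d) (b : ι → ℕ) :
    treeSize I b / d ≤ largeMass d I b := by
  by_contra! hlt
  have hno : ∀ x ∈ I, b x < treeSize I b / d := by
    intro x hx
    by_contra! h
    have : b x ≤ largeMass d I b :=
      Finset.single_le_sum (f := b) (fun _ _ => Nat.zero_le _) (Finset.mem_filter.2 ⟨hx, h⟩)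
    omega
  set θ := treeSize I b / d with hθ
  have h1 : ∑ x ∈ I, b x ≤ d * (θ - 1) := by
    calc ∑ x ∈ I, b x ≤ ∑ x ∈ I, (θ - 1) := Finset.sum_le_sum fun x hx => by
          have := hno x hx; omega
      _ = I.card * (θ - 1) := by simp
      _ ≤ _ := Nat.mul_le_mul_right _ hI
  have h2 : d * θ ≤ treeSize I b := Nat.mul_div_le _ _
  have h3 : treeSize I b = ∑ x ∈ I, b x + 1 := rfl
  obtain ⟨k, hk⟩ : ∃ k, θ = k + 1 := ⟨θ - 1, by omega⟩
  rw [hk] at h1 h2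
  simp only [Nat.add_sub_cancel] at h1
  rw [mul_add] at h2
  omega

/-- If many branches `U` are just as large as they are in a smaller tree where they count as
small, then the other branches contain much of the larger tree. -/
lemma card_mul_le_largeMass {b b' : ι → ℕ} {U : Finset ι} (hd : 0 < d) (hI : I.card ≤ d)
    (hU : U ⊆ I) (heq : ∀ x ∈ U, b x = b' x) (hsmall : ∀ x ∈ U, b' x < treeSize I b' / d)
    (hle : treeSize I b' ≤ treeSize I b) (hdN : d ≤ treeSize I b) :
    (U.card : ℝ) * ((treeSize I b : ℝ) - treeSize I b') ≤ d * largeMass d I b := by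
  classical
  set N := treeSize I b with hN
  set N' := treeSize I b' with hN'
  set Z := I.filter fun x => ¬ N / d ≤ b x with hZ
  have hdR : (0 : ℝ) < d := by exact_mod_cast hd
  have hUZ : U ⊆ Z := fun x hx => by
    refine Finset.mem_filter.2 ⟨hU hx, ?_⟩
    have h1 := hsmall x hx
    have h2 : N' / d ≤ N / d := Nat.div_le_div_right hle
    rw [heq x hx]; omega
  have hsum : (largeMass d I b : ℝ) + ∑ x ∈ Z, (b x : ℝ) + 1 = N := by
    exact_mod_cast largeMass_add_small (d := d) (I := I) b
  have h1 : ∑ x ∈ U, (b x : ℝ) ≤ U.card * ((N' : ℝ) / d - 1) := by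
    rw [← nsmul_eq_mul, ← Finset.sum_const]
    refine Finset.sum_le_sum fun x hx => ?_
    have h2 : ((b' x + 1 : ℕ) : ℝ) ≤ ((N' / d : ℕ) : ℝ) := by exact_mod_cast hsmall x hx
    have h3 := natDiv_le_real N' d
    rw [heq x hx]; push_cast at h2; linarith
  have h2 : ∑ x ∈ Z \ U, (b x : ℝ) ≤ (Z \ U).card * ((N : ℝ) / d - 1) := by
    rw [← nsmul_eq_mul, ← Finset.sum_const]
    refine Finset.sum_le_sum fun x hx => ?_
    have hx' := (Finset.mem_filter.1 (Finset.mem_sdiff.1 hx).1).2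
    have h2 : ((b x + 1 : ℕ) : ℝ) ≤ ((N / d : ℕ) : ℝ) := by
      exact_mod_cast (by omega : b x + 1 ≤ N / d)
    have h3 := natDiv_le_real N d
    push_cast at h2; linarith
  have hcard : (Z \ U).card + U.card ≤ d := by
    rw [Finset.card_sdiff_add_card_eq_card hUZ]
    exact (Finset.card_filter_le _ _).trans hI
  have hcard' : ((Z \ U).card : ℝ) ≤ d - U.card := by
    have : (((Z \ U).card + U.card : ℕ) : ℝ) ≤ d := by exact_mod_cast hcard
    push_cast at this; linarith
  have hone : (0 : ℝ) ≤ (N : ℝ) / d - 1 := by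
    rw [sub_nonneg, one_le_div hdR]; exact_mod_cast hdN
  have h3 := mul_le_mul_of_nonneg_right hcard' hone
  have h4 : ∑ x ∈ Z, (b x : ℝ) = ∑ x ∈ Z \ U, (b x : ℝ) + ∑ x ∈ U, (b x : ℝ) :=
    (Finset.sum_sdiff hUZ).symm
  have h5 : (U.card : ℝ) * ((N : ℝ) / d) - U.card * ((N' : ℝ) / d) ≤ largeMass d I b := by
    have h6 : (d : ℝ) * ((N : ℝ) / d) = N := by field_simp
    have h7 : (1 : ℝ) ≤ d := by exact_mod_cast hd
    nlinarith
  calc (U.card : ℝ) * ((N : ℝ) - N') = d * (U.card * ((N : ℝ) / d) - U.card * ((N' : ℝ) / d)) := by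
        field_simp
    _ ≤ _ := by gcongr

/-- In each step before `T`, a piece of one branch is cut off. -/
def CutSteps (I : Finset ι) (b : ℕ → ι → ℕ) (T : ℕ) : Prop :=
  ∀ t < T, ∃ x ∈ I, b (t + 1) x ≤ b t x ∧ ∀ y ∈ I, y ≠ x → b (t + 1) y = b t y

variable {b : ℕ → ι → ℕ} {T : ℕ}

lemma CutSteps.mono (h : CutSteps I b T) {T' : ℕ} (hT : T' ≤ T) : CutSteps I b T' :=
  fun t ht => h t (ht.trans_le hT)

lemma CutSteps.antitone (h : CutSteps I b T) {s t : ℕ} (hst : s ≤ t) (ht : t ≤ T) :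
    ∀ x ∈ I, b t x ≤ b s x := by
  induction t, hst using Nat.le_induction with
  | base => exact fun _ _ => le_rfl
  | succ t hst ih =>
    intro x hx
    refine le_trans ?_ (ih (by omega) x hx)
    obtain ⟨y, -, hy, hy'⟩ := h t (by omega)
    by_cases hxy : x = y
    · exact hxy ▸ hy
    · exact (hy' x hx hxy).le

lemma CutSteps.treeSize_antitone (h : CutSteps I b T) {s t : ℕ} (hst : s ≤ t) (ht : t ≤ T) :
    treeSize I (b t) ≤ treeSize I (b s) :=
  Nat.add_le_add_right (Finset.sum_le_sum (h.antitone hst ht)) 1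

/-- Branches that are small at the beginning can lose less than `⌊N / d⌋` vertices per step. -/
lemma CutSteps.small_loss (h : CutSteps I b T) {Z : Finset ι} (hZ : Z ⊆ I) {θ : ℕ}
    (hθ : ∀ x ∈ Z, b 0 x ≤ θ) : ∑ x ∈ Z, b 0 x ≤ ∑ x ∈ Z, b T x + T * θ := by
  classical
  induction T with
  | zero => simp
  | succ T ih =>
    refine (ih (h.mono (Nat.le_succ T))).trans ?_
    obtain ⟨x, hx, h1, h2⟩ := h T (Nat.lt_succ_self T)
    have : ∑ y ∈ Z, b T y ≤ ∑ y ∈ Z, b (T + 1) y + θ := by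
      by_cases hxZ : x ∈ Z
      · rw [← Finset.add_sum_erase _ _ hxZ, ← Finset.add_sum_erase Z (b (T + 1)) hxZ]
        have h3 : ∑ y ∈ Z.erase x, b T y = ∑ y ∈ Z.erase x, b (T + 1) y :=
          Finset.sum_congr rfl fun y hy =>
            (h2 y (hZ (Finset.mem_of_mem_erase hy)) (Finset.ne_of_mem_erase hy)).symm
        have h4 := h.antitone (Nat.zero_le T) (Nat.le_succ T) x hx
        have := hθ x hxZ
        omega
      · refine (Finset.sum_le_sum fun y hy => ?_).trans (Nat.le_add_right _ _)
        exact (h2 y (hZ hy) fun hyx => hxZ (hyx ▸ hy)).ge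
    rw [add_mul]
    omega

lemma CutSteps.loss (h : CutSteps I b T) :
    treeSize I (b 0) ≤ treeSize I (b T) + largeMass d I (b 0) + T * (treeSize I (b 0) / d) := by
  have h1 := largeMass_add_small (d := d) (I := I) (b 0)
  have h2 := h.small_loss (Z := I.filter fun x => ¬ treeSize I (b 0) / d ≤ b 0 x)
    (Finset.filter_subset _ _) (θ := treeSize I (b 0) / d) (fun x hx => by
      have := (Finset.mem_filter.1 hx).2; omega)
  have h3 : ∑ x ∈ I with ¬ treeSize I (b 0) / d ≤ b 0 x, b T x ≤ ∑ x ∈ I, b T x :=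
    Finset.sum_le_sum_of_subset (Finset.filter_subset _ _)
  have h4 : treeSize I (b T) = ∑ x ∈ I, b T x + 1 := rfl
  omega

lemma CutSteps.card_cut_le (h : CutSteps I b T) {s t : ℕ} (hst : s ≤ t) (ht : t ≤ T) :
    (I.filter fun x => ¬ b s x = b t x).card ≤ t - s := by
  classical
  induction t, hst using Nat.le_induction with
  | base => simp
  | succ t hst ih =>
    obtain ⟨x, hx, h1, h2⟩ := h t (by omega)
    have hsub : (I.filter fun y => ¬ b s y = b (t + 1) y) ⊆
        insert x (I.filter fun y => ¬ b s y = b t y) := by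
      intro y hy
      rw [Finset.mem_filter] at hy
      by_cases hyx : y = x
      · exact hyx ▸ Finset.mem_insert_self _ _
      · exact Finset.mem_insert_of_mem (Finset.mem_filter.2 ⟨hy.1, h2 y hy.1 hyx ▸ hy.2⟩)
    have := (Finset.card_le_card hsub).trans (Finset.card_insert_le _ _)
    have := ih (by omega)
    omega

end Sizes

section BadStretch

variable {ι : Type} {I : Finset ι} {d : ℕ} {b : ℕ → ι → ℕ} {T : ℕ}

/-- As long as only small branches and a small mass of large branches are cut, the tree keeps
most of its vertices. -/
lemma CutSteps.most_remain (h : CutSteps I b T) (hT : 64 * T ≤ 3 * d)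
    (hbad : 64 * largeMass d I (b 0) < treeSize I (b 0)) {t : ℕ} (ht : t ≤ T) :
    15 * treeSize I (b 0) ≤ 16 * treeSize I (b t) := by
  have h1 := (h.mono ht).loss (d := d)
  have h2 : 64 * (t * (treeSize I (b 0) / d)) ≤ 3 * treeSize I (b 0) := by
    calc 64 * (t * (treeSize I (b 0) / d)) = (64 * t) * (treeSize I (b 0) / d) := by ring
      _ ≤ (3 * d) * (treeSize I (b 0) / d) := Nat.mul_le_mul_right _ (by omega)
      _ = 3 * (d * (treeSize I (b 0) / d)) := by ring
      _ ≤ _ := Nat.mul_le_mul_left _ (Nat.mul_div_le _ _)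
  omega

/-- Going back `k` steps from a tree with little mass in large branches, the mass in large
branches is at least of order `k N / d`: most branches are then small and not cut in
between, and the vertices that are cut off have to come from large branches. -/
lemma CutSteps.largeMass_before_bad (h : CutSteps I b T) (hd : 32 < d) (hI : I.card ≤ d)
    (hT : 64 * T ≤ 3 * d) (hbad : 64 * largeMass d I (b 0) < treeSize I (b 0))
    (hN : 2 * d ≤ treeSize I (b 0))
    (hpiece : ∀ t < T, treeSize I (b (t + 1)) + treeSize I (b t) / d ≤ treeSize I (b t))
    {t τ : ℕ} (htτ : t < τ) (hτ : τ ≤ T)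
    (hbadτ : 64 * largeMass d I (b τ) < treeSize I (b τ)) :
    (treeSize I (b t) : ℝ) / largeMass d I (b t) ≤ 5 * d / ((τ - t : ℕ) : ℝ) := by
  classical
  have hrem : ∀ u ≤ T, 15 * treeSize I (b 0) ≤ 16 * treeSize I (b u) := fun u hu =>
    h.most_remain hT hbad hu
  have hdR : (0 : ℝ) < d := by exact_mod_cast (by omega : 0 < d)
  set N := treeSize I (b t) with hNt
  set N' := treeSize I (b τ) with hN'
  -- the loss between the two times
  have hloss : ∀ k, t + k ≤ τ →
      (treeSize I (b (t + k)) : ℝ) + k * (15 / 32 * N / d) ≤ N := by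
    intro k
    induction k with
    | zero => intro _; simp [hNt]
    | succ k ih =>
      intro hk
      have h1 := ih (by omega)
      have h2 : ((treeSize I (b (t + k + 1)) + treeSize I (b (t + k)) / d : ℕ) : ℝ) ≤
          treeSize I (b (t + k)) := by exact_mod_cast hpiece (t + k) (by omega)
      have h3 : (treeSize I (b (t + k)) : ℝ) / (2 * d) ≤
          ((treeSize I (b (t + k)) / d : ℕ) : ℝ) :=
        half_div_le_natDiv (by omega) (by have := hrem (t + k) (by omega); omega)
      have h4 : 15 * N ≤ 16 * treeSize I (b (t + k)) := by
        have h5 := hrem (t + k) (by omega)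
        have h6 : N ≤ treeSize I (b 0) := h.treeSize_antitone (Nat.zero_le t) (by omega)
        omega
      have h5 : (15 * N : ℝ) ≤ 16 * treeSize I (b (t + k)) := by exact_mod_cast h4
      have h6 : 15 / 32 * (N : ℝ) / d ≤ (treeSize I (b (t + k)) : ℝ) / (2 * d) := by
        rw [div_le_div_iff₀ hdR (by positivity)]
        nlinarith
      push_cast at h2 ⊢
      rw [← add_assoc]
      linarith
  -- most branches are small at time `τ`
  set Z := I.filter fun x => ¬ N' / d ≤ b τ x with hZ
  have hZcard : 63 * (d : ℝ) ≤ 64 * Z.card := by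
    have hsum : (largeMass d I (b τ) : ℝ) + ∑ x ∈ Z, (b τ x : ℝ) + 1 = N' := by
      exact_mod_cast largeMass_add_small (d := d) (I := I) (b τ)
    have h1 : ∑ x ∈ Z, (b τ x : ℝ) ≤ Z.card * ((N' : ℝ) / d - 1) := by
      rw [← nsmul_eq_mul, ← Finset.sum_const]
      refine Finset.sum_le_sum fun x hx => ?_
      have hx' := (Finset.mem_filter.1 hx).2
      have h2 : ((b τ x + 1 : ℕ) : ℝ) ≤ ((N' / d : ℕ) : ℝ) := by
        exact_mod_cast (by omega : b τ x + 1 ≤ N' / d)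
      have h3 := natDiv_le_real N' d
      push_cast at h2; linarith
    have h2 : (64 * largeMass d I (b τ) : ℝ) < N' := by exact_mod_cast hbadτ
    have hN'2 : (2 : ℝ) ≤ N' := by
      exact_mod_cast (by have := hrem τ hτ; omega : 2 ≤ N')
    have hpos : 0 < Z.card := by
      rcases Nat.eq_zero_or_pos Z.card with h0 | h0
      · rw [h0] at h1; push_cast at h1; linarith
      · exact h0
    have hone : (1 : ℝ) ≤ Z.card := by exact_mod_cast hpos
    have h3 : 63 * (N' : ℝ) ≤ 64 * (Z.card * ((N' : ℝ) / d)) := by linarith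
    have h4 : 63 * (N' : ℝ) * d ≤ 64 * Z.card * N' := by
      calc 63 * (N' : ℝ) * d ≤ 64 * (Z.card * ((N' : ℝ) / d)) * d := by gcongr
        _ = _ := by field_simp
    by_contra! hlt
    nlinarith
  -- those among them that are not cut in between
  set U := Z.filter fun x => b t x = b τ x with hU
  have hUcard : (d : ℝ) ≤ 2 * U.card := by
    have h1 : (Z.filter fun x => ¬ b t x = b τ x).card ≤ τ - t :=
      (Finset.card_le_card (Finset.filter_subset_filter _ (Finset.filter_subset _ _))).trans
        (h.card_cut_le htτ.le hτ)
    have h2 := Finset.card_filter_add_card_filter_not (s := Z) (fun x => b t x = b τ x)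
    rw [← hU] at h2
    have h3 : 63 * d ≤ 64 * Z.card := by exact_mod_cast hZcard
    have h4 : d ≤ 2 * U.card := by omega
    exact_mod_cast h4
  have hkey := card_mul_le_largeMass (d := d) (I := I) (b := b t) (b' := b τ) (U := U) (by omega)
    hI (fun x hx => (Finset.mem_filter.1 (Finset.mem_filter.1 hx).1).1)
    (fun x hx => (Finset.mem_filter.1 hx).2)
    (fun x hx => not_le.1 (Finset.mem_filter.1 (Finset.mem_filter.1 hx).1).2)
    (h.treeSize_antitone htτ.le hτ)
    (by have := hrem t (by omega); omega)
  have hl := hloss (τ - t) (by omega)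
  rw [show t + (τ - t) = τ by omega] at hl
  have hNpos : (0 : ℝ) < N := by
    exact_mod_cast (by have := hrem t (by omega); omega : 0 < N)
  have hk : (0 : ℝ) < ((τ - t : ℕ) : ℝ) := by exact_mod_cast (by omega : 0 < τ - t)
  have h1 : (N : ℝ) * ((τ - t : ℕ) : ℝ) ≤ 5 * d * largeMass d I (b t) := by
    have h2 : ((τ - t : ℕ) : ℝ) * (15 / 32 * N / d) ≤ (N : ℝ) - N' := by linarith
    have h3 : (d : ℝ) / 2 * (((τ - t : ℕ) : ℝ) * (15 / 32 * N / d)) ≤ d * largeMass d I (b t) :=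
      le_trans (mul_le_mul (by linarith) h2 (by positivity) (by positivity)) hkey
    have h4 : (d : ℝ) / 2 * (((τ - t : ℕ) : ℝ) * (15 / 32 * N / d)) =
        15 / 64 * (N * ((τ - t : ℕ) : ℝ)) := by field_simp; norm_num
    have h5 : 0 < (N : ℝ) * ((τ - t : ℕ) : ℝ) := by positivity
    linarith
  have hM : (0 : ℝ) < largeMass d I (b t) := by
    by_contra! hle
    have : 0 < (N : ℝ) * ((τ - t : ℕ) : ℝ) := by positivity
    nlinarith
  rw [div_le_div_iff₀ hM hk]
  exact h1

/-- From a tree with little mass in large branches on, the mean number of rounds per cut is of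
order `log d` over a stretch of order `d` cuts: the waiting times before the last bad tree
are bounded by a harmonic series. -/
lemma CutSteps.sum_waiting_le (h : CutSteps I b T) (hd : 32 < d) (hI : I.card ≤ d)
    (hT0 : 0 < T) (hT : 64 * T ≤ 3 * d) (hbad : 64 * largeMass d I (b 0) < treeSize I (b 0))
    (hN : 2 * d ≤ treeSize I (b 0))
    (hpiece : ∀ t < T, treeSize I (b (t + 1)) + treeSize I (b t) / d ≤ treeSize I (b t)) :
    ∑ t ∈ Finset.range T, (treeSize I (b t) : ℝ) / largeMass d I (b t) ≤
      10 * d * Real.log d := by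
  classical
  have hdR : (0 : ℝ) < d := by exact_mod_cast (by omega : 0 < d)
  have hrem : ∀ u ≤ T, 15 * treeSize I (b 0) ≤ 16 * treeSize I (b u) := fun u hu =>
    h.most_remain hT hbad hu
  -- the last bad time
  obtain ⟨τ, hτ, hmax⟩ := Finset.exists_max_image
    ((Finset.range T).filter fun t => 64 * largeMass d I (b t) < treeSize I (b t)) id
    ⟨0, by simp [hT0, hbad]⟩
  rw [Finset.mem_filter, Finset.mem_range] at hτ
  have hterm : ∀ t ∈ Finset.range T, (treeSize I (b t) : ℝ) / largeMass d I (b t) ≤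
      64 + (if t = τ then 2 * (d : ℝ) else 0) +
        (if t < τ then 5 * (d : ℝ) / ((τ - t : ℕ) : ℝ) else 0) := by
    intro t ht
    rw [Finset.mem_range] at ht
    have hM0 : treeSize I (b t) / d ≤ largeMass d I (b t) := div_le_largeMass (by omega) hI _
    have hdN : d ≤ treeSize I (b t) := by have := hrem t ht.le; omega
    have hM : (0 : ℝ) < largeMass d I (b t) := by
      have : 1 ≤ treeSize I (b t) / d := (Nat.one_le_div_iff (by omega)).2 hdN
      exact_mod_cast (by omega : 0 < largeMass d I (b t))
    rcases lt_trichotomy t τ with hlt | rfl | hgt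
    · rw [if_neg hlt.ne, if_pos hlt]
      have := h.largeMass_before_bad hd hI hT hbad hN hpiece hlt hτ.1.le hτ.2
      linarith
    · rw [if_pos rfl, if_neg (lt_irrefl _), div_le_iff₀ hM]
      have h1 := half_div_le_natDiv (by omega) hdN
      have h2 : ((treeSize I (b t) / d : ℕ) : ℝ) ≤ largeMass d I (b t) := by exact_mod_cast hM0
      rw [div_le_iff₀ (by positivity)] at h1
      nlinarith
    · rw [if_neg hgt.ne', if_neg hgt.le.not_gt, div_le_iff₀ hM]
      have : ¬ 64 * largeMass d I (b t) < treeSize I (b t) := fun h' => by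
        have := hmax t (by simp [ht, h'])
        simp at this; omega
      have : (treeSize I (b t) : ℝ) ≤ 64 * largeMass d I (b t) := by exact_mod_cast not_lt.1 this
      linarith
  refine (Finset.sum_le_sum hterm).trans ?_
  rw [Finset.sum_add_distrib, Finset.sum_add_distrib]
  have h1 : ∑ t ∈ Finset.range T, (64 : ℝ) ≤ 3 * d := by
    have : ((64 * T : ℕ) : ℝ) ≤ ((3 * d : ℕ) : ℝ) := by exact_mod_cast hT
    push_cast at this
    simp; linarith
  have h2 : ∑ t ∈ Finset.range T, (if t = τ then 2 * (d : ℝ) else 0) ≤ 2 * d := by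
    rw [Finset.sum_ite_eq']; split_ifs <;> simp
  have h3 : ∑ t ∈ Finset.range T, (if t < τ then 5 * (d : ℝ) / ((τ - t : ℕ) : ℝ) else 0) ≤
      5 * d * (1 + Real.log d) := by
    have h4 : ∑ t ∈ Finset.range T, (if t < τ then 5 * (d : ℝ) / ((τ - t : ℕ) : ℝ) else 0) =
        ∑ t ∈ Finset.range τ, 5 * (d : ℝ) / ((τ - t : ℕ) : ℝ) := by
      rw [← Finset.sum_filter]
      refine Finset.sum_congr ?_ fun _ _ => rfl
      ext t; simp; omega
    have h5 : ∑ t ∈ Finset.range τ, 5 * (d : ℝ) / ((τ - t : ℕ) : ℝ) =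
        5 * d * ((harmonic τ : ℚ) : ℝ) := by
      rw [← Finset.sum_range_reflect, harmonic, Rat.cast_sum, Finset.mul_sum]
      refine Finset.sum_congr rfl fun j hj => ?_
      rw [Finset.mem_range] at hj
      rw [show τ - (τ - 1 - j) = j + 1 by omega]
      push_cast
      rw [div_eq_mul_inv]
    rw [h4, h5]
    have h6 := harmonic_le_one_add_log τ
    have h7 : Real.log τ ≤ Real.log d := by
      rcases Nat.eq_zero_or_pos τ with h0 | h0
      · rw [h0]; simpa using Real.log_natCast_nonneg d
      · exact Real.log_le_log (by exact_mod_cast h0) (by exact_mod_cast (by omega : τ ≤ d))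
    gcongr
    linarith
  have hlog : 2 ≤ Real.log d := by
    rw [Real.le_log_iff_exp_le hdR]
    have h8 : Real.exp 2 ≤ 9 := by
      have := Real.exp_one_lt_d9
      rw [show (2 : ℝ) = 1 + 1 by norm_num, Real.exp_add]
      nlinarith [Real.exp_pos 1]
    have : ((32 : ℕ) : ℝ) ≤ d := by exact_mod_cast hd.le
    push_cast at this; linarith
  nlinarith

end BadStretch

/-! ### The total weight of a recursive decomposition -/

section Entropy

lemma mul_log_div_le {a b : ℝ} (ha : 0 < a) (hb : 0 < b) :
    a * Real.log ((a + b) / a) ≤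
      (a + b) * Real.log (a + b) - a * Real.log a - b * Real.log b := by
  rw [Real.log_div (by positivity) ha.ne']
  have : Real.log b ≤ Real.log (a + b) := Real.log_le_log hb (by linarith)
  nlinarith

/-- The entropy gain of a split is at least half the size of each part that is not the
larger one. -/
lemma half_le_entropy_gain {a b : ℝ} (ha : 0 < a) (hab : a ≤ b) :
    a / 2 ≤ (a + b) * Real.log (a + b) - a * Real.log a - b * Real.log b := by
  refine le_trans ?_ (mul_log_div_le ha (ha.trans_le hab))
  have h1 : Real.log 2 ≤ Real.log ((a + b) / a) :=
    Real.log_le_log (by norm_num) (by rw [le_div_iff₀ ha]; linarith)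
  have := Real.log_two_gt_d9
  nlinarith

/-- The entropy gain of cutting off a part of size between `N / (2d)` and `N / 2`. -/
lemma log_le_entropy_gain {a b d : ℝ} (hd : 1 ≤ d) (hb : 0 < b)
    (h1 : (a + b) / (2 * d) ≤ a) (h2 : a ≤ b) :
    (a + b) * Real.log d / (4 * d) ≤
      (a + b) * Real.log (a + b) - a * Real.log a - b * Real.log b := by
  have hd0 : 0 < d := by linarith
  have ha : 0 < a := by
    by_contra! h
    have h3 : 0 < a + b ∨ a + b ≤ 0 := lt_or_ge _ _
    rcases h3 with h3 | h3
    · have : 0 < (a + b) / (2 * d) := by positivity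
      linarith
    · have h4 : (a + b) / (2 * d) ≤ a := h1
      rw [div_le_iff₀ (by positivity)] at h4
      nlinarith
  refine le_trans ?_ (mul_log_div_le ha hb)
  set N := a + b with hN
  have hs : 0 < √d := Real.sqrt_pos.2 hd0
  have hss : √d * √d = d := Real.mul_self_sqrt hd0.le
  have hlogs : Real.log d = 2 * Real.log √d := by
    rw [Real.log_sqrt hd0.le]; ring
  have hlog0 : 0 ≤ Real.log d := Real.log_nonneg hd
  rw [div_le_iff₀ (by positivity)] at h1 ⊢
  by_cases hcase : a * √d ≤ N
  · have h3 : Real.log √d ≤ Real.log (N / a) :=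
      Real.log_le_log hs (by rw [le_div_iff₀ ha]; linarith)
    have h4 : N * Real.log d ≤ a * (2 * d) * Real.log d := by gcongr
    have h5 : a * d * Real.log √d ≤ a * d * Real.log (N / a) := by gcongr
    rw [hlogs] at h4 ⊢
    linarith
  · push Not at hcase
    have h3 : Real.log 2 ≤ Real.log (N / a) :=
      Real.log_le_log (by norm_num) (by rw [le_div_iff₀ ha]; linarith)
    have h4 := Real.log_two_gt_d9
    have h5 : Real.log √d ≤ √d := (Real.log_le_sub_one_of_pos hs).trans (by linarith)
    calc N * Real.log d ≤ (a * √d) * (2 * √d) := by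
          rw [hlogs]; exact mul_le_mul hcase.le (by linarith)
            (by linarith) (by positivity)
      _ = a * (1 / 2) * (4 * (√d * √d)) := by ring
      _ = a * (1 / 2) * (4 * d) := by rw [hss]
      _ ≤ a * Real.log (N / a) * (4 * d) := by gcongr; linarith

end Entropy

section Weight

variable {V : Type} {E : Finset (V × V)} {d : ℕ}

open Classical in
/-- The pairs of vertices of `S` that are separated by an even separator: for these, the round that
draws them succeeds. -/
noncomputable def goodPairs (E : Finset (V × V)) (d : ℕ) (S : Finset V) : Finset (V × V) :=
  (S ×ˢ S).filter fun p => ∃ v, IsEven E d S v ∧ ¬ (AncEq E v p.1 ↔ AncEq E v p.2)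

lemma mem_goodPairs {S : Finset V} {i j : V} : (i, j) ∈ goodPairs E d S ↔
    (i ∈ S ∧ j ∈ S) ∧ ∃ v, IsEven E d S v ∧ ¬ (AncEq E v i ↔ AncEq E v j) := by
  simp [goodPairs]

/-- The size of `S` times the mean number of rounds until one succeeds. -/
noncomputable def roundWeight (E : Finset (V × V)) (d : ℕ) (S : Finset V) : ℝ :=
  S.card * ((S.card : ℝ) ^ 2 / (goodPairs E d S).card)

/-- Pairs of a vertex of a large branch and a vertex outside of that branch are good. -/
lemma IsRootedTree.largeMass_mul_le_card_goodPairs (hE : IsRootedTree E) {S : Finset V}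
    (hS : IsSubtree E S) {c : V} (hc : c ∈ S) {B : ℕ}
    (hB : ∀ x ∈ branchLabels E c, (branch E c S x).card ≤ B) (hBS : B ≤ S.card - S.card / d) :
    largeMass d (branchLabels E c) (fun x => (branch E c S x).card) * (S.card - B) ≤
      (goodPairs E d S).card := by
  classical
  have hsize : treeSize (branchLabels E c) (fun x => (branch E c S x).card) = S.card :=
    hE.sum_card_branch hc
  unfold largeMass
  rw [hsize, Finset.sum_mul]
  set L := (branchLabels E c).filter fun x => S.card / d ≤ (branch E c S x).card with hL
  calc ∑ x ∈ L, (branch E c S x).card * (S.card - B)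
      ≤ ∑ x ∈ L, (branch E c S x ×ˢ (S \ branch E c S x)).card := by
        refine Finset.sum_le_sum fun x hx => ?_
        have hsub : branch E c S x ⊆ S := fun k hk => (mem_branch.1 hk).1
        rw [Finset.card_product, Finset.card_sdiff_of_subset hsub]
        have := hB x (Finset.mem_filter.1 hx).1
        exact Nat.mul_le_mul_left _ (by omega)
    _ = (L.biUnion fun x => branch E c S x ×ˢ (S \ branch E c S x)).card := by
        rw [Finset.card_biUnion]
        intro x hx y hy hxy
        rw [Function.onFun, Finset.disjoint_left]
        rintro ⟨i, j⟩ h1 h2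
        rw [Finset.mem_product] at h1 h2
        exact hxy (hE.inBranch_unique (Finset.mem_filter.1 hx).1 (Finset.mem_filter.1 hy).1
          (mem_branch.1 h1.1).2 (mem_branch.1 h2.1).2)
    _ ≤ _ := by
        refine Finset.card_le_card fun p hp => ?_
        obtain ⟨x, hx, hp⟩ := Finset.mem_biUnion.1 hp
        rw [Finset.mem_product, Finset.mem_sdiff] at hp
        rw [Finset.mem_filter] at hx
        obtain ⟨v, hv, hsep⟩ := hE.exists_even_of_branch (d := d) hS hc hx.1
          (Finset.card_pos.2 ⟨_, hp.1⟩) hx.2 ((hB x hx.1).trans hBS)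
        refine Finset.mem_filter.2 ⟨Finset.mem_product.2 ⟨(mem_branch.1 hp.1).1, hp.2.1⟩, v, hv, ?_⟩
        exact hsep _ _ (mem_branch.1 hp.1).2 fun h => hp.2.2 (mem_branch.2 ⟨hp.2.1, h⟩)

/-- A cut by an even separator, seen from a vertex `c` of the tree: the part that
loses `c` belongs to one branch at `c`. -/
lemma IsRootedTree.exists_cut (hE : IsRootedTree E) {F : Finset V → ℝ} {S : Finset V}
    (hS : IsSubtree E S) {c : V} (hc : c ∈ S) {v : V} (hv : IsEven E d S v) :
    ∃ S' R, IsSubtree E S' ∧ c ∈ S' ∧ IsSubtree E R ∧ S'.card + R.card = S.card ∧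
      S.card / d ≤ R.card ∧ F (below E S v) + F (rest E S v) = F S' + F R ∧
      ∃ x ∈ branchLabels E c, (branch E c S' x).card ≤ (branch E c S x).card ∧
        ∀ y ∈ branchLabels E c, y ≠ x → (branch E c S' y).card = (branch E c S y).card := by
  have key : ∀ S' R : Finset V, (∀ k, k ∈ S ↔ k ∈ S' ∨ k ∈ R) →
      (∃ x ∈ branchLabels E c, ∀ k ∈ R, InBranch E c x k) →
      ∃ x ∈ branchLabels E c, (branch E c S' x).card ≤ (branch E c S x).card ∧
        ∀ y ∈ branchLabels E c, y ≠ x → (branch E c S' y).card = (branch E c S y).card := by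
    rintro S' R hSR ⟨x, hx, hxR⟩
    refine ⟨x, hx, Finset.card_le_card fun k hk => ?_, fun y hy hyx => ?_⟩
    · rw [mem_branch] at hk ⊢
      exact ⟨(hSR k).2 (Or.inl hk.1), hk.2⟩
    · congr 1
      ext k
      rw [mem_branch, mem_branch, hSR]
      constructor
      · exact fun h => ⟨Or.inl h.1, h.2⟩
      · rintro ⟨h | h, h'⟩
        · exact ⟨h, h'⟩
        · exact absurd (hE.inBranch_unique hy hx h' (hxR k h)) hyx
  have hcard := card_below_add_card_rest (E := E) S v
  have hdiv := Nat.div_le_self S.card d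
  by_cases hvc : AncEq E v c
  · refine ⟨below E S v, rest E S v, hv.isSubtree_below hS, mem_below.2 ⟨hc, hvc⟩,
      hv.isSubtree_rest hS, hcard, ?_, rfl, key _ _ (fun k => ?_)
        (hE.rest_inBranch (Finset.card_pos.1 hv.rest_card_pos) hvc)⟩
    · have := hv.2.2.2; omega
    · rw [mem_below, mem_rest]; tauto
  · refine ⟨rest E S v, below E S v, hv.isSubtree_rest hS, mem_rest.2 ⟨hc, hvc⟩,
      hv.isSubtree_below hS, by omega, hv.2.2.1, add_comm _ _, key _ _ (fun k => ?_)
        (hE.below_inBranch (S := S) hvc)⟩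
    rw [mem_below, mem_rest]; tauto

/-- A weight that, on each subtree, is at most the weight of a round plus the weights of the two
parts of some even split. -/
def IsDecompositionWeight (E : Finset (V × V)) (d : ℕ) (F : Finset V → ℝ) : Prop :=
  (∀ S, S.card ≤ 1 → F S ≤ 0) ∧ ∀ S, IsSubtree E S → 2 ≤ S.card →
    ∃ v, IsEven E d S v ∧ F S ≤ roundWeight E d S + (F (below E S v) + F (rest E S v))

lemma div_le_half {N d : ℕ} (hd : 2 ≤ d) : 2 * (N / d) ≤ N :=
  (Nat.mul_le_mul_right _ hd).trans (Nat.mul_div_le _ _)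

/-- A tree with a constant fraction of its mass in large branches at a centroid: one round succeeds
with constant probability, and this is paid for by the entropy gain of one split. -/
lemma IsRootedTree.weight_le_of_good (hE : IsRootedTree E) (hd : 2 ≤ d)
    {F : Finset V → ℝ} (hF : IsDecompositionWeight E d F) {S : Finset V} (hS : IsSubtree E S)
    (h2 : 2 ≤ S.card) {c : V} (hc : c ∈ S)
    (hcent : ∀ x ∈ branchLabels E c, 2 * (branch E c S x).card ≤ S.card)
    (hgood : S.card ≤ 64 * largeMass d (branchLabels E c) (fun x => (branch E c S x).card))
    (ih : ∀ S' : Finset V, S'.card < S.card → IsSubtree E S' →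
      F S' ≤ 8192 * d * (S'.card * Real.log S'.card)) :
    F S ≤ 8192 * d * (S.card * Real.log S.card) := by
  obtain ⟨v, hv, hFv⟩ := hF.2 S hS h2
  have hdR : (2 : ℝ) ≤ d := by exact_mod_cast hd
  set M := largeMass d (branchLabels E c) (fun x => (branch E c S x).card) with hM
  have hhalf := div_le_half (N := S.card) hd
  have hpairs := hE.largeMass_mul_le_card_goodPairs (d := d) hS hc (B := S.card / 2)
    (fun x hx => by have := hcent x hx; omega) (by omega)
  have hNR : (2 : ℝ) ≤ S.card := by exact_mod_cast h2
  have hw : roundWeight E d S ≤ 128 * S.card := by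
    have h3 : (S.card : ℝ) ^ 2 ≤ 128 * (goodPairs E d S).card := by
      have h4 : S.card * S.card ≤ 128 * (goodPairs E d S).card := by
        calc S.card * S.card ≤ (64 * M) * (2 * (S.card - S.card / 2)) :=
              Nat.mul_le_mul hgood (by omega)
          _ = 128 * (M * (S.card - S.card / 2)) := by ring
          _ ≤ _ := Nat.mul_le_mul_left _ hpairs
      rw [sq]; exact_mod_cast h4
    have h5 : (0 : ℝ) < (goodPairs E d S).card := by nlinarith
    unfold roundWeight
    rw [mul_comm]
    gcongr
    rw [div_le_iff₀ h5]; exact h3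
  have hi1 := ih _ hv.2.1 (hv.isSubtree_below hS)
  have hi2 := ih _ hv.rest_card_lt (hv.isSubtree_rest hS)
  have hpart : ∀ a b : ℕ, a + b = S.card → 0 < a → S.card / d ≤ a → a ≤ b →
      (S.card : ℝ) / (64 * d) ≤ S.card * Real.log S.card - a * Real.log a - b * Real.log b := by
    intro a b hab ha had hle
    have h1 := half_le_entropy_gain (a := a) (b := b) (by exact_mod_cast ha) (by exact_mod_cast hle)
    rw [show (a : ℝ) + b = S.card by exact_mod_cast hab] at h1
    refine le_trans ?_ h1
    have h4 : (S.card : ℝ) / (2 * d) ≤ a := by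
      by_cases hdN : d ≤ S.card
      · exact (half_div_le_natDiv (by omega) hdN).trans (by exact_mod_cast had)
      · rw [div_le_iff₀ (by positivity)]
        have h5 : (S.card : ℝ) ≤ d := by exact_mod_cast (by omega : S.card ≤ d)
        have h6 : (1 : ℝ) ≤ a := by exact_mod_cast ha
        nlinarith
    rw [div_le_iff₀ (by positivity)] at h4 ⊢
    nlinarith
  have hcard := card_below_add_card_rest (E := E) S v
  have hgain : (S.card : ℝ) / (64 * d) ≤ S.card * Real.log S.card -
      (below E S v).card * Real.log (below E S v).card -
      (rest E S v).card * Real.log (rest E S v).card := by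
    have hdiv := Nat.div_le_self S.card d
    have hv' := hv.2.2.2
    rcases le_total (below E S v).card (rest E S v).card with h | h
    · exact hpart _ _ hcard hv.below_card_pos hv.2.2.1 h
    · have := hpart _ _ (by omega) hv.rest_card_pos (by omega) h
      linarith
  have h6 : 128 * (S.card : ℝ) ≤ 8192 * d * (S.card * Real.log S.card -
      (below E S v).card * Real.log (below E S v).card -
      (rest E S v).card * Real.log (rest E S v).card) := by
    calc 128 * (S.card : ℝ) = 8192 * d * ((S.card : ℝ) / (64 * d)) := by field_simp; norm_num
      _ ≤ _ := by gcongr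
  linarith

/-- A tree with little mass in large branches at a centroid `c`: along the next
`⌊d / 64⌋ + 1` cuts of the part that contains `c`, the weights of the rounds add up to
`O(d N log d)`, and the entropy gain is of order `N log d`. -/
lemma IsRootedTree.weight_le_of_bad [DecidableEq V] (hE : IsRootedTree E) (hd : 2 ≤ d)
    (hdeg : ∀ v, degree E v ≤ d)
    {F : Finset V → ℝ} (hF : IsDecompositionWeight E d F) {S : Finset V} (hS : IsSubtree E S)
    (h2 : 2 ≤ S.card) {c : V} (hc : c ∈ S)
    (hcent : ∀ x ∈ branchLabels E c, 2 * (branch E c S x).card ≤ S.card)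
    (hbad : 64 * largeMass d (branchLabels E c) (fun x => (branch E c S x).card) < S.card)
    (ih : ∀ S' : Finset V, S'.card < S.card → IsSubtree E S' →
      F S' ≤ 8192 * d * (S'.card * Real.log S'.card)) :
    F S ≤ 8192 * d * (S.card * Real.log S.card) := by
  set I := branchLabels E c with hIdef
  have hI : I.card ≤ d := (card_branchLabels_le c).trans (hdeg c)
  have hsize : ∀ S : Finset V, c ∈ S → treeSize I (fun x => (branch E c S x).card) = S.card :=
    fun S hc => hE.sum_card_branch hc
  have hM0 := div_le_largeMass hd hI (fun x => (branch E c S x).card)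
  rw [hsize S hc] at hM0
  -- in a small tree all branches are large
  have hN : 2 * d ≤ S.card := by
    by_contra! hlt
    have h1 : S.card / d ≤ 1 := Nat.le_of_lt_succ ((Nat.div_lt_iff_lt_mul (by omega)).2 hlt)
    have h3 := largeMass_add_small (d := d) (I := I) (fun x => (branch E c S x).card)
    rw [hsize S hc] at h3
    rw [Finset.sum_eq_zero fun x hx => by have := (Finset.mem_filter.1 hx).2; omega] at h3
    omega
  have hd32 : 32 < d := by
    have h1 : S.card < d * (S.card / d) + d := by
      have := Nat.div_add_mod S.card d
      have := Nat.mod_lt S.card (by omega : 0 < d)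
      omega
    by_contra! hle
    have h4 : d * (S.card / d) ≤ 32 * (S.card / d) := Nat.mul_le_mul_right _ hle
    have h5 : d ≤ d * (S.card / d) :=
      Nat.le_mul_of_pos_right _ ((Nat.one_le_div_iff (by omega)).2 (by omega))
    omega
  have hdR : (32 : ℝ) < d := by exact_mod_cast hd32
  have hcut : ∀ S : Finset V, IsSubtree E S ∧ 2 ≤ S.card ∧ c ∈ S → ∃ S' R, IsSubtree E S' ∧ c ∈ S' ∧
      IsSubtree E R ∧ S'.card + R.card = S.card ∧ S.card / d ≤ R.card ∧
      F S ≤ roundWeight E d S + (F S' + F R) ∧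
      ∃ x ∈ I, (branch E c S' x).card ≤ (branch E c S x).card ∧
        ∀ y ∈ I, y ≠ x → (branch E c S' y).card = (branch E c S y).card := by
    rintro S ⟨hS, h2, hc⟩
    obtain ⟨v, hv, hFv⟩ := hF.2 S hS h2
    obtain ⟨S', R, h3, h4, h5, h6, h7, h8, h9⟩ := hE.exists_cut (F := F) hS hc hv
    exact ⟨S', R, h3, h4, h5, h6, h7, h8 ▸ hFv, h9⟩
  choose! next piece hnext using hcut
  set Sq : ℕ → Finset V := fun t => next^[t] S with hSq
  have hSq_succ : ∀ t, Sq (t + 1) = next (Sq t) := fun t => Function.iterate_succ_apply' _ _ _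
  set b : ℕ → Option V → ℕ := fun t x => (branch E c (Sq t) x).card with hb
  set T := d / 64 + 1 with hT
  have hT3 : 64 * T ≤ 3 * d := by omega
  have hbad0 : 64 * largeMass d I (b 0) < treeSize I (b 0) := by
    rw [show treeSize I (b 0) = S.card from hsize S hc]; exact hbad
  have hinv : ∀ t ≤ T, IsSubtree E (Sq t) ∧ c ∈ Sq t ∧ CutSteps I b t ∧
      15 * S.card ≤ 16 * (Sq t).card := by
    intro t
    induction t with
    | zero =>
      intro _
      exact ⟨hS, hc, fun u hu => absurd hu (Nat.not_lt_zero u), by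
        simp only [hSq, Function.iterate_zero, id]; omega⟩
    | succ t iht =>
      intro ht
      obtain ⟨h3, h4, h5, h6⟩ := iht (by omega)
      have h7 := hnext (Sq t) ⟨h3, by omega, h4⟩
      have h8 : CutSteps I b (t + 1) := by
        intro u hu
        rcases Nat.lt_succ_iff_lt_or_eq.1 hu with hu | rfl
        · exact h5 u hu
        · simp only [hb, hSq_succ]; exact h7.2.2.2.2.2.2
      have hc' : c ∈ Sq (t + 1) := hSq_succ t ▸ h7.2.1
      refine ⟨hSq_succ t ▸ h7.1, hc', h8, ?_⟩
      have := h8.most_remain (by omega) hbad0 le_rfl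
      rwa [show treeSize I (b 0) = S.card from hsize S hc,
        show treeSize I (b (t + 1)) = (Sq (t + 1)).card from hsize _ hc'] at this
  have hcuts : CutSteps I b T := (hinv T le_rfl).2.2.1
  have hsz : ∀ t ≤ T, treeSize I (b t) = (Sq t).card := fun t ht => hsize _ (hinv t ht).2.1
  have hstep : ∀ t < T, IsSubtree E (piece (Sq t)) ∧
      (Sq (t + 1)).card + (piece (Sq t)).card = (Sq t).card ∧
      (Sq t).card / d ≤ (piece (Sq t)).card ∧
      F (Sq t) ≤ roundWeight E d (Sq t) + (F (Sq (t + 1)) + F (piece (Sq t))) := by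
    intro t ht
    obtain ⟨h3, h4, h5, h6⟩ := hinv t ht.le
    have h7 := hnext (Sq t) ⟨h3, by omega, h4⟩
    rw [hSq_succ]
    exact ⟨h7.2.2.1, h7.2.2.2.1, h7.2.2.2.2.1, h7.2.2.2.2.2.1⟩
  have hle : ∀ t ≤ T, (Sq t).card ≤ S.card := fun t ht => by
    rw [← hsz t ht, ← hsize S hc]
    exact hcuts.treeSize_antitone (Nat.zero_le t) ht
  -- the weights of the rounds
  have hweight : ∀ t < T, roundWeight E d (Sq t) ≤
      3 * S.card * ((treeSize I (b t) : ℝ) / largeMass d I (b t)) := by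
    intro t ht
    obtain ⟨h3, h4, h5, h6⟩ := hinv t ht.le
    have h32 : 32 * ((Sq t).card / d) ≤ (Sq t).card :=
      (Nat.mul_le_mul_right _ hd32.le).trans (Nat.mul_div_le _ _)
    have hpairs := hE.largeMass_mul_le_card_goodPairs (d := d) h3 h4 (B := S.card / 2)
      (fun x hx => by
        have h7 := hcent x hx
        have h8 : b t x ≤ b 0 x := hcuts.antitone (Nat.zero_le t) ht.le x hx
        have h9 : b 0 x = (branch E c S x).card := rfl
        have h10 : b t x = (branch E c (Sq t) x).card := rfl
        omega) (by omega)
    have hpairs' : (Sq t).card * largeMass d I (b t) ≤ 3 * (goodPairs E d (Sq t)).card := by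
      calc (Sq t).card * largeMass d I (b t)
          ≤ (3 * ((Sq t).card - S.card / 2)) * largeMass d I (b t) :=
            Nat.mul_le_mul_right _ (by omega)
        _ = 3 * (largeMass d I (b t) * ((Sq t).card - S.card / 2)) := by ring
        _ ≤ _ := Nat.mul_le_mul_left _ hpairs
    have hMt : 0 < largeMass d I (b t) := by
      have h7 := div_le_largeMass hd hI (b t)
      rw [hsz t ht.le] at h7
      have : 1 ≤ (Sq t).card / d := (Nat.one_le_div_iff (by omega)).2 (by omega)
      omega
    have hMR : (0 : ℝ) < largeMass d I (b t) := by exact_mod_cast hMt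
    have hpR : ((Sq t).card : ℝ) * largeMass d I (b t) ≤ 3 * (goodPairs E d (Sq t)).card := by
      exact_mod_cast hpairs'
    have hNt : (0 : ℝ) < (Sq t).card := by exact_mod_cast h3.card_pos
    have hGR : (0 : ℝ) < (goodPairs E d (Sq t)).card := by
      have : 0 < ((Sq t).card : ℝ) * largeMass d I (b t) := by positivity
      linarith
    rw [hsz t ht.le]
    unfold roundWeight
    calc ((Sq t).card : ℝ) * (((Sq t).card : ℝ) ^ 2 / (goodPairs E d (Sq t)).card)
        ≤ S.card * (3 * (((Sq t).card : ℝ) / largeMass d I (b t))) := by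
          have : ((Sq t).card : ℝ) ≤ S.card := by exact_mod_cast hle t ht.le
          gcongr
          rw [div_le_iff₀ hGR, ← mul_div_assoc, div_mul_eq_mul_div, le_div_iff₀ hMR]
          nlinarith
      _ = _ := by ring
  have hsum := hcuts.sum_waiting_le hd32 hI (by omega) hT3 hbad0
    (by rw [hsz 0 (Nat.zero_le _)]; exact hN) (fun t ht => by
      rw [hsz t ht.le, hsz (t + 1) ht]
      have := hstep t ht; omega)
  -- the entropy gain
  have hN0 : (0 : ℝ) < S.card := by exact_mod_cast hS.card_pos
  have hlogd : 0 ≤ Real.log d := Real.log_natCast_nonneg d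
  have hgain : ∀ t < T, 15 / 64 * S.card * Real.log d / d ≤
      (Sq t).card * Real.log (Sq t).card -
        (piece (Sq t)).card * Real.log (piece (Sq t)).card -
        (Sq (t + 1)).card * Real.log (Sq (t + 1)).card := by
    intro t ht
    obtain ⟨h3, h4, h5, h6⟩ := hinv t ht.le
    obtain ⟨g1, g2, g3, g4⟩ := hstep t ht
    have h7 := (hinv (t + 1) ht).2.2.2
    have h8 := hle t ht.le
    have hsum' : ((piece (Sq t)).card : ℝ) + (Sq (t + 1)).card = (Sq t).card := by
      rw [add_comm]; exact_mod_cast g2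
    have h9 := log_le_entropy_gain (a := (piece (Sq t)).card) (b := (Sq (t + 1)).card) (d := d)
      (by linarith) (by exact_mod_cast (hinv (t + 1) ht).1.card_pos)
      (by
        rw [hsum']
        exact (half_div_le_natDiv (by omega) (by omega)).trans (by exact_mod_cast g3))
      (by exact_mod_cast (by omega : (piece (Sq t)).card ≤ (Sq (t + 1)).card))
    rw [hsum'] at h9
    refine le_trans ?_ h9
    have h10 : 15 * (S.card : ℝ) ≤ 16 * (Sq t).card := by exact_mod_cast h6
    rw [div_le_div_iff₀ (by positivity) (by positivity)]
    have : 0 ≤ Real.log d * d := by positivity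
    nlinarith
  have htel : ∀ t ≤ T, F S ≤ 8192 * d * (S.card * Real.log S.card) -
      8192 * d * ((Sq t).card * Real.log (Sq t).card) + F (Sq t) +
      3 * S.card * ∑ u ∈ Finset.range t, (treeSize I (b u) : ℝ) / largeMass d I (b u) -
      1920 * t * (S.card * Real.log d) := by
    intro t
    induction t with
    | zero => intro _; simp [hSq]
    | succ t iht =>
      intro ht
      obtain ⟨g1, g2, g3, g4⟩ := hstep t ht
      obtain ⟨h3, h4, h5, h6⟩ := hinv t (by omega)
      have hlt : (piece (Sq t)).card < S.card := by
        have := (hinv (t + 1) ht).1.card_pos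
        have := hle t (by omega)
        omega
      have h7 := ih _ hlt g1
      have h8 := hweight t ht
      have h9 := hgain t ht
      have h10 := iht (by omega)
      have h11 : 1920 * (S.card * Real.log d) ≤ 8192 * d * ((Sq t).card * Real.log (Sq t).card -
        (piece (Sq t)).card * Real.log (piece (Sq t)).card -
        (Sq (t + 1)).card * Real.log (Sq (t + 1)).card) := by
        calc 1920 * (S.card * Real.log d) =
            8192 * d * (15 / 64 * S.card * Real.log d / d) := by field_simp; ring
          _ ≤ _ := by gcongr
      rw [Finset.sum_range_succ]
      push_cast
      linarith
  have hlast := htel T le_rfl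
  have hltT : (Sq T).card < S.card := by
    have h3 := hstep 0 (by omega)
    have h4 : (Sq 0).card / d ≥ 1 := (Nat.one_le_div_iff (by omega)).2 (by
      simp only [hSq, Function.iterate_zero, id]; omega)
    have h5 : treeSize I (b T) ≤ treeSize I (b 1) := hcuts.treeSize_antitone (by omega) le_rfl
    rw [hsz T le_rfl, hsz 1 (by omega)] at h5
    have h6 : (Sq 0).card = S.card := rfl
    rw [zero_add] at h3
    omega
  have hihT := ih _ hltT (hinv T le_rfl).1
  have hTR : (d : ℝ) ≤ 64 * T := by exact_mod_cast (by omega : d ≤ 64 * T)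
  have h12 : 3 * S.card * ∑ u ∈ Finset.range T, (treeSize I (b u) : ℝ) / largeMass d I (b u) ≤
      3 * S.card * (10 * d * Real.log d) := by gcongr
  have h13 : 3 * S.card * (10 * d * Real.log d) ≤ 1920 * T * (S.card * Real.log d) := by
    have : 0 ≤ S.card * Real.log d := by positivity
    nlinarith
  linarith

/-- The size of the tree, summed over all rounds of a recursive decomposition, is on average
`O(d N log N)`. -/
theorem IsRootedTree.decompositionWeight_le [DecidableEq V] (hE : IsRootedTree E) (hd : 2 ≤ d)
    (hdeg : ∀ v, degree E v ≤ d) {F : Finset V → ℝ} (hF : IsDecompositionWeight E d F)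
    {S : Finset V} (hS : IsSubtree E S) :
    F S ≤ 8192 * d * (S.card * Real.log S.card) := by
  induction hn : S.card using Nat.strong_induction_on generalizing S with
  | _ n ih =>
    subst hn
    have ih' : ∀ S' : Finset V, S'.card < S.card → IsSubtree E S' →
        F S' ≤ 8192 * d * (S'.card * Real.log S'.card) := fun S' h hS' => ih _ h hS' rfl
    by_cases h2 : 2 ≤ S.card
    · obtain ⟨c, hc, hcent⟩ := hE.exists_centroid hS
      by_cases h : S.card ≤ 64 * largeMass d (branchLabels E c) fun x => (branch E c S x).card
      · exact hE.weight_le_of_good hd hF hS h2 hc hcent h ih'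
      · exact hE.weight_le_of_bad hd hdeg hF hS h2 hc hcent (not_le.1 h) ih'
    · refine (hF.1 S (by omega)).trans ?_
      have := Real.log_natCast_nonneg S.card
      positivity

end Weight

/-! ### Runs of programs -/

section Runs

variable {V α β : Type} {Q : V → V → Bool} {m : ℕ}

lemma addCost_addCost (q t q' t' : ℕ) (r : Option (Outcome α)) :
    addCost q t (addCost q' t' r) = addCost (q' + q) (t' + t) r := by
  cases r <;> simp [addCost, add_assoc]

lemma addCost_zero (r : Option (Outcome α)) : addCost 0 0 r = r := by
  cases r <;> simp [addCost]

/-- The law of the outcome of a program that is followed by another one, in terms of the outcome of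
the first. -/
noncomputable def continueWith (g : α → PMF (Option (Outcome β))) :
    Option (Outcome α) → PMF (Option (Outcome β))
  | none => PMF.pure none
  | some o => (g o.output).map (addCost o.queries o.time)

lemma continueWith_addCost (g : α → PMF (Option (Outcome β))) (q t : ℕ)
    (r : Option (Outcome α)) :
    continueWith g (addCost q t r) = (continueWith g r).map (addCost q t) := by
  cases r with
  | none => simp [continueWith, addCost, PMF.pure_map]
  | some o =>
    simp only [continueWith, addCost, Option.map_some, PMF.map_comp]
    congr 1
    funext r
    exact (addCost_addCost _ _ _ _ r).symm

lemma run_bind (p : Prog V α) (f : α → Prog V β) :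
    (p >>= f).run Q m = (p.run Q m).bind (continueWith fun a => (f a).run Q m) := by
  change (p.bind f).run Q m = _
  have hmap : ∀ (X : PMF (Option (Outcome α))) (q t : ℕ),
      (X.bind (continueWith fun a => (f a).run Q m)).map (addCost q t) =
        (X.map (addCost q t)).bind (continueWith fun a => (f a).run Q m) := by
    intro X q t
    rw [PMF.map_bind, PMF.bind_map]
    congr 1
    funext r
    exact (continueWith_addCost _ _ _ r).symm
  induction p with
  | ret a =>
    simp only [Prog.bind, Prog.run, PMF.pure_bind, continueWith]
    rw [show (addCost 0 0 : Option (Outcome β) → _) = id from funext addCost_zero, PMF.map_id]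
  | abort => simp only [Prog.bind, Prog.run, PMF.pure_bind, continueWith]
  | charge t p ih => simp only [Prog.bind, Prog.run, ih, hmap]
  | query i j p ih => simp only [Prog.bind, Prog.run, ih, hmap]
  | pick vs p ih =>
    simp only [Prog.bind, Prog.run]
    split_ifs with h
    · rw [← hmap, PMF.bind_bind]
      simp only [ih]
    · rw [PMF.pure_bind]; rfl

/-- The program `p` has the output `x` with certainty, at a total cost (queries plus time) of at
most `(2m + 1) c`. As a query costs `m` queries and `m + 1` units of time, it counts once
in `c`, and so does a unit of time that is spent otherwise. -/
def Yields (Q : V → V → Bool) (m : ℕ) (p : Prog V α) (x : α) (c : ℕ) : Prop :=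
  ∃ q t, p.run Q m = PMF.pure (some ⟨x, q, t⟩) ∧ q + t ≤ (2 * m + 1) * c

lemma Yields.mono {p : Prog V α} {x : α} {c c' : ℕ} (h : Yields Q m p x c) (hc : c ≤ c') :
    Yields Q m p x c' :=
  let ⟨q, t, h1, h2⟩ := h
  ⟨q, t, h1, h2.trans (Nat.mul_le_mul_left _ hc)⟩

lemma yields_pure (x : α) : Yields Q m (pure x : Prog V α) x 0 := ⟨0, 0, rfl, by simp⟩

lemma yields_spend (t : ℕ) : Yields Q m (spend t : Prog V Unit) () t :=
  ⟨0, t, by simp [spend, Prog.run, PMF.pure_map, addCost], by nlinarith⟩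

lemma yields_ask (i j : V) : Yields Q m (ask i j) (Q i j) 1 :=
  ⟨m, m + 1, by simp [ask, Prog.run, PMF.pure_map, addCost], by omega⟩

lemma Yields.bind {p : Prog V α} {f : α → Prog V β} {x : α} {y : β} {c c' : ℕ}
    (h : Yields Q m p x c) (h' : Yields Q m (f x) y c') : Yields Q m (p >>= f) y (c + c') := by
  obtain ⟨q, t, h1, h2⟩ := h
  obtain ⟨q', t', h3, h4⟩ := h'
  refine ⟨q' + q, t' + t, ?_, by rw [mul_add]; omega⟩
  rw [run_bind, h1, PMF.pure_bind]
  simp [continueWith, h3, PMF.pure_map, addCost]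

lemma Yields.bind_pure {p : Prog V α} {g : α → β} {x : α} {y : β} {c : ℕ}
    (h : Yields Q m p x c) (hy : g x = y) : Yields Q m (p >>= fun a => pure (g a)) y c :=
  hy ▸ h.bind (f := fun a => pure (g a)) (yields_pure _)

lemma Yields.ask_bind {f : Bool → Prog V β} {i j : V} {b : Bool} {y : β} {c : ℕ} (hb : Q i j = b)
    (h : Yields Q m (f b) y c) : Yields Q m (ask i j >>= f) y (1 + c) :=
  (yields_ask i j).bind (hb ▸ h)

end Runs

/-! ### Scanning and sorting -/

section Scans

variable {V : Type} {Q : V → V → Bool} {m : ℕ}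

lemma yields_nodesBetween [DecidableEq V] (i j : V) (vs : List V) :
    Yields Q m (nodesBetween i j vs)
      (vs.filter fun k => decide (k ≠ i ∧ k ≠ j ∧ Q i k = true ∧ Q k j = true))
      (3 * vs.length) := by
  induction vs with
  | nil => exact yields_pure _
  | cons k ks ih =>
    rw [nodesBetween]
    by_cases hk : k = i ∨ k = j
    · rw [List.filter_cons_of_neg (by simp; tauto), if_pos hk]
      exact ((yields_spend 1).bind ih).mono (by simp; omega)
    · rw [if_neg hk]
      push Not at hk
      cases hb : Q i k with
      | false =>
        rw [List.filter_cons_of_neg (by simp [hb])]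
        exact ((yields_spend 1).bind (Yields.ask_bind hb ih)).mono (by simp; omega)
      | true =>
        cases hc : Q k j with
        | false =>
          rw [List.filter_cons_of_neg (by simp [hc])]
          exact ((yields_spend 1).bind (Yields.ask_bind hb (Yields.ask_bind hc
            (ih.bind_pure rfl)))).mono (by simp; omega)
        | true =>
          rw [List.filter_cons_of_pos (by simp [hb, hc, hk])]
          exact ((yields_spend 1).bind (Yields.ask_bind hb (Yields.ask_bind hc
            (ih.bind_pure rfl)))).mono (by simp; omega)

lemma yields_nodesAbove [DecidableEq V] (i : V) (vs : List V) :
    Yields Q m (nodesAbove i vs) (vs.filter fun j => decide (j ≠ i ∧ Q j i = true))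
      (2 * vs.length) := by
  induction vs with
  | nil => exact yields_pure _
  | cons k ks ih =>
    rw [nodesAbove]
    by_cases hk : k = i
    · rw [List.filter_cons_of_neg (by simp [hk]), if_pos hk]
      exact ((yields_spend 1).bind ih).mono (by simp; omega)
    · rw [if_neg hk]
      cases hb : Q k i with
      | false =>
        rw [List.filter_cons_of_neg (by simp [hb])]
        exact ((yields_spend 1).bind (Yields.ask_bind hb
          (ih.bind_pure rfl))).mono (by simp; omega)
      | true =>
        rw [List.filter_cons_of_pos (by simp [hb, hk])]
        exact ((yields_spend 1).bind (Yields.ask_bind hb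
          (ih.bind_pure rfl))).mono (by simp; omega)

lemma yields_lastAbove (j : V) (best : Option V) (ks : List V) :
    Yields Q m (lastAbove j best ks) ((ks.filter fun k => Q k j).getLast?.or best)
      (2 * ks.length) := by
  induction ks generalizing best with
  | nil => simpa [lastAbove] using yields_pure best
  | cons k ks ih =>
    rw [lastAbove]
    cases hb : Q k j with
    | false =>
      rw [List.filter_cons_of_neg (by simp [hb])]
      exact ((yields_spend 1).bind (Yields.ask_bind (c := 2 * ks.length) hb
        (ih best))).mono (by simp; omega)
    | true =>
      rw [List.filter_cons_of_pos (by simp [hb])]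
      have h : Yields Q m (do
          spend 1
          let b ← ask k j
          lastAbove j (if b then some k else best) ks)
          ((ks.filter fun k => Q k j).getLast?.or (some k)) (2 * (k :: ks).length) :=
        ((yields_spend 1).bind (Yields.ask_bind (c := 2 * ks.length) hb
          (ih (some k)))).mono (by simp; omega)
      convert h using 1
      rw [List.getLast?_cons]
      cases (ks.filter fun k => Q k j).getLast? <;> simp

lemma yields_splitTree [DecidableEq V] (j : V) (vs : List V) :
    Yields Q m (splitTree j vs)
      (vs.filter fun k => decide (¬ (k = j ∨ Q j k = true)),
        vs.filter fun k => decide (k = j ∨ Q j k = true)) (2 * vs.length) := by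
  induction vs with
  | nil => exact yields_pure _
  | cons k ks ih =>
    rw [splitTree]
    by_cases hk : k = j
    · rw [List.filter_cons_of_neg (by simp [hk]), List.filter_cons_of_pos (by simp [hk]),
        if_pos hk]
      exact ((yields_spend 1).bind (ih.bind_pure rfl)).mono (by simp; omega)
    · rw [if_neg hk]
      cases hb : Q j k with
      | false =>
        rw [List.filter_cons_of_pos (by simp [hb, hk]), List.filter_cons_of_neg (by simp [hb, hk])]
        exact ((yields_spend 1).bind (Yields.ask_bind hb
          (ih.bind_pure rfl))).mono (by simp; omega)
      | true =>
        rw [List.filter_cons_of_neg (by simp [hb]), List.filter_cons_of_pos (by simp [hb])]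
        exact ((yields_spend 1).bind (Yields.ask_bind hb
          (ih.bind_pure rfl))).mono (by simp; omega)

/-- The order of the sorted lists. -/
abbrev Before (Q : V → V → Bool) (x y : V) : Prop := Q x y = true

lemma exists_yields_mergeLists (htrans : ∀ x y z, Q x y = true → Q y z = true → Q x z = true)
    (xs ys : List V) (hx : xs.Pairwise (Before Q)) (hy : ys.Pairwise (Before Q))
    (hxy : ∀ x ∈ xs, ∀ y ∈ ys, Q x y = true ∨ Q y x = true) :
    ∃ zs, Yields Q m (mergeLists xs ys) zs (2 * (xs.length + ys.length)) ∧ zs.Perm (xs ++ ys) ∧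
      zs.Pairwise (Before Q) := by
  induction hn : xs.length + ys.length generalizing xs ys with
  | zero =>
    obtain rfl : xs = [] := List.length_eq_zero_iff.1 (by omega)
    rw [mergeLists]
    exact ⟨ys, (yields_pure _).mono (Nat.zero_le _), by simp, hy⟩
  | succ n ih =>
    match xs, ys with
    | [], ys =>
      rw [mergeLists]
      exact ⟨ys, (yields_pure _).mono (Nat.zero_le _), by simp, hy⟩
    | x :: xs, [] =>
      rw [mergeLists]
      exact ⟨x :: xs, (yields_pure _).mono (Nat.zero_le _), by simp, hx⟩
    | x :: xs, y :: ys =>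
      rw [mergeLists]
      rw [List.pairwise_cons] at hx hy
      simp only [List.length_cons] at hn
      cases hb : Q x y with
      | true =>
        obtain ⟨zs, h1, h2, h3⟩ := ih xs (y :: ys) hx.2 (List.pairwise_cons.2 hy)
          (fun a ha b hb => hxy a (List.mem_cons_of_mem _ ha) b hb) (by simp; omega)
        refine ⟨x :: zs, ((yields_spend 1).bind (Yields.ask_bind hb
          (h1.bind_pure rfl))).mono (by omega), by simpa using h2,
          List.pairwise_cons.2 ⟨fun z hz => ?_, h3⟩⟩
        rcases List.mem_append.1 (h2.subset hz) with hz | hz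
        · exact hx.1 z hz
        · rcases List.mem_cons.1 hz with rfl | hz
          · exact hb
          · exact htrans _ _ _ hb (hy.1 z hz)
      | false =>
        have hb' : Q y x = true := by
          rcases hxy x (by simp) y (by simp) with h | h
          · rw [hb] at h; exact absurd h (by simp)
          · exact h
        obtain ⟨zs, h1, h2, h3⟩ := ih (x :: xs) ys (List.pairwise_cons.2 hx) hy.2
          (fun a ha b hb => hxy a ha b (List.mem_cons_of_mem _ hb)) (by simp; omega)
        refine ⟨y :: zs, ((yields_spend 1).bind (Yields.ask_bind hb
          (h1.bind_pure rfl))).mono (by omega), ?_,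
          List.pairwise_cons.2 ⟨fun z hz => ?_, h3⟩⟩
        · exact (h2.cons y).trans List.perm_middle.symm
        · rcases List.mem_append.1 (h2.subset hz) with hz | hz
          · rcases List.mem_cons.1 hz with rfl | hz
            · exact hb'
            · exact htrans _ _ _ hb' (hx.1 z hz)
          · exact hy.1 z hz

/-- Merge sort sorts chains, at a cost of at most `3 ℓ ⌈log₂ ℓ⌉`. -/
lemma exists_yields_sortNodes (htrans : ∀ x y z, Q x y = true → Q y z = true → Q x z = true)
    (xs : List V) (hx : xs.Pairwise fun x y => Q x y = true ∨ Q y x = true) :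
    ∃ zs, Yields Q m (sortNodes xs) zs (3 * (xs.length * Nat.clog 2 xs.length)) ∧ zs.Perm xs ∧
      zs.Pairwise (Before Q) := by
  induction hn : xs.length using Nat.strong_induction_on generalizing xs with
  | _ n ih =>
    subst hn
    rw [sortNodes]
    by_cases h : xs.length < 2
    · rw [dif_pos h]
      refine ⟨xs, (yields_pure _).mono (Nat.zero_le _), List.Perm.refl _, ?_⟩
      match xs, h with
      | [], _ => simp
      | [x], _ => simp
    · rw [dif_neg h]
      rw [← List.take_append_drop (xs.length / 2) xs, List.pairwise_append] at hx
      obtain ⟨ys, h1, h2, h3⟩ := ih _ (by simp only [List.length_take]; omega)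
        (xs.take (xs.length / 2)) hx.1 rfl
      obtain ⟨zs, h4, h5, h6⟩ := ih _ (by simp only [List.length_drop]; omega)
        (xs.drop (xs.length / 2)) hx.2.1 rfl
      obtain ⟨ws, h7, h8, h9⟩ := exists_yields_mergeLists (m := m) htrans ys zs h3 h6
        fun x hx' y hy' => hx.2.2 x (h2.subset hx') y (h5.subset hy')
      refine ⟨ws, ((yields_spend _).bind (h1.bind (h4.bind h7))).mono ?_, ?_, h9⟩
      · rw [h2.length_eq, h5.length_eq]
        simp only [List.length_take, List.length_drop]
        rw [Nat.min_eq_left (by omega)]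
        obtain ⟨l, hl⟩ : ∃ l, xs.length = l := ⟨_, rfl⟩
        rw [hl] at h ⊢
        have hc : Nat.clog 2 l = Nat.clog 2 ((l + 1) / 2) + 1 :=
          Nat.clog_of_two_le one_lt_two (by omega)
        have hc1 : Nat.clog 2 (l / 2) ≤ Nat.clog 2 ((l + 1) / 2) := Nat.clog_mono_right 2 (by omega)
        have hc2 : Nat.clog 2 (l - l / 2) ≤ Nat.clog 2 ((l + 1) / 2) :=
          Nat.clog_mono_right 2 (by omega)
        rw [hc]
        have h10 := Nat.mul_le_mul_left (l / 2) hc1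
        have h11 := Nat.mul_le_mul_left (l - l / 2) hc2
        have h12 : l / 2 * Nat.clog 2 ((l + 1) / 2) + (l - l / 2) * Nat.clog 2 ((l + 1) / 2) =
            l * Nat.clog 2 ((l + 1) / 2) := by
          rw [← add_mul]; congr 1; omega
        have h13 : l * (Nat.clog 2 ((l + 1) / 2) + 1) = l * Nat.clog 2 ((l + 1) / 2) + l := by ring
        omega
      · refine h8.trans ((h2.append h5).trans ?_)
        rw [List.take_append_drop]

end Scans

/-! ### Paths and bags -/

section Paths

variable {V : Type} {E : Finset (V × V)} {m : ℕ} {S : Finset V} {vs : List V}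

lemma pathQuery_trans {x y z : V} (h : pathQuery E x y = true) (h' : pathQuery E y z = true) :
    pathQuery E x z = true := by
  simp only [pathQuery, decide_eq_true_eq] at h h' ⊢
  exact h.trans h'

/-- The path between `i` and `j` in the undirected skeleton of `S`, bent at the lowest common ancestor
`x`: the vertices `left` lead down from `x` to `i`, the vertices `right` lead down from `x` to `j`,
and `x` is in neither list. -/
structure IsBentPath (E : Finset (V × V)) (S : Finset V) (i j x : V) (left right : List V) :
    Prop where
  top_mem : x ∈ S
  left_sorted : (x :: left).Pairwise (Before (pathQuery E))
  right_sorted : (x :: right).Pairwise (Before (pathQuery E))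
  mem_left : ∀ z, z ∈ left ↔ z ∈ S ∧ z ≠ x ∧ AncEq E x z ∧ AncEq E z i
  mem_right : ∀ z, z ∈ right ↔ z ∈ S ∧ z ≠ x ∧ AncEq E x z ∧ AncEq E z j
  top_left : AncEq E x i
  top_right : AncEq E x j
  common : ∀ z, AncEq E x z → AncEq E z i → AncEq E z j → z = x

lemma IsRootedTree.comparable (hE : IsRootedTree E) {x y k : V} (hx : AncEq E x k)
    (hy : AncEq E y k) (hxy : x ≠ y) : pathQuery E x y = true ∨ pathQuery E y x = true := by
  rw [hE.pathQuery_iff, hE.pathQuery_iff]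
  rcases hE.ancEq_total hx hy with h | h
  · exact Or.inl ⟨h, hxy⟩
  · exact Or.inr ⟨h, hxy.symm⟩

/-- Sorting a list of ancestors of one vertex. -/
lemma IsRootedTree.exists_yields_sortNodes_of_chain (hE : IsRootedTree E) {l : List V}
    (hl : l.Nodup) {k : V} (hk : ∀ z ∈ l, AncEq E z k) {n : ℕ} (hn : l.length ≤ n) :
    ∃ zs, Yields (pathQuery E) m (sortNodes l) zs (3 * (n * Nat.clog 2 n)) ∧ zs.Perm l ∧
      zs.Pairwise (Before (pathQuery E)) := by
  obtain ⟨zs, h1, h2, h3⟩ := exists_yields_sortNodes (m := m) (Q := pathQuery E)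
    (fun _ _ _ => pathQuery_trans) l
    (List.Pairwise.imp_of_mem (fun hx hy hxy => hE.comparable (hk _ hx) (hk _ hy) hxy) hl)
  exact ⟨zs, h1.mono (Nat.mul_le_mul_left _
    (Nat.mul_le_mul hn (Nat.clog_mono_right 2 hn))), h2, h3⟩

lemma IsRootedTree.exists_yields_directedPath [DecidableEq V] (hE : IsRootedTree E) (hnd : vs.Nodup)
    (hvs : ∀ z, z ∈ vs ↔ z ∈ S) {x i : V} (hi : i ∈ S) (hxi : pathQuery E x i = true) :
    ∃ l mid, Yields (pathQuery E) m (nodesBetween x i vs) l (3 * vs.length) ∧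
      Yields (pathQuery E) m (sortNodes l) mid (3 * (vs.length * Nat.clog 2 vs.length)) ∧
      mid.length ≤ vs.length ∧
      (x :: (mid ++ [i])).Pairwise (Before (pathQuery E)) ∧
      ∀ z, z ∈ mid ++ [i] ↔ z ∈ S ∧ z ≠ x ∧ AncEq E x z ∧ AncEq E z i := by
  have h1 := yields_nodesBetween (Q := pathQuery E) (m := m) x i vs
  set l := vs.filter fun k =>
    decide (k ≠ x ∧ k ≠ i ∧ pathQuery E x k = true ∧ pathQuery E k i = true) with hl
  have hmem : ∀ z, z ∈ l ↔ z ∈ S ∧ pathQuery E x z = true ∧ pathQuery E z i = true := by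
    intro z
    simp only [hl, List.mem_filter, hvs, decide_eq_true_eq]
    constructor
    · exact fun h => ⟨h.1, h.2.2.2⟩
    · exact fun h => ⟨h.1, (hE.pathQuery_iff.1 h.2.1).2.symm, (hE.pathQuery_iff.1 h.2.2).2, h.2⟩
  have hlen : l.length ≤ vs.length := List.length_filter_le _ _
  obtain ⟨mid, h2, h3, h4⟩ := hE.exists_yields_sortNodes_of_chain (m := m) (hnd.filter _)
    (k := i) (fun z hz => (hE.pathQuery_iff.1 ((hmem z).1 hz).2.2).1) hlen
  refine ⟨l, mid, h1, h2, h3.length_eq.trans_le hlen, ?_, fun z => ?_⟩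
  · rw [List.pairwise_cons, List.pairwise_append]
    refine ⟨fun z hz => ?_, h4, by simp, fun z hz w hw => ?_⟩
    · rcases List.mem_append.1 hz with hz | hz
      · exact ((hmem z).1 (h3.subset hz)).2.1
      · exact List.mem_singleton.1 hz ▸ hxi
    · exact List.mem_singleton.1 hw ▸ ((hmem z).1 (h3.subset hz)).2.2
  · rw [List.mem_append, h3.mem_iff, hmem, List.mem_singleton, hE.pathQuery_iff, hE.pathQuery_iff]
    constructor
    · rintro (h | rfl)
      · exact ⟨h.1, h.2.1.2.symm, h.2.1.1, h.2.2.1⟩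
      · exact ⟨hi, (hE.pathQuery_iff.1 hxi).2.symm, (hE.pathQuery_iff.1 hxi).1, AncEq.refl _⟩
    · intro h
      by_cases hzi : z = i
      · exact Or.inr hzi
      · exact Or.inl ⟨h.1, ⟨h.2.2.1, h.2.1.symm⟩, h.2.2.2, hzi⟩

/-- With correct answers, the algorithm finds the path between `i` and `j`; if `j` is an ancestor of
`i`, it is listed from `j` to `i`. -/
lemma IsRootedTree.exists_yields_multidirPath [DecidableEq V] (hE : IsRootedTree E)
    (hS : IsSubtree E S) (hnd : vs.Nodup) (hvs : ∀ z, z ∈ vs ↔ z ∈ S) {i j : V} (hi : i ∈ S) (hj : j ∈ S) :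
    ∃ x left right, Yields (pathQuery E) m (multidirPath vs i j)
        (left.reverse ++ x :: right, left.length)
        (16 * vs.length + 9 * (vs.length * Nat.clog 2 vs.length)) ∧
      (IsBentPath E S i j x left right ∨ IsBentPath E S j i x left right) := by
  have hpos : 0 < vs.length := List.length_pos_of_mem ((hvs i).2 hi)
  -- the path from a vertex to a descendant
  have hdown : ∀ i j : V, i ∈ S → pathQuery E i j = true → ∀ right : List V,
      (i :: right).Pairwise (Before (pathQuery E)) →
      (∀ z, z ∈ right ↔ z ∈ S ∧ z ≠ i ∧ AncEq E i z ∧ AncEq E z j) →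
      IsBentPath E S i j i [] right := by
    intro i j hi hij right h1 h2
    refine ⟨hi, by simp, h1, fun z => ?_, h2, AncEq.refl i, (hE.pathQuery_iff.1 hij).1,
      fun z h h' _ => hE.ancEq_antisymm h' h⟩
    simp only [List.not_mem_nil, false_iff]
    exact fun h => h.2.1 (hE.ancEq_antisymm h.2.2.2 h.2.2.1)
  rw [multidirPath]
  by_cases hij : i = j
  · subst hij
    rw [if_pos rfl]
    refine ⟨i, [], [], (yields_pure _).mono (Nat.zero_le _), Or.inl ?_⟩
    refine ⟨hi, by simp, by simp, fun z => ?_, fun z => ?_, AncEq.refl i, AncEq.refl i,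
      fun z h h' _ => hE.ancEq_antisymm h' h⟩ <;>
    · simp only [List.not_mem_nil, false_iff]
      exact fun h => h.2.1 (hE.ancEq_antisymm h.2.2.2 h.2.2.1)
  rw [if_neg hij]
  cases hb : pathQuery E i j with
  | true =>
    obtain ⟨l, mid, h1, h2, h3, h4, h5⟩ := hE.exists_yields_directedPath (m := m) hnd hvs hj hb
    exact ⟨i, [], mid ++ [j], (Yields.ask_bind hb (h1.bind (h2.bind_pure rfl))).mono (by omega),
      Or.inl (hdown i j hi hb _ h4 h5)⟩
  | false =>
    cases hc : pathQuery E j i with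
    | true =>
      obtain ⟨l, mid, h1, h2, h3, h4, h5⟩ := hE.exists_yields_directedPath (m := m) hnd hvs hi hc
      exact ⟨j, [], mid ++ [i], (Yields.ask_bind hb (Yields.ask_bind hc
        (h1.bind (h2.bind_pure rfl)))).mono (by omega), Or.inr (hdown j i hj hc _ h4 h5)⟩
    | false =>
      have h1 := yields_nodesAbove (Q := pathQuery E) (m := m) i vs
      set l := vs.filter fun k => decide (k ≠ i ∧ pathQuery E k i = true) with hl
      have hmem : ∀ z, z ∈ l ↔ z ∈ S ∧ z ≠ i ∧ AncEq E z i := by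
        intro z
        simp only [hl, List.mem_filter, hvs, decide_eq_true_eq, hE.pathQuery_iff]
        tauto
      have hlen : l.length ≤ vs.length := List.length_filter_le _ _
      obtain ⟨anc, h2, h3, h4⟩ := hE.exists_yields_sortNodes_of_chain (m := m) (hnd.filter _)
        (k := i) (fun z hz => ((hmem z).1 hz).2.2) hlen
      have h5 := yields_lastAbove (Q := pathQuery E) (m := m) j none anc
      have hij' : ¬ AncEq E i j := fun h => by simp [hE.pathQuery_iff.2 ⟨h, hij⟩] at hb
      have hji' : ¬ AncEq E j i := fun h => by
        simp [hE.pathQuery_iff.2 ⟨h, fun h => hij h.symm⟩] at hc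
      set cs := anc.filter fun k => pathQuery E k j with hcs
      have hmemc : ∀ z, z ∈ cs ↔ z ∈ S ∧ AncEq E z i ∧ AncEq E z j := by
        intro z
        rw [hcs, List.mem_filter, h3.mem_iff, hmem, hE.pathQuery_iff]
        constructor
        · exact fun h => ⟨h.1.1, h.1.2.2, h.2.1⟩
        · exact fun h => ⟨⟨h.1, fun hz => hij' (hz ▸ h.2.2), h.2.1⟩, h.2.2,
            fun hz => hji' (hz ▸ h.2.1)⟩
      obtain ⟨r, hr, hr'⟩ := id hS
      obtain ⟨cs', x, hcx⟩ : ∃ cs' x, cs = cs' ++ [x] := by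
        have hne : cs ≠ [] := List.ne_nil_of_mem ((hmemc r).2 ⟨hr, (hr' i hi).1, (hr' j hj).1⟩)
        exact ⟨cs.dropLast, cs.getLast hne, (List.dropLast_append_getLast hne).symm⟩
      have hx := (hmemc x).1 (by simp [hcx])
      have hlast : ∀ z, z ∈ cs → AncEq E z x := by
        intro z hz
        have hp : cs.Pairwise (Before (pathQuery E)) := h4.filter _
        rw [hcx, List.pairwise_append] at hp
        rw [hcx, List.mem_append, List.mem_singleton] at hz
        rcases hz with hz | rfl
        · exact (hE.pathQuery_iff.1 (hp.2.2 z hz x (by simp))).1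
        · exact AncEq.refl _
      have hlca : Yields (pathQuery E) m (findCommonAncestor vs i j) (some x)
          (4 * vs.length + 3 * (vs.length * Nat.clog 2 vs.length)) := by
        rw [hcx] at h5
        rw [findCommonAncestor, findPathFromRoot]
        have h6 := (h1.bind h2).bind h5
        simp only [List.getLast?_append, List.getLast?_singleton, Option.some_or,
          Option.or_none] at h6
        refine h6.mono ?_
        have : anc.length = l.length := h3.length_eq
        omega
      have hxi : pathQuery E x i = true :=
        hE.pathQuery_iff.2 ⟨hx.2.1, fun h => hij' (h ▸ hx.2.2)⟩
      have hxj : pathQuery E x j = true :=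
        hE.pathQuery_iff.2 ⟨hx.2.2, fun h => hji' (h ▸ hx.2.1)⟩
      obtain ⟨l1, left, a1, a2, a3, a4, a5⟩ :=
        hE.exists_yields_directedPath (m := m) hnd hvs hi hxi
      obtain ⟨l2, right, b1, b2, b3, b4, b5⟩ :=
        hE.exists_yields_directedPath (m := m) hnd hvs hj hxj
      refine ⟨x, left ++ [i], right ++ [j], ?_, Or.inl ⟨hx.1, a4, b4, a5, b5, hx.2.1, hx.2.2,
        fun z h h' h'' => ?_⟩⟩
      · rw [show ((left ++ [i]).reverse ++ x :: (right ++ [j]), (left ++ [i]).length) =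
          (i :: (left.reverse ++ x :: (right ++ [j])), left.length + 1) by simp]
        refine (Yields.ask_bind hb (Yields.ask_bind (c := 4 * vs.length +
          3 * (vs.length * Nat.clog 2 vs.length) + (3 * vs.length +
          (3 * (vs.length * Nat.clog 2 vs.length) + (3 * vs.length +
          (3 * (vs.length * Nat.clog 2 vs.length) + (left.length + right.length)))))) hc
          (hlca.bind ?_))).mono (by omega)
        exact a1.bind (a2.bind (b1.bind (b2.bind ((yields_spend _).bind_pure rfl))))
      · exact hE.ancEq_antisymm (hlast z ((hmemc z).2 ⟨hS.convex hx.1 hi h h', h', h''⟩)) h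

end Paths

section Bags

variable {V : Type} {E : Finset (V × V)} {m : ℕ} {S : Finset V} {vs : List V}

/-- Binary search on a directed path for the last ancestor of `k`. -/
lemma exists_yields_findBagLoop {path : List V} (hp : path.Pairwise (Before (pathQuery E))) (k : V)
    {l r : ℕ} (hlr : l < r) (hr : r ≤ path.length) :
    ∃ t, Yields (pathQuery E) m (findBagLoop path k l r) t (2 * Nat.clog 2 (r - l)) ∧ t < r ∧
      (t = l ∨ ∀ x, path[t]? = some x → pathQuery E x k = true) ∧
      ∀ s x, t < s → s < r → path[s]? = some x → pathQuery E x k = false := by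
  induction hn : r - l using Nat.strong_induction_on generalizing l r with
  | _ n ih =>
    subst hn
    rw [findBagLoop]
    by_cases h : l + 1 < r
    · rw [dif_pos h]
      have hm : (l + r) / 2 < path.length := by omega
      rw [List.getElem?_eq_getElem hm]
      have hc : Nat.clog 2 (r - l) = Nat.clog 2 ((r - l + 1) / 2) + 1 :=
        Nat.clog_of_two_le one_lt_two (by omega)
      cases hb : pathQuery E path[(l + r) / 2] k with
      | true =>
        obtain ⟨t, h1, h2, h3, h4⟩ := ih (r - (l + r) / 2) (by omega) (l := (l + r) / 2) (r := r)
          (by omega) hr rfl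
        refine ⟨t, ((yields_spend 1).bind (Yields.ask_bind hb h1)).mono ?_, h2, Or.inr ?_, h4⟩
        · have := Nat.clog_mono_right 2 (by omega : r - (l + r) / 2 ≤ (r - l + 1) / 2)
          omega
        · rcases h3 with rfl | h3
          · intro x hx
            rw [List.getElem?_eq_getElem hm, Option.some_inj] at hx
            exact hx ▸ hb
          · exact h3
      | false =>
        obtain ⟨t, h1, h2, h3, h4⟩ := ih ((l + r) / 2 - l) (by omega) (l := l) (r := (l + r) / 2)
          (by omega) (by omega) rfl
        refine ⟨t, ((yields_spend 1).bind (Yields.ask_bind hb h1)).mono ?_, by omega, h3, ?_⟩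
        · have := Nat.clog_mono_right 2 (by omega : (l + r) / 2 - l ≤ (r - l + 1) / 2)
          omega
        · intro s x hts hsr hx
          rcases lt_trichotomy s ((l + r) / 2) with hs | rfl | hs
          · exact h4 s x hts hs hx
          · rw [List.getElem?_eq_getElem hm, Option.some_inj] at hx
            exact hx ▸ hb
          · by_contra hne
            rw [Bool.not_eq_false] at hne
            have hs' : s < path.length := by omega
            rw [List.getElem?_eq_getElem hs', Option.some_inj] at hx
            have := pathQuery_trans (List.pairwise_iff_getElem.1 hp _ _ hm hs' hs) (hx ▸ hne)
            rw [hb] at this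
            exact absurd this (by simp)
    · rw [dif_neg h]
      exact ⟨l, (yields_pure l).mono (Nat.zero_le _), hlr, Or.inl rfl, fun s x h1 h2 => by omega⟩

lemma IsBentPath.nodup {i j x : V} {left right : List V} (hE : IsRootedTree E)
    (h : IsBentPath E S i j x left right) : (left.reverse ++ x :: right).Nodup := by
  have hnd : ∀ l : List V, l.Pairwise (Before (pathQuery E)) → l.Nodup := fun l hl =>
    hl.imp fun hxy => (hE.pathQuery_iff.1 hxy).2
  have h1 := List.nodup_cons.1 (hnd _ h.left_sorted)
  refine List.nodup_append.2 ⟨List.nodup_reverse.2 h1.2, hnd _ h.right_sorted, ?_⟩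
  rintro z hz w hw rfl
  rw [List.mem_reverse] at hz
  rcases List.mem_cons.1 hw with rfl | hw
  · exact h1.1 hz
  · have h2 := (h.mem_left z).1 hz
    exact h2.2.1 (h.common z h2.2.2.1 h2.2.2.2 ((h.mem_right z).1 hw).2.2.2)

lemma IsBentPath.mem {i j x : V} {left right : List V} (h : IsBentPath E S i j x left right) {z : V}
    (hz : z ∈ left.reverse ++ x :: right) : z ∈ S := by
  rw [List.mem_append, List.mem_reverse, List.mem_cons] at hz
  rcases hz with hz | rfl | hz
  · exact ((h.mem_left z).1 hz).1
  · exact h.top_mem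
  · exact ((h.mem_right z).1 hz).1

lemma IsBentPath.not_ancEq {i j x : V} {left right : List V}
    (h : IsBentPath E S i j x left right) {z w : V} (hz : z ∈ left) (hw : w ∈ right) :
    ¬ AncEq E z w ∧ ¬ AncEq E w z := by
  rw [h.mem_left] at hz
  rw [h.mem_right] at hw
  exact ⟨fun h' => hz.2.1 (h.common z hz.2.2.1 hz.2.2.2 (h'.trans hw.2.2.2)),
    fun h' => hw.2.1 (h.common w hw.2.2.1 (h'.trans hz.2.2.2) hw.2.2.2)⟩

lemma getElem?_bentPath_left {x : V} {left right : List V} {q : ℕ} (hq : q ≤ left.length) :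
    (left.reverse ++ x :: right)[q]? = (x :: left)[left.length - q]? := by
  rw [show left.reverse ++ x :: right = (x :: left).reverse ++ right by simp,
    List.getElem?_append_left (by simp; omega), List.getElem?_reverse (by simp; omega)]
  simp

lemma getElem?_bentPath_right {x : V} {left right : List V} {q : ℕ} (hq : left.length ≤ q) :
    (left.reverse ++ x :: right)[q]? = (x :: right)[q - left.length]? := by
  rw [List.getElem?_append_right (by simpa using hq)]
  simp

lemma mem_tail_of_getElem? {x v : V} {l : List V} {q : ℕ} (hq : 0 < q)
    (h : (x :: l)[q]? = some v) : v ∈ l := by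
  obtain ⟨p, rfl⟩ : ∃ p, q = p + 1 := ⟨q - 1, by omega⟩
  rw [List.getElem?_cons_succ] at h
  exact List.mem_of_getElem? h

lemma before_of_getElem? {l : List V} (hl : l.Pairwise (Before (pathQuery E))) {p q : ℕ} {v w : V}
    (hpq : p < q) (hv : l[p]? = some v) (hw : l[q]? = some w) : pathQuery E v w = true := by
  obtain ⟨hp, rfl⟩ := List.getElem?_eq_some_iff.1 hv
  obtain ⟨hq, rfl⟩ := List.getElem?_eq_some_iff.1 hw
  exact List.pairwise_iff_getElem.1 hl _ _ hp hq hpq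

/-- The vertex `k` is on the side of `x_q` of the edge between the vertices `x_q` and `x_{q+1}` of a
path, where `v` is the lower end of this edge and `a` the position of the top of the path. -/
def OnSide (E : Finset (V × V)) (a q : ℕ) (v k : V) : Prop :=
  if q < a then AncEq E v k else ¬ AncEq E v k

/-- The bag that is found for `k` lies on the same side of each edge of the path as `k`. -/
lemma IsBentPath.exists_bag {i j x : V} {left right : List V} (hE : IsRootedTree E)
    (h : IsBentPath E S i j x left right) {k : V} (hk : k ∉ left.reverse ++ x :: right) {n : ℕ}
    (hn : (left.reverse ++ x :: right).length ≤ n) :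
    ∃ l r, Yields (pathQuery E) m
        (findBag ((left.reverse ++ x :: right).take (left.length + 1)).reverse k) l
        (2 * Nat.clog 2 n) ∧
      Yields (pathQuery E) m (findBag ((left.reverse ++ x :: right).drop left.length) k) r
        (2 * Nat.clog 2 n) ∧
      (if l = 0 then left.length + r else left.length - l) <
        (left.reverse ++ x :: right).length ∧
      ∀ q v, (left.reverse ++ x :: right)[if q < left.length then q else q + 1]? = some v →
        ((if l = 0 then left.length + r else left.length - l) < q + 1 ↔
          OnSide E left.length q v k) := by
  have h1 : ((left.reverse ++ x :: right).take (left.length + 1)).reverse = x :: left := by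
    rw [show left.reverse ++ x :: right = (x :: left).reverse ++ right by simp,
      List.take_left' (by simp), List.reverse_reverse]
  have h2 : (left.reverse ++ x :: right).drop left.length = x :: right :=
    List.drop_left' (by simp)
  rw [h1, h2, findBag, findBag]
  simp only [List.length_append, List.length_reverse, List.length_cons] at hn ⊢
  obtain ⟨l, l1, l2, l3, l4⟩ := exists_yields_findBagLoop (m := m) h.left_sorted k
    (l := 0) (r := (x :: left).length) (by simp) le_rfl
  obtain ⟨r, r1, r2, r3, r4⟩ := exists_yields_findBagLoop (m := m) h.right_sorted k
    (l := 0) (r := (x :: right).length) (by simp) le_rfl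
  simp only [List.length_cons, Nat.sub_zero] at l1 l2 l4 r1 r2 r4
  have hne : ∀ {v}, v ∈ left.reverse ++ x :: right → (pathQuery E v k = true ↔ AncEq E v k) :=
    fun {v} hv => by
      rw [hE.pathQuery_iff]
      exact and_iff_left fun hvk => hk (hvk ▸ hv)
  refine ⟨l, r, l1.mono (Nat.mul_le_mul_left _ (Nat.clog_mono_right 2 (by omega))),
    r1.mono (Nat.mul_le_mul_left _ (Nat.clog_mono_right 2 (by omega))), by split_ifs <;> omega,
    fun q v hv => ?_⟩
  have hvk := hne (List.mem_of_getElem? hv)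
  unfold OnSide
  by_cases hq : q < left.length
  · rw [if_pos hq] at hv ⊢
    rw [getElem?_bentPath_left hq.le] at hv
    rw [← hvk]
    by_cases hl : l = 0
    · rw [if_pos hl]
      have := l4 (left.length - q) v (by omega) (by omega) hv
      simp [this]; omega
    · rw [if_neg hl]
      have hlk := l3.resolve_left hl
      rcases lt_trichotomy (left.length - q) l with hlt | heq | hgt
      · obtain ⟨w, hw⟩ : ∃ w, (x :: left)[l]? = some w :=
          ⟨_, List.getElem?_eq_getElem (by simpa using l2)⟩
        have := pathQuery_trans (before_of_getElem? h.left_sorted hlt hv hw) (hlk w hw)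
        simp [this]; omega
      · have := hlk v (heq ▸ hv)
        simp [this]; omega
      · have := l4 _ v hgt (by omega) hv
        simp [this]; omega
  · rw [if_neg hq] at hv ⊢
    rw [getElem?_bentPath_right (by omega)] at hv
    have hvr : v ∈ right := mem_tail_of_getElem? (by omega) hv
    rw [← hvk]
    by_cases hl : l = 0
    · rw [if_pos hl]
      rcases lt_trichotomy (q + 1 - left.length) r with hlt | heq | hgt
      · have hrk := r3.resolve_left (by omega)
        obtain ⟨w, hw⟩ : ∃ w, (x :: right)[r]? = some w :=
          ⟨_, List.getElem?_eq_getElem (by simpa using r2)⟩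
        have := pathQuery_trans (before_of_getElem? h.right_sorted hlt hv hw) (hrk w hw)
        simp [this]; omega
      · have hrk := r3.resolve_left (by omega)
        have := hrk v (heq ▸ hv)
        simp [this]; omega
      · have hlt : q + 1 - left.length < right.length + 1 := by
          have := (List.getElem?_eq_some_iff.1 hv).1
          simpa using this
        have := r4 _ v hgt hlt hv
        simp [this]; omega
    · rw [if_neg hl]
      -- an ancestor of `k` on the left path excludes ancestors of `k` on the right path
      obtain ⟨w, hw⟩ : ∃ w, (x :: left)[l]? = some w :=
        ⟨_, List.getElem?_eq_getElem (by simpa using l2)⟩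
      have hwl : w ∈ left := mem_tail_of_getElem? (by omega) hw
      have hwk := (hE.pathQuery_iff.1 (l3.resolve_left hl w hw)).1
      have : ¬ pathQuery E v k = true := by
        rw [hvk]
        intro hv'
        rcases hE.ancEq_total hwk hv' with h' | h'
        · exact (h.not_ancEq hwl hvr).1 h'
        · exact (h.not_ancEq hwl hvr).2 h'
      exact iff_of_true (by omega) this

/-- The vertices of a path on the side of `x_q` are `x_0, …, x_q`. -/
lemma IsBentPath.onSide_iff {i j x : V} {left right : List V} (hE : IsRootedTree E)
    (h : IsBentPath E S i j x left right) {p q : ℕ} {v k : V}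
    (hv : (left.reverse ++ x :: right)[if q < left.length then q else q + 1]? = some v)
    (hk : (left.reverse ++ x :: right)[p]? = some k) :
    OnSide E left.length q v k ↔ p < q + 1 := by
  have hasymm : ∀ {u w}, pathQuery E u w = true → ¬ AncEq E w u := fun {u w} huw hwu =>
    (hE.pathQuery_iff.1 huw).2 (hE.ancEq_antisymm (hE.pathQuery_iff.1 huw).1 hwu)
  unfold OnSide
  by_cases hq : q < left.length
  · rw [if_pos hq] at hv ⊢
    rw [getElem?_bentPath_left hq.le] at hv
    by_cases hp : p ≤ left.length
    · rw [getElem?_bentPath_left hp] at hk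
      rcases lt_trichotomy p q with hpq | rfl | hpq
      · have := before_of_getElem? h.left_sorted
          (by omega : left.length - q < left.length - p) hv hk
        simp [(hE.pathQuery_iff.1 this).1]; omega
      · rw [hv, Option.some_inj] at hk
        simp [hk, AncEq.refl]
      · have := before_of_getElem? h.left_sorted
          (by omega : left.length - p < left.length - q) hk hv
        simp [hasymm this]; omega
    · rw [getElem?_bentPath_right (by omega)] at hk
      have := (h.not_ancEq (mem_tail_of_getElem? (by omega) hv)
        (mem_tail_of_getElem? (by omega) hk)).1
      simp [this]; omega
  · rw [if_neg hq] at hv ⊢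
    rw [getElem?_bentPath_right (by omega)] at hv
    by_cases hp : left.length ≤ p
    · rw [getElem?_bentPath_right hp] at hk
      rcases lt_trichotomy p (q + 1) with hpq | rfl | hpq
      · have := before_of_getElem? h.right_sorted
          (by omega : p - left.length < q + 1 - left.length) hk hv
        simp [hasymm this]; omega
      · rw [hv, Option.some_inj] at hk
        simp [hk, AncEq.refl]
      · have := before_of_getElem? h.right_sorted
          (by omega : q + 1 - left.length < p - left.length) hv hk
        simp [(hE.pathQuery_iff.1 this).1]; omega
    · rw [getElem?_bentPath_left (by omega)] at hk
      have := (h.not_ancEq (mem_tail_of_getElem? (by omega) hk)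
        (mem_tail_of_getElem? (by omega) hv)).2
      simp [this]; omega

lemma sum_take_modify_succ (size : List ℕ) (b q : ℕ) (hb : b < size.length) :
    ((size.modify b (· + 1)).take q).sum = (size.take q).sum + if b < q then 1 else 0 := by
  induction size generalizing b q with
  | nil => simp at hb
  | cons s size ih =>
    cases q with
    | zero => simp
    | succ q =>
      cases b with
      | zero => simp; omega
      | succ b =>
        simp only [List.modify_succ_cons, List.take_succ_cons, List.sum_cons]
        rw [ih b q (by simpa using hb)]
        simp [add_assoc]

lemma exists_yields_bagSizes [DecidableEq V] {path : List V} {a C : ℕ} {β : V → ℕ} (ks : List V)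
    (size : List ℕ)
    (hβ : ∀ k ∈ ks, k ∉ path → ∃ l r,
      Yields (pathQuery E) m (findBag (path.take (a + 1)).reverse k) l C ∧
      Yields (pathQuery E) m (findBag (path.drop a) k) r C ∧
      (if l = 0 then a + r else a - l) = β k)
    (hlt : ∀ k ∈ ks, k ∉ path → β k < size.length) :
    ∃ out, Yields (pathQuery E) m (bagSizes path a ks size) out (ks.length * (1 + 2 * C)) ∧
      out.length = size.length ∧ ∀ q, (out.take q).sum =
        (size.take q).sum + (ks.filter fun k => decide (k ∉ path ∧ β k < q)).length := by
  induction ks generalizing size with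
  | nil => exact ⟨size, (yields_pure _).mono (Nat.zero_le _), rfl, by simp⟩
  | cons k ks ih =>
    rw [bagSizes]
    by_cases hk : k ∈ path
    · obtain ⟨out, h1, h2, h3⟩ := ih size (fun k hk => hβ k (List.mem_cons_of_mem _ hk))
        (fun k hk => hlt k (List.mem_cons_of_mem _ hk))
      rw [if_pos hk]
      refine ⟨out, ((yields_spend 1).bind h1).mono (by simp [add_mul]; omega), h2, fun q => ?_⟩
      rw [h3, List.filter_cons_of_neg (by simp [hk])]
    · obtain ⟨l, r, hl, hr, hlr⟩ := hβ k (by simp) hk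
      have hb := hlt k (by simp) hk
      obtain ⟨out, h1, h2, h3⟩ := ih (size.modify (β k) (· + 1))
        (fun k hk => hβ k (List.mem_cons_of_mem _ hk))
        (fun k hk => by simpa using hlt k (List.mem_cons_of_mem _ hk))
      rw [if_neg hk]
      refine ⟨out, ((yields_spend 1).bind (hl.bind (hr.bind (hlr ▸ h1)))).mono
        (by simp [add_mul]; omega), by simpa using h2, fun q => ?_⟩
      rw [h3, sum_take_modify_succ _ _ _ hb]
      by_cases hq : β k < q
      · rw [List.filter_cons_of_pos (by simp [hk, hq])]
        simp [hq]; omega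
      · rw [List.filter_cons_of_neg (by simp [hq])]
        simp [hq]

/-- The sizes of the bags add up to the sizes of the parts into which the edges of the path divide
the tree. -/
lemma IsBentPath.exists_yields_bagSizes [DecidableEq V] {i j x : V} {left right : List V}
    (hE : IsRootedTree E)
    (hnd : vs.Nodup) (hvs : ∀ z, z ∈ vs ↔ z ∈ S) (h : IsBentPath E S i j x left right) :
    ∃ out, Yields (pathQuery E) m (bagSizes (left.reverse ++ x :: right) left.length vs
        (List.replicate (left.reverse ++ x :: right).length 1)) out
        (vs.length * (1 + 4 * Nat.clog 2 vs.length)) ∧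
      out.length = (left.reverse ++ x :: right).length ∧
      ∀ q v, q + 1 < (left.reverse ++ x :: right).length →
        (left.reverse ++ x :: right)[if q < left.length then q else q + 1]? = some v →
        (out.take (q + 1)).sum =
          if q < left.length then (below E S v).card else (rest E S v).card := by
  classical
  set path := left.reverse ++ x :: right with hpath
  have hpnd : path.Nodup := h.nodup hE
  have hlen : path.length ≤ vs.length :=
    (hpnd.subperm fun z hz => (hvs z).2 (h.mem hz)).length_le
  have hbag : ∀ k, ∃ b, k ∉ path → (∃ l r,
      Yields (pathQuery E) m (findBag (path.take (left.length + 1)).reverse k) l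
        (2 * Nat.clog 2 vs.length) ∧
      Yields (pathQuery E) m (findBag (path.drop left.length) k) r (2 * Nat.clog 2 vs.length) ∧
      (if l = 0 then left.length + r else left.length - l) = b) ∧ b < path.length ∧
      ∀ q v, path[if q < left.length then q else q + 1]? = some v →
        (b < q + 1 ↔ OnSide E left.length q v k) := by
    intro k
    by_cases hk : k ∈ path
    · exact ⟨0, fun h => absurd hk h⟩
    · obtain ⟨l, r, h1, h2, h3, h4⟩ := h.exists_bag (m := m) hE hk hlen
      exact ⟨_, fun _ => ⟨⟨l, r, h1, h2, rfl⟩, h3, h4⟩⟩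
  choose β hβ using hbag
  obtain ⟨out, h1, h2, h3⟩ := TreeQuery.exists_yields_bagSizes (E := E) (m := m) (path := path)
    (a := left.length) (β := β) vs (List.replicate path.length 1) (fun k _ hk => (hβ k hk).1)
    (fun k _ hk => by simpa using (hβ k hk).2.1)
  refine ⟨out, h1.mono (le_of_eq (by ring)), by simpa using h2, fun q v hq hv => ?_⟩
  have hside : (out.take (q + 1)).sum = (S.filter fun k => OnSide E left.length q v k).card := by
    have hcard : (S.filter fun k => OnSide E left.length q v k).card =
        (vs.filter fun k => decide (OnSide E left.length q v k)).length := by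
      rw [← List.toFinset_card_of_nodup (hnd.filter _)]
      congr 1
      ext z
      simp [hvs]
    have hpf : path.filter (fun k => decide (OnSide E left.length q v k)) = path.take (q + 1) := by
      conv_lhs => rw [← List.take_append_drop (q + 1) path]
      rw [List.filter_append, List.filter_eq_self.2, List.filter_eq_nil_iff.2, List.append_nil]
      · intro k hk
        obtain ⟨p, hp⟩ := List.mem_iff_getElem?.1 hk
        rw [List.getElem?_drop] at hp
        rw [decide_eq_true_eq, h.onSide_iff hE hv hp]
        omega
      · intro k hk
        obtain ⟨p, hp⟩ := List.mem_iff_getElem?.1 hk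
        have hpq : p < q + 1 := by
          have := (List.getElem?_eq_some_iff.1 hp).1
          rw [List.length_take] at this; omega
        rw [List.getElem?_take_of_lt hpq] at hp
        rw [decide_eq_true_eq, h.onSide_iff hE hv hp]
        exact hpq
    have hon : (vs.filter fun k => decide (k ∈ path ∧ OnSide E left.length q v k)).length =
        q + 1 := by
      have hperm : (vs.filter fun k => decide (k ∈ path ∧ OnSide E left.length q v k)).Perm
          (path.filter fun k => decide (OnSide E left.length q v k)) := by
        rw [List.perm_ext_iff_of_nodup (hnd.filter _) (hpnd.filter _)]
        intro k
        simp only [List.mem_filter, decide_eq_true_eq, hvs]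
        exact ⟨fun h' => h'.2, fun h' => ⟨h.mem h'.1, h'⟩⟩
      rw [hperm.length_eq, hpf, List.length_take]
      omega
    have hoff : (vs.filter fun k => decide (k ∉ path ∧ β k < q + 1)).length =
        (vs.filter fun k => decide (k ∉ path ∧ OnSide E left.length q v k)).length := by
      congr 1
      refine List.filter_congr fun k _ => ?_
      rw [decide_eq_decide]
      exact and_congr_right fun hk => (hβ k hk).2.2 q v hv
    rw [h3, hoff, hcard, List.take_replicate, List.sum_replicate, Nat.min_eq_left (by omega),
      smul_eq_mul, mul_one]
    have hsplit : ∀ l : List V,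
        (l.filter fun k => decide (OnSide E left.length q v k)).length =
        (l.filter fun k => decide (k ∈ path ∧ OnSide E left.length q v k)).length +
        (l.filter fun k => decide (k ∉ path ∧ OnSide E left.length q v k)).length := by
      intro l
      induction l with
      | nil => rfl
      | cons k l ih =>
        by_cases h1 : OnSide E left.length q v k <;> by_cases h2 : k ∈ path <;>
          simp [h1, h2] at ih ⊢ <;> omega
    rw [hsplit, hon]
  rw [hside]
  unfold OnSide
  split_ifs
  · rfl
  · rfl

end Bags

/-! ### One round of the search for an even separator -/

section Round

variable {V : Type} {E : Finset (V × V)} {m d : ℕ} {S : Finset V} {vs : List V}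

lemma even_condition_iff {n s : ℕ} (hd : 0 < d) :
    (⌊(n : ℚ) / d⌋ ≤ ((s : ℕ) : ℤ) ∧ ((s : ℕ) : ℤ) ≤ ⌈((d : ℚ) - 1) * n / d⌉) ↔
      n / d ≤ s ∧ s ≤ n - n / d := by
  have h1 : ⌊(n : ℚ) / d⌋ = ((n / d : ℕ) : ℤ) := by
    rw [Rat.floor_natCast_div_natCast]; simp
  have h2 : ⌈((d : ℚ) - 1) * n / d⌉ = (n : ℤ) - ((n / d : ℕ) : ℤ) := by
    have hdq : (d : ℚ) ≠ 0 := by exact_mod_cast hd.ne'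
    rw [show ((d : ℚ) - 1) * n / d = -((n : ℚ) / d) + ((n : ℤ) : ℚ) by push_cast; field_simp; ring,
      Int.ceil_add_intCast, Int.ceil_neg, h1]
    ring
  rw [h1, h2]
  have := Nat.div_le_self n d
  omega

lemma findSeparator_eq_some {n a r ls : ℕ} (hd : 0 < d) {path : List V} {sizes : List ℕ}
    {e : V × V} (h : findSeparator n d a r ls path sizes = some e) :
    ∃ q x y, path[q]? = some x ∧ path[q + 1]? = some y ∧
      e = (if r + q < a then (y, x) else (x, y)) ∧
      n / d ≤ ls + (sizes.take (q + 1)).sum ∧ ls + (sizes.take (q + 1)).sum ≤ n - n / d := by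
  induction path generalizing sizes r ls with
  | nil => simp [findSeparator] at h
  | cons x path ih =>
    match path, sizes with
    | [], _ => simp [findSeparator] at h
    | _ :: _, [] => simp [findSeparator] at h
    | y :: path, b :: sizes =>
      rw [findSeparator] at h
      split_ifs at h with hc hr
      · rw [even_condition_iff hd] at hc
        rw [Option.some_inj] at h
        exact ⟨0, x, y, rfl, rfl, by simp [hr, h], by simpa using hc.1, by simpa using hc.2⟩
      · rw [even_condition_iff hd] at hc
        rw [Option.some_inj] at h
        exact ⟨0, x, y, rfl, rfl, by simp [hr, h], by simpa using hc.1, by simpa using hc.2⟩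
      · obtain ⟨q, x', y', h1, h2, h3, h4, h5⟩ := ih h
        refine ⟨q + 1, x', y', h1, h2, ?_, ?_, ?_⟩
        · rw [h3, show r + (q + 1) = r + 1 + q by ring]
        · rw [List.take_succ_cons, List.sum_cons]; omega
        · rw [List.take_succ_cons, List.sum_cons]; omega

lemma findSeparator_eq_none {n a r ls : ℕ} (hd : 0 < d) {path : List V} {sizes : List ℕ}
    (hlen : sizes.length = path.length) (h : findSeparator n d a r ls path sizes = none) {q : ℕ}
    (hq : q + 1 < path.length) : ¬ (n / d ≤ ls + (sizes.take (q + 1)).sum ∧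
      ls + (sizes.take (q + 1)).sum ≤ n - n / d) := by
  induction path generalizing sizes r ls q with
  | nil => simp at hq
  | cons x path ih =>
    match path, sizes with
    | [], _ => simp at hq
    | _ :: _, [] => simp at hlen
    | y :: path, b :: sizes =>
      rw [findSeparator] at h
      split_ifs at h with hc
      rw [even_condition_iff hd] at hc
      cases q with
      | zero => simpa using hc
      | succ q =>
        have := ih (by simpa using hlen) h (q := q) (by simpa using hq)
        rw [List.take_succ_cons, List.sum_cons]
        rwa [← add_assoc]

/-- Consecutive vertices of a path are joined by an edge. -/
lemma IsBentPath.edge {i j x : V} {left right : List V} (hE : IsRootedTree E)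
    (hS : IsSubtree E S) (h : IsBentPath E S i j x left right) {q : ℕ} {u v : V}
    (hu : (left.reverse ++ x :: right)[q]? = some u)
    (hv : (left.reverse ++ x :: right)[q + 1]? = some v) :
    if q < left.length then (v, u) ∈ E else (u, v) ∈ E := by
  have key : ∀ (l : List V) (k : V), (x :: l).Pairwise (Before (pathQuery E)) →
      (∀ z, z ∈ l ↔ z ∈ S ∧ z ≠ x ∧ AncEq E x z ∧ AncEq E z k) → ∀ p u v,
      (x :: l)[p]? = some u → (x :: l)[p + 1]? = some v → (u, v) ∈ E := by
    intro l k hp hm p u v hu hv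
    have huv := hE.pathQuery_iff.1 (before_of_getElem? hp (Nat.lt_succ_self p) hu hv)
    have hvl : v ∈ l := mem_tail_of_getElem? (Nat.succ_pos p) hv
    have hv' := (hm v).1 hvl
    have hu' : u ∈ S ∧ AncEq E x u := by
      rcases List.mem_cons.1 (List.mem_of_getElem? hu) with rfl | hul
      · exact ⟨h.top_mem, AncEq.refl _⟩
      · exact ⟨((hm u).1 hul).1, ((hm u).1 hul).2.2.1⟩
    refine hE.edge_of_covers huv.1 huv.2 fun z huz hzv => ?_
    have hzS : z ∈ S := hS.convex hu'.1 hv'.1 huz hzv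
    have hzl : z ∈ x :: l := by
      by_cases hzx : z = x
      · exact hzx ▸ List.mem_cons_self
      · exact List.mem_cons_of_mem _
          ((hm z).2 ⟨hzS, hzx, hu'.2.trans huz, hzv.trans hv'.2.2.2⟩)
    obtain ⟨s, hs⟩ := List.mem_iff_getElem?.1 hzl
    rcases lt_trichotomy s p with hsp | rfl | hsp
    · have := (hE.pathQuery_iff.1 (before_of_getElem? hp hsp hs hu))
      exact Or.inl (hE.ancEq_antisymm this.1 huz)
    · rw [hs, Option.some_inj] at hu
      exact Or.inl hu
    · rcases (Nat.succ_le_of_lt hsp).eq_or_lt with rfl | hsp'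
      · rw [Nat.succ_eq_add_one, hv, Option.some_inj] at hs
        exact Or.inr hs.symm
      · have := (hE.pathQuery_iff.1 (before_of_getElem? hp hsp' hv hs))
        exact Or.inr (hE.ancEq_antisymm hzv this.1)
  by_cases hq : q < left.length
  · rw [if_pos hq]
    rw [getElem?_bentPath_left (by omega)] at hu hv
    exact key left i h.left_sorted h.mem_left (left.length - (q + 1)) v u hv
      (by rwa [show left.length - (q + 1) + 1 = left.length - q by omega])
  · rw [if_neg hq]
    rw [getElem?_bentPath_right (by omega)] at hu hv
    exact key right j h.right_sorted h.mem_right (q - left.length) u v hu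
      (by rwa [show q - left.length + 1 = q + 1 - left.length by omega])

/-- An even separator between the ends of the path is the lower end of an edge of the path. -/
lemma IsBentPath.exists_position {i j x : V} {left right : List V} (hE : IsRootedTree E)
    (h : IsBentPath E S i j x left right) {v : V} (hvS : v ∈ S)
    (hv : ¬ (AncEq E v i ↔ AncEq E v j)) :
    ∃ q, q + 1 < (left.reverse ++ x :: right).length ∧
      (left.reverse ++ x :: right)[if q < left.length then q else q + 1]? = some v := by
  by_cases hvi : AncEq E v i
  · have hvj : ¬ AncEq E v j := fun h' => hv (iff_of_true hvi h')
    have hxv : AncEq E x v := (hE.ancEq_total h.top_left hvi).resolve_right fun h' =>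
      hvj (h'.trans h.top_right)
    have hvl : v ∈ left.reverse := List.mem_reverse.2
      ((h.mem_left v).2 ⟨hvS, fun hvx => hvj (hvx ▸ h.top_right), hxv, hvi⟩)
    obtain ⟨q, hq⟩ := List.mem_iff_getElem?.1 hvl
    have hlt : q < left.length := by
      simpa using (List.getElem?_eq_some_iff.1 hq).1
    refine ⟨q, by simp; omega, ?_⟩
    rw [if_pos hlt, List.getElem?_append_left (by simpa using hlt)]
    exact hq
  · have hvj : AncEq E v j := by
      by_contra h'
      exact hv (iff_of_false hvi h')
    have hxv : AncEq E x v := (hE.ancEq_total h.top_right hvj).resolve_right fun h' =>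
      hvi (h'.trans h.top_left)
    have hvl : v ∈ right := (h.mem_right v).2 ⟨hvS, fun hvx => hvi (hvx ▸ h.top_left), hxv, hvj⟩
    obtain ⟨q, hq⟩ := List.mem_iff_getElem?.1 hvl
    have hlt : q < right.length := (List.getElem?_eq_some_iff.1 hq).1
    refine ⟨left.length + q, by simp; omega, ?_⟩
    rw [if_neg (by omega), getElem?_bentPath_right (by omega),
      show left.length + q + 1 - left.length = q + 1 by omega, List.getElem?_cons_succ]
    exact hq

/-- A round of the search, from the two vertices that have been drawn. -/
def roundFrom [DecidableEq V] (d : ℕ) (vs : List V) (i j : V) : Prog V (Option (V × V)) := do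
  let (path, a) ← multidirPath vs i j
  spend path.length
  let size ← bagSizes path a vs (List.replicate path.length 1)
  spend path.length
  pure (findSeparator vs.length d a 0 0 path size)

/-- What the scan of the edges finds, if the bag sizes add up to the sizes of the parts into which
the edges of the path divide the tree. -/
lemma IsBentPath.round_spec {i j x : V} {left right : List V} (hE : IsRootedTree E) (hd : 0 < d)
    (hS : IsSubtree E S) (h : IsBentPath E S i j x left right) {sizes : List ℕ}
    (hlen : sizes.length = (left.reverse ++ x :: right).length)
    (hsum : ∀ q v, q + 1 < (left.reverse ++ x :: right).length →
        (left.reverse ++ x :: right)[if q < left.length then q else q + 1]? = some v →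
        (sizes.take (q + 1)).sum =
          if q < left.length then (below E S v).card else (rest E S v).card) :
    (∀ e, findSeparator S.card d left.length 0 0 (left.reverse ++ x :: right) sizes = some e →
      e ∈ E ∧ e.1 ∈ S ∧ IsEven E d S e.2) ∧
    (findSeparator S.card d left.length 0 0 (left.reverse ++ x :: right) sizes = none →
      ∀ v, IsEven E d S v → (AncEq E v i ↔ AncEq E v j)) := by
  have hdiv := Nat.div_le_self S.card d
  constructor
  · intro e he
    obtain ⟨q, u, w, hu, hw, rfl, h1, h2⟩ := findSeparator_eq_some hd he
    have hedge := h.edge hE hS hu hw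
    have hq := (List.getElem?_eq_some_iff.1 hw).1
    have huS := h.mem (List.mem_of_getElem? hu)
    have hwS := h.mem (List.mem_of_getElem? hw)
    rw [zero_add] at h1 h2 ⊢
    have heven : ∀ p c, (p, c) ∈ E → p ∈ S → c ∈ S → S.card / d ≤ (below E S c).card →
        (below E S c).card ≤ S.card - S.card / d → IsEven E d S c := by
      intro p c hpc hp hc h3 h4
      refine ⟨hc, Finset.card_lt_card ⟨fun k hk => (mem_below.1 hk).1, fun hsub => ?_⟩, h3, h4⟩
      exact hE.edge_ne hpc (hE.ancEq_antisymm (AncEq.of_edge hpc) (mem_below.1 (hsub hp)).2)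
    by_cases hlt : q < left.length
    · rw [if_pos hlt] at hedge ⊢
      have := hsum q u hq (by rwa [if_pos hlt])
      rw [if_pos hlt] at this
      exact ⟨hedge, hwS, heven w u hedge hwS huS (by omega) (by omega)⟩
    · rw [if_neg hlt] at hedge ⊢
      have := hsum q w hq (by rwa [if_neg hlt])
      rw [if_neg hlt] at this
      have hcard := card_below_add_card_rest (E := E) S w
      exact ⟨hedge, huS, heven u w hedge huS hwS (by omega) (by omega)⟩
  · intro hnone v hv
    by_contra hsep
    obtain ⟨q, hq, hqv⟩ := h.exists_position hE hv.1 hsep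
    have h1 := hsum q v hq hqv
    refine findSeparator_eq_none hd hlen hnone hq ?_
    rw [zero_add, h1]
    have hcard := card_below_add_card_rest (E := E) S v
    have h2 := hv.2.2.1
    have h3 := hv.2.2.2
    split_ifs <;> omega

/-- With correct answers, a round finds only even separators, and it finds one if the pair that
has been drawn is good. -/
lemma IsRootedTree.exists_yields_roundFrom [DecidableEq V] (hE : IsRootedTree E) (hd : 0 < d)
    (hS : IsSubtree E S) (hnd : vs.Nodup) (hvs : ∀ z, z ∈ vs ↔ z ∈ S) {i j : V} (hi : i ∈ S)
    (hj : j ∈ S) :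
    ∃ sep, Yields (pathQuery E) m (roundFrom d vs i j) sep
        (19 * vs.length + 13 * (vs.length * Nat.clog 2 vs.length)) ∧
      (∀ e, sep = some e → e ∈ E ∧ e.1 ∈ S ∧ IsEven E d S e.2) ∧
      ((i, j) ∈ goodPairs E d S → sep ≠ none) := by
  obtain ⟨x, left, right, h1, h2⟩ := hE.exists_yields_multidirPath (m := m) hS hnd hvs hi hj
  have hcard : vs.length = S.card := by
    rw [← List.toFinset_card_of_nodup hnd]; congr 1; ext z; simp [hvs]
  have key : ∀ i' j', IsBentPath E S i' j' x left right →
      ((∀ v, IsEven E d S v → (AncEq E v i' ↔ AncEq E v j')) →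
        (∀ v, IsEven E d S v → (AncEq E v i ↔ AncEq E v j))) →
      ∃ sep, Yields (pathQuery E) m (roundFrom d vs i j) sep
        (19 * vs.length + 13 * (vs.length * Nat.clog 2 vs.length)) ∧
      (∀ e, sep = some e → e ∈ E ∧ e.1 ∈ S ∧ IsEven E d S e.2) ∧
      ((i, j) ∈ goodPairs E d S → sep ≠ none) := by
    intro i' j' h hgood
    obtain ⟨sizes, h3, h4, h5⟩ := h.exists_yields_bagSizes (m := m) hE hnd hvs
    obtain ⟨h6, h7⟩ := h.round_spec hE hd hS h4 h5
    rw [← hcard] at h6 h7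
    refine ⟨_, ?_, h6, fun hij hnone => ?_⟩
    · have hlen : (left.reverse ++ x :: right).length ≤ vs.length :=
        ((h.nodup hE).subperm fun z hz => (hvs z).2 (h.mem hz)).length_le
      have h9 : vs.length * (1 + 4 * Nat.clog 2 vs.length) =
          vs.length + 4 * (vs.length * Nat.clog 2 vs.length) := by ring
      rw [h9] at h3
      refine Yields.mono (c := 16 * vs.length + 9 * (vs.length * Nat.clog 2 vs.length) +
        (vs.length + ((vs.length + 4 * (vs.length * Nat.clog 2 vs.length)) + vs.length))) ?_
        (by omega)
      exact h1.bind (((yields_spend _).mono hlen).bind (h3.bind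
        (((yields_spend _).mono hlen).bind_pure rfl)))
    · obtain ⟨v, hv, hsep⟩ := (mem_goodPairs.1 hij).2
      exact hsep (hgood (h7 hnone) v hv)
  rcases h2 with h2 | h2
  · exact key i j h2 id
  · exact key j i h2 fun h v hv => (h v hv).symm

end Round

/-! ### Mean penalties of runs -/

section Means

variable {V α β : Type} {Q : V → V → Bool} {m : ℕ}

/-- The mean of a nonnegative function. -/
noncomputable def mean (ψ : α → ℝ≥0∞) (X : PMF α) : ℝ≥0∞ := ∑' a, X a * ψ a

lemma mean_pure (ψ : α → ℝ≥0∞) (a : α) : mean ψ (PMF.pure a) = ψ a := by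
  classical
  rw [mean, tsum_eq_single a]
  · simp
  · intro b hb; simp [hb]

lemma mean_bind (ψ : β → ℝ≥0∞) (X : PMF α) (g : α → PMF β) :
    mean ψ (X.bind g) = mean (fun a => mean ψ (g a)) X := by
  simp only [mean, PMF.bind_apply, ← ENNReal.tsum_mul_right, ← ENNReal.tsum_mul_left]
  rw [ENNReal.tsum_comm]
  simp only [mul_assoc]

lemma mean_map (ψ : β → ℝ≥0∞) (X : PMF α) (f : α → β) :
    mean ψ (X.map f) = mean (fun a => ψ (f a)) X := by
  rw [PMF.map, mean_bind]
  simp only [Function.comp, mean_pure]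

lemma mean_mono {ψ φ : α → ℝ≥0∞} (X : PMF α) (h : ∀ a, ψ a ≤ φ a) : mean ψ X ≤ mean φ X :=
  ENNReal.tsum_le_tsum fun a => mul_le_mul_right (h a) _

lemma mean_add (ψ φ : α → ℝ≥0∞) (X : PMF α) :
    mean (fun a => ψ a + φ a) X = mean ψ X + mean φ X := by
  simp only [mean, mul_add, ENNReal.tsum_add]

lemma mean_const (c : ℝ≥0∞) (X : PMF α) : mean (fun _ => c) X = c := by
  simp [mean, ENNReal.tsum_mul_right, X.tsum_coe]

lemma mean_ofMultiset [DecidableEq V] {vs : List V} (hnd : vs.Nodup) (h : (vs : Multiset V) ≠ 0)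
    (ψ : V → ℝ≥0∞) :
    mean ψ (PMF.ofMultiset (vs : Multiset V) h) =
      (vs.length : ℝ≥0∞)⁻¹ * ∑ v ∈ vs.toFinset, ψ v := by
  rw [mean, tsum_eq_sum (s := vs.toFinset), Finset.mul_sum]
  · refine Finset.sum_congr rfl fun v hv => ?_
    have hv' : v ∈ vs := List.mem_toFinset.1 hv
    have hc : ∀ inst : DecidableEq V, @Multiset.count V inst v (vs : Multiset V) = 1 := fun _ =>
      Multiset.count_eq_one_of_mem (Multiset.coe_nodup.2 hnd)
        (Multiset.mem_coe.2 hv')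
    rw [PMF.ofMultiset_apply, hc, Multiset.coe_card]
    simp
  · intro v hv
    rw [PMF.ofMultiset_apply_of_notMem _ (by simpa using hv), zero_mul]

/-- The penalty `w` for a run without output, and `κ` times the total cost for any other run. -/
noncomputable def penalty (w κ : ℕ) : Option (Outcome α) → ℝ≥0∞
  | none => w
  | some o => κ * (o.queries + o.time : ℕ)

lemma penalty_addCost_le (w κ q t : ℕ) (r : Option (Outcome α)) :
    penalty w κ (addCost q t r) ≤ (κ * (q + t) : ℕ) + penalty w κ r := by
  cases r with
  | none => simp [addCost, penalty]
  | some o =>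
    simp only [addCost, penalty, Option.map_some]
    norm_cast
    exact le_of_eq (by ring)

lemma mean_penalty_continueWith_le (w κ : ℕ) (g : α → PMF (Option (Outcome β))) {B : ℝ≥0∞}
    (hB : ∀ a, mean (penalty w κ) (g a) ≤ B) (r : Option (Outcome α)) :
    mean (penalty w κ) (continueWith g r) ≤ penalty w κ r + B := by
  cases r with
  | none => simp [continueWith, mean_pure, penalty]
  | some o =>
    rw [continueWith, mean_map]
    refine (mean_mono _ fun r => penalty_addCost_le w κ _ _ r).trans ?_
    rw [mean_add, mean_const]
    refine add_le_add (le_of_eq ?_) (hB _)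
    simp [penalty]

lemma mean_penalty_bind_le (w κ : ℕ) (p : Prog V α) (f : α → Prog V β) {B : ℝ≥0∞}
    (hB : ∀ a, mean (penalty w κ) ((f a).run Q m) ≤ B) :
    mean (penalty w κ) ((p >>= f).run Q m) ≤ mean (penalty w κ) (p.run Q m) + B := by
  rw [run_bind, mean_bind]
  refine (mean_mono _ fun r => mean_penalty_continueWith_le w κ _ hB r).trans ?_
  rw [mean_add, mean_const]

lemma Yields.mean_penalty_bind_le {p : Prog V α} {x : α} {c : ℕ} (h : Yields Q m p x c) (w κ : ℕ)
    (f : α → Prog V β) :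
    mean (penalty w κ) ((p >>= f).run Q m) ≤
      (κ * ((2 * m + 1) * c) : ℕ) + mean (penalty w κ) ((f x).run Q m) := by
  obtain ⟨q, t, h1, h2⟩ := h
  rw [run_bind, h1, PMF.pure_bind, continueWith, mean_map]
  refine (mean_mono _ fun r => penalty_addCost_le w κ _ _ r).trans ?_
  rw [mean_add, mean_const]
  gcongr

lemma Yields.mean_penalty_le {p : Prog V α} {x : α} {c : ℕ} (h : Yields Q m p x c) (w κ : ℕ) :
    mean (penalty w κ) (p.run Q m) ≤ (κ * ((2 * m + 1) * c) : ℕ) := by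
  obtain ⟨q, t, h1, h2⟩ := h
  rw [h1, mean_pure, penalty]
  norm_cast
  gcongr

lemma mean_penalty_pick_le [DecidableEq V] {vs : List V} (hnd : vs.Nodup) (hne : vs ≠ []) (w κ : ℕ)
    (p : V → Prog V α) :
    mean (penalty w κ) ((Prog.pick vs p).run Q m) ≤ (κ : ℕ) +
      (vs.length : ℝ≥0∞)⁻¹ * ∑ v ∈ vs.toFinset, mean (penalty w κ) ((p v).run Q m) := by
  have h : (vs : Multiset V) ≠ 0 := by simpa using hne
  rw [Prog.run, dif_pos h, mean_map]
  refine (mean_mono _ fun r => penalty_addCost_le w κ _ _ r).trans ?_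
  rw [mean_add, mean_const, mean_bind, mean_ofMultiset hnd]
  simp

/-- Every output of the program satisfies `P`. -/
def Sound (Q : V → V → Bool) (m : ℕ) (p : Prog V α) (P : α → Prop) : Prop :=
  ∀ o, some o ∈ (p.run Q m).support → P o.output

lemma Yields.sound {p : Prog V α} {x : α} {c : ℕ} (h : Yields Q m p x c) :
    Sound Q m p fun a => a = x := by
  obtain ⟨q, t, h1, -⟩ := h
  intro o ho
  rw [h1, PMF.support_pure, Set.mem_singleton_iff, Option.some_inj] at ho
  rw [ho]

lemma Sound.bind {p : Prog V α} {f : α → Prog V β} {P : α → Prop} {R : β → Prop}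
    (h : Sound Q m p P) (h' : ∀ a, P a → Sound Q m (f a) R) : Sound Q m (p >>= f) R := by
  intro o ho
  rw [run_bind, PMF.mem_support_bind_iff] at ho
  obtain ⟨r, hr, ho⟩ := ho
  cases r with
  | none => simp [continueWith] at ho
  | some o' =>
    rw [continueWith, PMF.mem_support_map_iff] at ho
    obtain ⟨r, hr', hro⟩ := ho
    cases r with
    | none => simp [addCost] at hro
    | some o'' =>
      have := h' _ (h o' hr) o'' hr'
      simp only [addCost, Option.map_some, Option.some_inj] at hro
      exact hro ▸ this

lemma Sound.pick {vs : List V} {p : V → Prog V α} {P : α → Prop}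
    (h : ∀ v ∈ vs, Sound Q m (p v) P) : Sound Q m (.pick vs p) P := by
  intro o ho
  rw [Prog.run] at ho
  split_ifs at ho with hne
  · rw [PMF.mem_support_map_iff] at ho
    obtain ⟨r, hr, hro⟩ := ho
    rw [PMF.mem_support_bind_iff] at hr
    obtain ⟨v, hv, hr⟩ := hr
    cases r with
    | none => simp [addCost] at hro
    | some o' =>
      have := h v (by simpa using hv) o' hr
      simp only [addCost, Option.map_some, Option.some_inj] at hro
      exact hro ▸ this
  · simp at ho

end Means

/-! ### The recursion -/

section Recursion

variable {V : Type} [DecidableEq V] {E : Finset (V × V)} {m d : ℕ}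

lemma mean_penalty_pick_le_ofReal {α : Type} {Q : V → V → Bool} {vs : List V} (hnd : vs.Nodup)
    (hne : vs ≠ []) (w κ : ℕ) (p : V → Prog V α) {x : V → ℝ}
    (hx0 : ∀ v ∈ vs, 0 ≤ x v)
    (hx : ∀ v ∈ vs, mean (penalty w κ) ((p v).run Q m) ≤ ENNReal.ofReal (x v)) :
    mean (penalty w κ) ((Prog.pick vs p).run Q m) ≤
      ENNReal.ofReal (κ + (∑ v ∈ vs.toFinset, x v) / vs.length) := by
  have hlen : (0 : ℝ) < vs.length := by exact_mod_cast List.length_pos_of_ne_nil hne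
  have hsum : 0 ≤ ∑ v ∈ vs.toFinset, x v :=
    Finset.sum_nonneg fun v hv => hx0 v (List.mem_toFinset.1 hv)
  refine (mean_penalty_pick_le hnd hne w κ p).trans ?_
  rw [ENNReal.ofReal_add (Nat.cast_nonneg _) (by positivity), ENNReal.ofReal_natCast,
    ENNReal.ofReal_div_of_pos hlen, ENNReal.ofReal_natCast, div_eq_mul_inv, mul_comm,
    ENNReal.ofReal_sum_of_nonneg fun v hv => hx0 v (List.mem_toFinset.1 hv)]
  gcongr with v hv
  exact hx v (List.mem_toFinset.1 hv)

lemma mem_filter_below {S : Finset V} {vs : List V} (hE : IsRootedTree E)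
    (hvs : ∀ z, z ∈ vs ↔ z ∈ S) (v z : V) :
    z ∈ vs.filter (fun k => decide (k = v ∨ pathQuery E v k = true)) ↔ z ∈ below E S v := by
  rw [List.mem_filter, decide_eq_true_eq, hvs, mem_below, hE.ancEq_iff, or_comm, eq_comm (a := z)]

lemma mem_filter_rest {S : Finset V} {vs : List V} (hE : IsRootedTree E)
    (hvs : ∀ z, z ∈ vs ↔ z ∈ S) (v z : V) :
    z ∈ vs.filter (fun k => decide (¬ (k = v ∨ pathQuery E v k = true))) ↔ z ∈ rest E S v := by
  rw [List.mem_filter, decide_eq_true_eq, hvs, mem_rest, hE.ancEq_iff, or_comm, eq_comm (a := z)]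

lemma length_eq_card {S : Finset V} {vs : List V} (hnd : vs.Nodup) (hvs : ∀ z, z ∈ vs ↔ z ∈ S) :
    vs.length = S.card := by
  rw [← List.toFinset_card_of_nodup hnd]
  congr 1
  ext z
  simp [hvs]

/-- What the algorithm does after a round. -/
def afterRound (d f : ℕ) (vs : List V) : Option (V × V) → Prog V (Finset (V × V))
  | none => reconstructTree d f vs
  | some e => do
    let (V₁, V₂) ← splitTree e.2 vs
    let E₁ ← reconstructTree d f V₁
    let E₂ ← reconstructTree d f V₂
    spend vs.length
    pure (E₁ ∪ E₂ ∪ {e})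

lemma reconstructTree_succ (d f : ℕ) {vs : List V} (h : vs.length ≠ 1) :
    reconstructTree d (f + 1) vs = spend 1 >>= fun _ =>
      Prog.pick vs fun i => Prog.pick vs fun j => roundFrom d vs i j >>= afterRound d f vs := by
  rw [reconstructTree]
  simp only [if_neg h]
  rfl

/-- With correct answers, every output of the algorithm is the set of edges of the subtree. -/
lemma IsRootedTree.sound_reconstructTree (hE : IsRootedTree E) (hd : 0 < d) (f : ℕ) {S : Finset V}
    {vs : List V} (hS : IsSubtree E S) (hnd : vs.Nodup) (hvs : ∀ z, z ∈ vs ↔ z ∈ S) :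
    Sound (pathQuery E) m (reconstructTree d f vs) fun F => F = inducedEdges E S := by
  induction f generalizing S vs with
  | zero =>
    intro o ho
    simp [reconstructTree, Prog.run] at ho
  | succ f ih =>
    have hcard := length_eq_card hnd hvs
    by_cases h1 : vs.length = 1
    · rw [reconstructTree]
      refine (yields_spend 1).sound.bind fun _ _ => ?_
      rw [if_pos h1]
      have hempty : inducedEdges E S = ∅ := by
        rw [Finset.eq_empty_iff_forall_notMem]
        rintro ⟨u, v⟩ huv
        rw [mem_inducedEdges] at huv
        rw [h1] at hcard
        exact hE.edge_ne huv.1 (Finset.card_le_one.1 hcard.ge u huv.2.1 v huv.2.2)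
      rw [hempty]
      exact (yields_pure _).sound
    · rw [reconstructTree_succ d f h1]
      refine (yields_spend 1).sound.bind fun _ _ => Sound.pick fun i hi => Sound.pick fun j hj => ?_
      obtain ⟨sep, h2, h3, -⟩ := hE.exists_yields_roundFrom (m := m) hd hS hnd hvs
        ((hvs i).1 hi) ((hvs j).1 hj)
      refine h2.sound.bind fun s hs => ?_
      subst hs
      cases s with
      | none => exact ih hS hnd hvs
      | some e =>
        obtain ⟨he, heS, hev⟩ := h3 e rfl
        refine (yields_splitTree e.2 vs).sound.bind fun s hs => ?_
        subst hs
        refine (ih (hev.isSubtree_rest hS) (hnd.filter _) (mem_filter_rest hE hvs e.2)).bind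
          fun E₁ hE₁ => ?_
        refine (ih (hev.isSubtree_below hS) (hnd.filter _) (mem_filter_below hE hvs e.2)).bind
          fun E₂ hE₂ => ?_
        refine (yields_spend _).sound.bind fun _ _ => ?_
        rw [hE₁, hE₂, ← hE.inducedEdges_split (u := e.1) (v := e.2) he heS hev.1]
        exact (yields_pure _).sound

/-- A recursive bound `B` on the mean penalty: `T` bounds the sum of the bounds for the two parts of
an even split, and a round leads to such a split if the pair that is drawn is good. -/
theorem IsRootedTree.mean_penalty_reconstructTree_le (hE : IsRootedTree E) (hd : 0 < d) (w κ : ℕ)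
    {B T : ℕ → Finset V → ℝ} (hB : ∀ f S, 0 ≤ B f S)
    (hT : ∀ f S, IsSubtree E S → 2 ≤ S.card → 0 ≤ T f S)
    (hzero : ∀ S, IsSubtree E S → w ≤ B 0 S)
    (hone : ∀ f S, IsSubtree E S → S.card = 1 → (κ : ℝ) * (2 * m + 1) ≤ B (f + 1) S)
    (hTB : ∀ f S, IsSubtree E S → 2 ≤ S.card → T f S ≤ B f S)
    (hsplit : ∀ f S v, IsSubtree E S → IsEven E d S v →
      B f (below E S v) + B f (rest E S v) ≤ T f S)
    (hstep : ∀ f S, IsSubtree E S → 2 ≤ S.card →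
      (κ : ℝ) * (2 * m + 1) * (25 * S.card + 13 * (S.card * Nat.clog 2 S.card)) +
        ((goodPairs E d S).card * T f S + ((S.card : ℝ) ^ 2 - (goodPairs E d S).card) * B f S) /
          (S.card : ℝ) ^ 2 ≤ B (f + 1) S)
    (f : ℕ) {S : Finset V} {vs : List V} (hS : IsSubtree E S) (hnd : vs.Nodup)
    (hvs : ∀ z, z ∈ vs ↔ z ∈ S) :
    mean (penalty w κ) ((reconstructTree d f vs).run (pathQuery E) m) ≤
      ENNReal.ofReal (B f S) := by
  induction f generalizing S vs with
  | zero =>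
    rw [reconstructTree, Prog.run, mean_pure, penalty, ← ENNReal.ofReal_natCast]
    exact ENNReal.ofReal_le_ofReal (hzero S hS)
  | succ f ih =>
    have hcard := length_eq_card hnd hvs
    have hpos := hS.card_pos
    by_cases h1 : vs.length = 1
    · have hy : Yields (pathQuery E) m (reconstructTree d (f + 1) vs) ∅ 1 := by
        rw [reconstructTree]
        refine ((yields_spend 1).bind (c' := 0) ?_)
        rw [if_pos h1]
        exact yields_pure _
      refine (hy.mean_penalty_le w κ).trans ?_
      rw [← ENNReal.ofReal_natCast]
      refine ENNReal.ofReal_le_ofReal (le_trans (le_of_eq ?_) (hone f S hS (hcard ▸ h1)))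
      push_cast; ring
    · have h2 : 2 ≤ S.card := by omega
      have hne : vs ≠ [] := fun h => by simp [h] at hcard; omega
      set c : ℝ := (κ : ℝ) * (2 * m + 1) with hc
      have hc0 : 0 ≤ c := by positivity
      have hκc : (κ : ℝ) ≤ c := by
        rw [hc]; exact le_mul_of_one_le_right (Nat.cast_nonneg _) (by
          have : (0 : ℝ) ≤ m := Nat.cast_nonneg _
          linarith)
      classical
      set t : V → V → ℝ := fun i j => if (i, j) ∈ goodPairs E d S then T f S else B f S with ht
      have ht0 : ∀ i j, 0 ≤ t i j := fun i j => by
        simp only [ht]; split_ifs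
        · exact hT f S hS h2
        · exact hB f S
      set D : ℕ := 22 * vs.length + 13 * (vs.length * Nat.clog 2 vs.length) with hD
      have hround : ∀ i ∈ vs, ∀ j ∈ vs, mean (penalty w κ)
          ((roundFrom d vs i j >>= afterRound d f vs).run (pathQuery E) m) ≤
          ENNReal.ofReal (c * D + t i j) := by
        intro i hi j hj
        obtain ⟨sep, h3, h4, h5⟩ := hE.exists_yields_roundFrom (m := m) hd hS hnd hvs
          ((hvs i).1 hi) ((hvs j).1 hj)
        refine (h3.mean_penalty_bind_le w κ _).trans ?_
        cases sep with
        | none =>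
          have hng : (i, j) ∉ goodPairs E d S := fun h => h5 h rfl
          refine (add_le_add_right (ih hS hnd hvs) _).trans ?_
          rw [← ENNReal.ofReal_natCast, ← ENNReal.ofReal_add (Nat.cast_nonneg _) (hB f S)]
          refine ENNReal.ofReal_le_ofReal ?_
          simp only [ht, if_neg hng, hD, hc]
          push_cast
          have : (0 : ℝ) ≤ κ * (2 * m + 1) * vs.length := by positivity
          nlinarith
        | some e =>
          obtain ⟨he, heS, hev⟩ := h4 e rfl
          have ih1 := ih (hev.isSubtree_rest hS) (hnd.filter _) (mem_filter_rest hE hvs e.2)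
          have ih2 := ih (hev.isSubtree_below hS) (hnd.filter _) (mem_filter_below hE hvs e.2)
          have hlast : ∀ E₁ E₂ : Finset (V × V), mean (penalty w κ)
              ((spend vs.length >>= fun _ => pure (E₁ ∪ E₂ ∪ {e}) :
                Prog V (Finset (V × V))).run (pathQuery E) m) ≤
              ((κ * ((2 * m + 1) * vs.length) : ℕ) : ℝ≥0∞) := fun E₁ E₂ =>
            Yields.mean_penalty_le ((yields_spend _).bind_pure rfl) w κ
          have hafter : mean (penalty w κ) ((afterRound d f vs (some e)).run (pathQuery E) m) ≤
              ((κ * ((2 * m + 1) * (2 * vs.length)) : ℕ) : ℝ≥0∞) +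
                (ENNReal.ofReal (B f (rest E S e.2)) + (ENNReal.ofReal (B f (below E S e.2)) +
                  ((κ * ((2 * m + 1) * vs.length) : ℕ) : ℝ≥0∞))) := by
            refine ((yields_splitTree e.2 vs).mean_penalty_bind_le w κ _).trans ?_
            refine add_le_add_right ((mean_penalty_bind_le w κ _ _ fun E₁ =>
              (mean_penalty_bind_le w κ _ _ fun E₂ => hlast E₁ E₂).trans
                (add_le_add_left ih2 _)).trans (add_le_add_left ih1 _)) _
          refine (add_le_add_right hafter _).trans ?_
          rw [← ENNReal.ofReal_natCast, ← ENNReal.ofReal_natCast, ← ENNReal.ofReal_natCast,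
            ← ENNReal.ofReal_add (hB _ _) (Nat.cast_nonneg _),
            ← ENNReal.ofReal_add (hB _ _) (add_nonneg (hB _ _) (Nat.cast_nonneg _)),
            ← ENNReal.ofReal_add (Nat.cast_nonneg _)
              (add_nonneg (hB _ _) (add_nonneg (hB _ _) (Nat.cast_nonneg _))),
            ← ENNReal.ofReal_add (Nat.cast_nonneg _) (add_nonneg (Nat.cast_nonneg _)
              (add_nonneg (hB _ _) (add_nonneg (hB _ _) (Nat.cast_nonneg _))))]
          refine ENNReal.ofReal_le_ofReal ?_
          have h6 : B f (below E S e.2) + B f (rest E S e.2) ≤ t i j := by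
            refine (hsplit f S e.2 hS hev).trans ?_
            simp only [ht]; split_ifs
            · exact le_rfl
            · exact hTB f S hS h2
          rw [hD, hc]
          push_cast
          nlinarith
      rw [reconstructTree_succ d f h1]
      refine ((yields_spend 1).mean_penalty_bind_le w κ _).trans ?_
      have hpick := mean_penalty_pick_le_ofReal (m := m) (Q := pathQuery E) hnd hne w κ
        (fun i => Prog.pick vs fun j => roundFrom d vs i j >>= afterRound d f vs)
        (x := fun i => κ + (∑ j ∈ vs.toFinset, (c * D + t i j)) / vs.length)
        (fun i _ => add_nonneg (Nat.cast_nonneg _) (div_nonneg (Finset.sum_nonneg fun j _ =>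
          add_nonneg (mul_nonneg hc0 (Nat.cast_nonneg _)) (ht0 i j)) (Nat.cast_nonneg _)))
        (fun i hi => mean_penalty_pick_le_ofReal hnd hne w κ _
          (fun j _ => add_nonneg (mul_nonneg hc0 (Nat.cast_nonneg _)) (ht0 i j))
          fun j hj => hround i hi j hj)
      refine (add_le_add_right hpick _).trans ?_
      rw [← ENNReal.ofReal_natCast, ← ENNReal.ofReal_add (Nat.cast_nonneg _)
        (add_nonneg (Nat.cast_nonneg _) (div_nonneg (Finset.sum_nonneg fun i _ =>
          add_nonneg (Nat.cast_nonneg _) (div_nonneg (Finset.sum_nonneg fun j _ =>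
          add_nonneg (mul_nonneg hc0 (Nat.cast_nonneg _)) (ht0 i j)) (Nat.cast_nonneg _)))
          (Nat.cast_nonneg _)))]
      refine ENNReal.ofReal_le_ofReal (le_trans ?_ (hstep f S hS h2))
      have hSvs : vs.toFinset = S := by ext z; simp [hvs]
      have hsumt : ∑ i ∈ S, ∑ j ∈ S, t i j = (goodPairs E d S).card * T f S +
          ((S.card : ℝ) ^ 2 - (goodPairs E d S).card) * B f S := by
        have hsub : goodPairs E d S ⊆ S ×ˢ S := fun p hp =>
          Finset.mem_product.2 (mem_goodPairs.1 hp).1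
        have hle := Finset.card_le_card hsub
        rw [Finset.card_product] at hle
        have h7 : ∑ p ∈ (S ×ˢ S) \ goodPairs E d S, t p.1 p.2 =
            ((S.card : ℝ) ^ 2 - (goodPairs E d S).card) * B f S := by
          rw [Finset.sum_congr rfl (g := fun _ => B f S) fun p hp =>
            if_neg (Finset.mem_sdiff.1 hp).2, Finset.sum_const, Finset.card_sdiff_of_subset hsub,
            Finset.card_product, nsmul_eq_mul, Nat.cast_sub hle]
          push_cast; ring
        have h8 : ∑ p ∈ goodPairs E d S, t p.1 p.2 = (goodPairs E d S).card * T f S := by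
          rw [Finset.sum_congr rfl (g := fun _ => T f S) fun p hp => if_pos hp, Finset.sum_const,
            nsmul_eq_mul]
        rw [← Finset.sum_product', ← Finset.sum_sdiff hsub, h7, h8, add_comm]
      have hNR : (2 : ℝ) ≤ S.card := by exact_mod_cast h2
      simp only [hSvs, hcard, Finset.sum_add_distrib, ← Finset.sum_div, Finset.sum_const,
        nsmul_eq_mul, hsumt]
      rw [hD, hcard]
      set X := (goodPairs E d S).card * T f S +
          ((S.card : ℝ) ^ 2 - (goodPairs E d S).card) * B f S with hX
      set N : ℝ := (S.card : ℝ) with hN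
      have hexp : (κ : ℝ) + (N * κ + (N * (N * (c * ((22 * S.card + 13 * (S.card *
          Nat.clog 2 S.card) : ℕ) : ℝ))) + X) / N) / N = 2 * κ + c * ((22 * S.card + 13 * (S.card *
          Nat.clog 2 S.card) : ℕ) : ℝ) + X / N ^ 2 := by
        field_simp
        ring
      push_cast at hexp ⊢
      rw [hexp, mul_one, ← hc]
      nlinarith

end Recursion

/-! ### The mean cost, and the probability of not halting -/

section Bounds

variable {V : Type} {E : Finset (V × V)} {m d : ℕ}

lemma IsRootedTree.card_goodPairs_pos [DecidableEq V] (hE : IsRootedTree E) (hd : 2 ≤ d)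
    (hdeg : ∀ v, degree E v ≤ d) {S : Finset V} (hS : IsSubtree E S) (h2 : 2 ≤ S.card) :
    0 < (goodPairs E d S).card := by
  obtain ⟨c, hc, hcent⟩ := hE.exists_centroid hS
  have hsize : treeSize (branchLabels E c) (fun x => (branch E c S x).card) = S.card :=
    hE.sum_card_branch hc
  have hhalf := div_le_half (N := S.card) hd
  have hpairs := hE.largeMass_mul_le_card_goodPairs (d := d) hS hc (B := S.card / 2)
    (fun x hx => by have := hcent x hx; omega) (by omega)
  refine lt_of_lt_of_le (Nat.mul_pos ?_ (by omega)) hpairs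
  have h1 := div_le_largeMass hd ((card_branchLabels_le c).trans (hdeg c))
    (fun x => (branch E c S x).card)
  rw [hsize] at h1
  rcases Nat.eq_zero_or_pos (S.card / d) with h0 | h0
  · have h3 := largeMass_add_small (d := d) (I := branchLabels E c)
      (fun x => (branch E c S x).card)
    rw [hsize, h0] at h3
    simp only [Nat.zero_le, not_true_eq_false, Finset.filter_false, Finset.sum_empty] at h3
    omega
  · omega

lemma card_goodPairs_le (S : Finset V) : (goodPairs E d S).card ≤ S.card * S.card := by
  rw [← Finset.card_product]
  exact Finset.card_le_card fun p hp => Finset.mem_product.2 (mem_goodPairs.1 hp).1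

open Classical in
/-- The lower ends of the even separators. -/
noncomputable def evenVertices (E : Finset (V × V)) (d : ℕ) (S : Finset V) : Finset V :=
  S.filter fun v => IsEven E d S v

lemma mem_evenVertices {S : Finset V} {v : V} : v ∈ evenVertices E d S ↔ IsEven E d S v := by
  simp only [evenVertices, Finset.mem_filter, and_iff_right_iff_imp]
  exact fun h => h.1

/-- The largest total weight of the rounds in a recursive decomposition by even separators. Which
separators the algorithm finds depends on its random draws; this is the worst case. -/
noncomputable def worstWeight (E : Finset (V × V)) (d : ℕ) (S : Finset V) : ℝ :=
  if h : (evenVertices E d S).Nonempty then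
    roundWeight E d S + (evenVertices E d S).attach.sup' h.attach fun v =>
      worstWeight E d (below E S v) + worstWeight E d (rest E S v)
  else 0
termination_by S.card
decreasing_by
  · exact (mem_evenVertices.1 v.2).2.1
  · exact (mem_evenVertices.1 v.2).rest_card_lt

lemma roundWeight_nonneg (S : Finset V) : 0 ≤ roundWeight E d S := by
  unfold roundWeight; positivity

lemma worstWeight_nonneg (S : Finset V) : 0 ≤ worstWeight E d S := by
  induction hn : S.card using Nat.strong_induction_on generalizing S with
  | _ n ih =>
    subst hn
    rw [worstWeight]
    split_ifs with h
    · obtain ⟨v, hv⟩ := h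
      have hv' := mem_evenVertices.1 hv
      refine add_nonneg (roundWeight_nonneg S) ?_
      refine le_trans (add_nonneg (ih _ hv'.2.1 _ rfl) (ih _ hv'.rest_card_lt _ rfl))
        (Finset.le_sup' (fun v : evenVertices E d S =>
          worstWeight E d (below E S v) + worstWeight E d (rest E S v))
          (Finset.mem_attach _ ⟨v, hv⟩))
    · exact le_rfl

lemma worstWeight_split {S : Finset V} {v : V} (hv : IsEven E d S v) :
    worstWeight E d (below E S v) + worstWeight E d (rest E S v) ≤
      worstWeight E d S - roundWeight E d S := by
  have hmem := mem_evenVertices.2 hv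
  rw [le_sub_iff_add_le', worstWeight.eq_def E d S, dif_pos ⟨v, hmem⟩]
  gcongr
  exact Finset.le_sup' (fun v : evenVertices E d S =>
    worstWeight E d (below E S v) + worstWeight E d (rest E S v)) (Finset.mem_attach _ ⟨v, hmem⟩)

lemma IsRootedTree.exists_isEven [DecidableEq V] (hE : IsRootedTree E) (hd : 2 ≤ d)
    (hdeg : ∀ v, degree E v ≤ d) {S : Finset V} (hS : IsSubtree E S) (h2 : 2 ≤ S.card) :
    ∃ v, IsEven E d S v := by
  obtain ⟨⟨i, j⟩, hp⟩ := Finset.card_pos.1 (hE.card_goodPairs_pos hd hdeg hS h2)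
  obtain ⟨v, hv, -⟩ := (mem_goodPairs.1 hp).2
  exact ⟨v, hv⟩

lemma IsRootedTree.isDecompositionWeight_worstWeight [DecidableEq V] (hE : IsRootedTree E)
    (hd : 2 ≤ d) (hdeg : ∀ v, degree E v ≤ d) :
    IsDecompositionWeight E d (worstWeight E d) := by
  constructor
  · intro S hS
    rw [worstWeight, dif_neg]
    rintro ⟨v, hv⟩
    have h1 := (mem_evenVertices.1 hv).below_card_pos
    have h2 := (mem_evenVertices.1 hv).2.1
    omega
  · intro S hS h2
    obtain ⟨v, hv⟩ := hE.exists_isEven hd hdeg hS h2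
    have hne : (evenVertices E d S).Nonempty := ⟨v, mem_evenVertices.2 hv⟩
    obtain ⟨w, -, hw⟩ := Finset.exists_mem_eq_sup' hne.attach
      (fun v : evenVertices E d S =>
        worstWeight E d (below E S v) + worstWeight E d (rest E S v))
    refine ⟨w, mem_evenVertices.1 w.2, ?_⟩
    conv_lhs => rw [worstWeight.eq_def]
    rw [dif_pos hne, hw]

/-- The mean cost of the algorithm, with correct answers: a round costs `O(|S| log |S|)`, and
the mean number of rounds is accounted for by the weight of the decomposition. -/
theorem IsRootedTree.mean_cost_le [Fintype V] [DecidableEq V] (hE : IsRootedTree E) (hd : 2 ≤ d)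
    (hdeg : ∀ v, degree E v ≤ d) (f : ℕ) {vs : List V} (hnd : vs.Nodup) (hvs : ∀ v, v ∈ vs) :
    mean (penalty 0 1) ((reconstructTree d f vs).run (pathQuery E) m) ≤
      ENNReal.ofReal ((2 * m + 1) * ((26 + 13 * Nat.clog 2 (Fintype.card V)) *
        (8192 * d * (Fintype.card V * Real.log (Fintype.card V))) + 1)) := by
  set k : ℝ := 26 + 13 * Nat.clog 2 (Fintype.card V) with hk
  have hk1 : 1 ≤ k := by
    have : (0 : ℝ) ≤ Nat.clog 2 (Fintype.card V) := Nat.cast_nonneg _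
    linarith
  have hm : (0 : ℝ) < 2 * m + 1 := by positivity
  have hw : ∀ S, IsSubtree E S → 2 ≤ S.card →
      (S.card : ℝ) ≤ roundWeight E d S ∧
      (goodPairs E d S).card / (S.card : ℝ) ^ 2 * roundWeight E d S = S.card ∧
      (goodPairs E d S).card / (S.card : ℝ) ^ 2 ≤ 1 := by
    intro S hS h2
    have hg : (0 : ℝ) < (goodPairs E d S).card := by
      exact_mod_cast hE.card_goodPairs_pos hd hdeg hS h2
    have hN : (0 : ℝ) < S.card := by exact_mod_cast hS.card_pos
    have hle : ((goodPairs E d S).card : ℝ) ≤ (S.card : ℝ) ^ 2 := by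
      rw [sq]; exact_mod_cast card_goodPairs_le S
    refine ⟨?_, ?_, ?_⟩
    · exact le_mul_of_one_le_right hN.le ((one_le_div hg).2 hle)
    · unfold roundWeight; field_simp
    · exact (div_le_one (by positivity)).2 hle
  have h := hE.mean_penalty_reconstructTree_le (m := m) (by omega : 0 < d) 0 1
    (B := fun _ S => (2 * m + 1) * (k * worstWeight E d S + 1))
    (T := fun _ S => (2 * m + 1) * (k * (worstWeight E d S - roundWeight E d S) + 2))
    (fun _ S => by have := worstWeight_nonneg (E := E) (d := d) S; positivity)
    (fun _ S hS h2 => by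
      obtain ⟨v, hv⟩ := hE.exists_isEven hd hdeg hS h2
      have h1 := worstWeight_split hv
      have h3 := worstWeight_nonneg (E := E) (d := d) (below E S v)
      have h4 := worstWeight_nonneg (E := E) (d := d) (rest E S v)
      have : 0 ≤ worstWeight E d S - roundWeight E d S := by linarith
      positivity)
    (fun S _ => by have := worstWeight_nonneg (E := E) (d := d) S; push_cast; positivity)
    (fun _ S _ _ => by
      have h1 : 0 ≤ k * worstWeight E d S :=
        mul_nonneg (by linarith) (worstWeight_nonneg (E := E) (d := d) S)
      push_cast
      nlinarith)
    (fun _ S hS h2 => by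
      have h3 := (hw S hS h2).1
      have h4 : (2 : ℝ) ≤ S.card := by exact_mod_cast h2
      refine mul_le_mul_of_nonneg_left ?_ hm.le
      nlinarith)
    (fun _ S v _ hv => by
      have h1 := worstWeight_split hv
      rw [← mul_add]
      refine mul_le_mul_of_nonneg_left ?_ hm.le
      nlinarith)
    (fun _ S hS h2 => by
      obtain ⟨h3, h4, h5⟩ := hw S hS h2
      have hN : (2 : ℝ) ≤ S.card := by exact_mod_cast h2
      have hclog : (Nat.clog 2 S.card : ℝ) ≤ Nat.clog 2 (Fintype.card V) := by
        exact_mod_cast Nat.clog_mono_right 2 (Finset.card_le_univ S)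
      set N : ℝ := (S.card : ℝ)
      set g : ℝ := ((goodPairs E d S).card : ℝ)
      set W := roundWeight E d S
      set F := worstWeight E d S
      have h6 : (g * ((2 * m + 1) * (k * (F - W) + 2)) +
          (N ^ 2 - g) * ((2 * m + 1) * (k * F + 1))) / N ^ 2 =
          (2 * m + 1) * (k * F + 1 + g / N ^ 2 - k * (g / N ^ 2 * W)) := by
        field_simp; ring
      rw [h6, h4]
      push_cast
      rw [one_mul, ← mul_add]
      refine mul_le_mul_of_nonneg_left ?_ hm.le
      have h7 : N * Nat.clog 2 S.card ≤ N * Nat.clog 2 (Fintype.card V) := by gcongr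
      have h8 : k * N = 26 * N + 13 * (N * Nat.clog 2 (Fintype.card V)) := by rw [hk]; ring
      linarith)
    f hE.isSubtree_univ hnd (fun z => by simp [hvs z])
  refine h.trans (ENNReal.ofReal_le_ofReal ?_)
  have h1 := hE.decompositionWeight_le hd hdeg (hE.isDecompositionWeight_worstWeight hd hdeg)
    hE.isSubtree_univ
  rw [Finset.card_univ] at h1
  gcongr

/-- With correct answers, the probability that the nested iterations exceed the given number tends
to `0` geometrically. -/
theorem IsRootedTree.abort_le [Fintype V] [DecidableEq V] (hE : IsRootedTree E) (hd : 2 ≤ d)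
    (hdeg : ∀ v, degree E v ≤ d) (f : ℕ) {vs : List V} (hnd : vs.Nodup) (hvs : ∀ v, v ∈ vs) :
    mean (penalty 1 0) ((reconstructTree d f vs).run (pathQuery E) m) ≤
      ENNReal.ofReal ((4 * (Fintype.card V : ℝ) ^ 2) ^ Fintype.card V *
        (1 - 1 / (2 * (Fintype.card V : ℝ) ^ 2)) ^ f) := by
  -- In the bound `(4 n²) ^ |S| * ρ ^ f`, a factor `4 n²` pays for the two parts after a split, and
  -- `ρ = 1 - 1 / (2 n²)` leaves room for the success probability of a round, at least `1 / n²`.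
  set n : ℝ := (Fintype.card V : ℝ) with hn
  have hn1 : 1 ≤ n := by
    have : 0 < Fintype.card V := by
      rw [← Finset.card_univ]; exact hE.isSubtree_univ.card_pos
    exact Nat.one_le_cast.2 this
  have hρ0 : (1 : ℝ) / 2 ≤ 1 - 1 / (2 * n ^ 2) := by
    have : 1 / (2 * n ^ 2) ≤ 1 / 2 := by
      apply one_div_le_one_div_of_le <;> nlinarith
    linarith
  set ρ : ℝ := 1 - 1 / (2 * n ^ 2) with hρ
  have hA : 1 ≤ 4 * n ^ 2 := by nlinarith
  have hB : ∀ (f : ℕ) (S : Finset V), 0 ≤ (4 * n ^ 2) ^ S.card * ρ ^ f := fun f S => by positivity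
  have hq : 1 / (2 * n ^ 2) = 1 - ρ := by rw [hρ]; ring
  have h := hE.mean_penalty_reconstructTree_le (m := m) (by omega : 0 < d) 1 0
    (B := fun f S => (4 * n ^ 2) ^ S.card * ρ ^ f)
    (T := fun f S => (4 * n ^ 2) ^ S.card * ρ ^ f * (1 / (2 * n ^ 2)))
    hB (fun f S _ _ => mul_nonneg (hB f S) (by positivity))
    (fun S _ => by simpa using one_le_pow₀ hA) (fun f S _ _ => by simpa using hB (f + 1) S)
    (fun f S _ _ => mul_le_of_le_one_right (hB f S) (by rw [hq]; linarith))
    (fun f S v _ hv => by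
      have h1 : (4 * n ^ 2) ^ (below E S v).card ≤ (4 * n ^ 2) ^ (S.card - 1) :=
        pow_le_pow_right₀ hA (by have := hv.2.1; omega)
      have h2 : (4 * n ^ 2) ^ (rest E S v).card ≤ (4 * n ^ 2) ^ (S.card - 1) :=
        pow_le_pow_right₀ hA (by have := hv.rest_card_lt; omega)
      have h3 : (4 * n ^ 2) ^ S.card = (4 * n ^ 2) ^ (S.card - 1) * (4 * n ^ 2) := by
        rw [← pow_succ]; congr 1; have := hv.2.1; omega
      have h4 : (4 * n ^ 2) ^ S.card * ρ ^ f * (1 / (2 * n ^ 2)) =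
          (4 * n ^ 2) ^ (S.card - 1) * ρ ^ f + (4 * n ^ 2) ^ (S.card - 1) * ρ ^ f := by
        rw [h3]; field_simp; ring
      rw [h4]
      gcongr)
    (fun f S hS h2 => by
      have hg : (1 : ℝ) ≤ (goodPairs E d S).card := by
        exact_mod_cast hE.card_goodPairs_pos hd hdeg hS h2
      have hN : (0 : ℝ) < S.card := by exact_mod_cast hS.card_pos
      have hNn : (S.card : ℝ) ≤ n := Nat.cast_le.2 (Finset.card_le_univ S)
      have hp : 1 / n ^ 2 ≤ (goodPairs E d S).card / (S.card : ℝ) ^ 2 :=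
        div_le_div₀ (by linarith) hg (pow_pos hN 2) (pow_le_pow_left₀ hN.le hNn 2)
      rw [hq]
      have hB0 := hB f S
      set b := (4 * n ^ 2) ^ S.card * ρ ^ f with hb
      set g : ℝ := ((goodPairs E d S).card : ℝ)
      set N : ℝ := (S.card : ℝ)
      have h6 : (g * (b * (1 - ρ)) + (N ^ 2 - g) * b) / N ^ 2 = b * (1 - g / N ^ 2 * ρ) := by
        field_simp; ring
      rw [h6, show (4 * n ^ 2) ^ S.card * ρ ^ (f + 1) = b * ρ by rw [hb, pow_succ]; ring]
      push_cast
      rw [zero_mul, zero_mul, zero_add]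
      refine mul_le_mul_of_nonneg_left ?_ hB0
      have h7 : 1 / n ^ 2 * (1 / 2) ≤ g / N ^ 2 * ρ :=
        mul_le_mul hp hρ0 (by norm_num) (div_nonneg (by linarith) (sq_nonneg N))
      have h8 : 1 / n ^ 2 * (1 / 2) = 1 - ρ := by rw [← hq]; field_simp
      linarith)
    f hE.isSubtree_univ hnd (fun z => by simp [hvs z])
  rw [Finset.card_univ] at h
  exact h

end Bounds

/-! ### Majority votes -/

section Noise

lemma mean_noiseLaw_prod (ε : unitInterval) {ι : Type} [Fintype ι] [DecidableEq ι]
    (g : ι → Bool → ℝ≥0∞) :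
    mean (fun η => ∏ x, g x (η x)) (noiseLaw ε ι) =
      ∏ x, (ENNReal.ofReal ε * g x true + ENNReal.ofReal (1 - ε) * g x false) := by
  have h := Finset.prod_univ_sum (fun _ : ι => (Finset.univ : Finset Bool))
    (fun (x : ι) (b : Bool) =>
      (if b then ENNReal.ofReal (ε : ℝ) else ENNReal.ofReal (1 - (ε : ℝ))) * g x b)
  rw [Fintype.piFinset_univ] at h
  rw [mean, tsum_fintype]
  simp only [noiseLaw, PMF.ofFintype_apply, ← Finset.prod_mul_distrib]
  rw [← h]
  simp

variable {V : Type} {E : Finset (V × V)} {m : ℕ}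

/-- A wrong vote requires that at least half of the answers are flipped. -/
lemma le_two_mul_flips {η : Fin m × V × V → Bool} {i j : V}
    (h : majority (noisyPathQuery E η) i j ≠ pathQuery E i j) :
    m ≤ 2 * (Finset.univ.filter fun k => η (k, i, j) = true).card := by
  have hc := Finset.card_filter_add_card_filter_not (s := (Finset.univ : Finset (Fin m)))
    (fun k => η (k, i, j) = true)
  rw [Finset.card_univ, Fintype.card_fin] at hc
  unfold majority noisyPathQuery at h
  rcases hb : pathQuery E i j with _ | _
  · simp only [hb, Bool.false_xor, ne_eq, Bool.not_eq_false, decide_eq_true_eq] at h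
    have : (m : ℚ) < ((2 * (Finset.univ.filter fun k => η (k, i, j) = true).card : ℕ) : ℚ) := by
      push_cast; linarith
    exact_mod_cast this.le
  · simp only [hb, Bool.true_xor, ne_eq, Bool.not_eq_true, decide_eq_false_iff_not, not_lt,
      Bool.not_eq_true'] at h
    simp only [Bool.not_eq_true] at hc
    have : ((2 * (Finset.univ.filter fun k => η (k, i, j) = false).card : ℕ) : ℚ) ≤ m := by
      push_cast; linarith
    have : 2 * (Finset.univ.filter fun k => η (k, i, j) = false).card ≤ m := by exact_mod_cast this
    omega

open Classical in
/-- Chernoff's bound for the vote on one pair of vertices, by the moment `x ^ (flips - nonflips)`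
with `x = 1 + 2 γ`, where `γ = 1 / 2 - ε`. -/
lemma mean_wrong_vote_le [Fintype V] [DecidableEq V] (ε : unitInterval) (hε : (ε : ℝ) < 1 / 2)
    (i j : V) :
    mean (fun η => if majority (noisyPathQuery E η) i j ≠ pathQuery E i j then 1 else 0)
        (noiseLaw ε (Fin m × V × V)) ≤
      ENNReal.ofReal (Real.exp (-(2 * (1 / 2 - (ε : ℝ)) ^ 2 * m))) := by
  have hε0 : (0 : ℝ) ≤ ε := ε.2.1
  have hε1 : (ε : ℝ) ≤ 1 := ε.2.2
  set γ : ℝ := 1 / 2 - ε with hγ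
  -- With this `x`, one answer contributes the factor `ε x + (1 - ε) / x = 1 - 2 γ²`.
  set x : ℝ := 1 + 2 * γ with hx
  have hx1 : 1 ≤ x := by rw [hx]; linarith
  have hx0 : 0 < x := by linarith
  set g : Fin m × V × V → Bool → ℝ≥0∞ := fun p b =>
    if p.2 = (i, j) then (if b then ENNReal.ofReal x else ENNReal.ofReal x⁻¹) else 1 with hg
  have hpair : ∀ h : Fin m × V × V → ℝ≥0∞, (∀ p, p.2 ≠ (i, j) → h p = 1) →
      ∏ p, h p = ∏ k, h (k, i, j) := by
    intro h h1
    rw [Fintype.prod_prod_type]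
    refine Finset.prod_congr rfl fun k _ => ?_
    exact Finset.prod_eq_single (i, j) (fun q _ hq => h1 (k, q) hq)
      (fun hq => absurd (Finset.mem_univ _) hq)
  have h1 : ∀ η : Fin m × V × V → Bool,
      (if majority (noisyPathQuery E η) i j ≠ pathQuery E i j then (1 : ℝ≥0∞) else 0) ≤
        ∏ p, g p (η p) := by
    intro η
    split_ifs with h
    · rw [hpair _ fun p hp => by rw [hg]; simp only [if_neg hp]]
      simp only [hg, if_true]
      rw [Finset.prod_ite, Finset.prod_const, Finset.prod_const, ← ENNReal.ofReal_pow hx0.le,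
        ← ENNReal.ofReal_pow (by positivity), ← ENNReal.ofReal_mul (by positivity)]
      rw [ENNReal.one_le_ofReal, inv_pow]
      have h2 := le_two_mul_flips h
      have hc := Finset.card_filter_add_card_filter_not (s := (Finset.univ : Finset (Fin m)))
        (fun k => η (k, i, j) = true)
      rw [Finset.card_univ, Fintype.card_fin] at hc
      rw [← div_eq_mul_inv, one_le_div (by positivity)]
      exact pow_le_pow_right₀ hx1 (by omega)
    · exact zero_le
  refine (mean_mono _ h1).trans ?_
  rw [mean_noiseLaw_prod, hpair _ fun p hp => by
    rw [hg]; simp only [if_neg hp, mul_one]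
    rw [← ENNReal.ofReal_add hε0 (by linarith)]; simp]
  simp only [hg, if_true, Bool.false_eq_true, if_false]
  rw [Finset.prod_const, Finset.card_univ, Fintype.card_fin, ← ENNReal.ofReal_mul hε0,
    ← ENNReal.ofReal_mul (by linarith), ← ENNReal.ofReal_add (by positivity)
      (mul_nonneg (by linarith) (by positivity))]
  have h2 : (ε : ℝ) * x + (1 - ε) * x⁻¹ = 1 - 2 * γ ^ 2 := by
    have h3 : (ε : ℝ) = 1 / 2 - γ := by rw [hγ]; ring
    rw [h3, hx]
    have : 1 + 2 * γ ≠ 0 := by rw [← hx]; exact hx0.ne'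
    field_simp
    ring
  have h4 : 0 ≤ 1 - 2 * γ ^ 2 := by
    rw [← h2]
    exact add_nonneg (by positivity) (mul_nonneg (by linarith) (by positivity))
  rw [h2, ← ENNReal.ofReal_pow h4]
  refine ENNReal.ofReal_le_ofReal ?_
  calc (1 - 2 * γ ^ 2) ^ m ≤ Real.exp (-(2 * γ ^ 2)) ^ m := by
        gcongr
        have := Real.add_one_le_exp (-(2 * γ ^ 2))
        linarith
    _ = _ := by rw [← Real.exp_nat_mul]; congr 1; ring

open Classical in
/-- The probability that some vote is wrong. -/
lemma mean_wrong_votes_le [Fintype V] [DecidableEq V] (ε : unitInterval) (hε : (ε : ℝ) < 1 / 2) :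
    mean (fun η => if majority (noisyPathQuery E η) = pathQuery E then 0 else 1)
        (noiseLaw ε (Fin m × V × V)) ≤
      ENNReal.ofReal ((Fintype.card V : ℝ) ^ 2 *
        Real.exp (-(2 * (1 / 2 - (ε : ℝ)) ^ 2 * m))) := by
  have h1 : ∀ η : Fin m × V × V → Bool,
      (if majority (noisyPathQuery E η) = pathQuery E then (0 : ℝ≥0∞) else 1) ≤
        ∑ p : V × V, if majority (noisyPathQuery E η) p.1 p.2 ≠ pathQuery E p.1 p.2
          then 1 else 0 := by
    intro η
    split_ifs with h
    · exact zero_le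
    · obtain ⟨i, hi⟩ := Function.ne_iff.1 h
      obtain ⟨j, hj⟩ := Function.ne_iff.1 hi
      refine le_trans (by simp [hj]) (Finset.single_le_sum (fun _ _ => zero_le)
        (Finset.mem_univ (i, j)))
  refine (mean_mono _ h1).trans ?_
  have h2 : mean (fun η => ∑ p : V × V,
        if majority (noisyPathQuery E η) p.1 p.2 ≠ pathQuery E p.1 p.2 then (1 : ℝ≥0∞) else 0)
      (noiseLaw ε (Fin m × V × V)) =
      ∑ p : V × V, mean (fun η =>
        if majority (noisyPathQuery E η) p.1 p.2 ≠ pathQuery E p.1 p.2 then (1 : ℝ≥0∞) else 0)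
      (noiseLaw ε (Fin m × V × V)) := by
    simp only [mean, Finset.mul_sum, tsum_fintype]
    exact Finset.sum_comm
  rw [h2]
  refine (Finset.sum_le_sum fun p _ => mean_wrong_vote_le ε hε p.1 p.2).trans ?_
  rw [Finset.sum_const, Finset.card_univ, Fintype.card_prod, nsmul_eq_mul,
    ENNReal.ofReal_mul (by positivity), ENNReal.ofReal_pow (by positivity), ENNReal.ofReal_natCast]
  push_cast
  rw [← sq]

end Noise

/-! ### Success probability -/

section Success

/-- The probability of an event is the mean of its indicator function. -/
lemma toOuterMeasure_eq_mean {α : Type} (X : PMF α) (S : Set α) :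
    X.toOuterMeasure S = mean (S.indicator fun _ => 1) X := by
  classical
  rw [PMF.toOuterMeasure_apply, mean]
  refine tsum_congr fun a => ?_
  by_cases h : a ∈ S <;> simp [h]

/-- A run with correct answers that outputs anything outputs the edge set, so it is only bad if it
outputs nothing or if it is too expensive; the latter is bounded by Markov's inequality. -/
lemma IsRootedTree.one_le_run_add {V : Type} [Fintype V] [DecidableEq V] {E : Finset (V × V)}
    (hE : IsRootedTree E) {d : ℕ} (hd : 0 < d) (m f : ℕ) {vs : List V} (hnd : vs.Nodup)
    (hvs : ∀ v, v ∈ vs) {B : ℝ} (hB : 0 < B) :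
    1 ≤ ((reconstructTree d f vs).run (pathQuery E) m).toOuterMeasure
        (some '' {o | o.output = E ∧ (o.queries : ℝ) ≤ B ∧ (o.time : ℝ) ≤ B}) +
      mean (penalty 1 0) ((reconstructTree d f vs).run (pathQuery E) m) +
      (ENNReal.ofReal B)⁻¹ *
        mean (penalty 0 1) ((reconstructTree d f vs).run (pathQuery E) m) := by
  classical
  have hB0 : ENNReal.ofReal B ≠ 0 := (ENNReal.ofReal_pos.2 hB).ne'
  have hsound := hE.sound_reconstructTree (m := m) hd f hE.isSubtree_univ hnd
    (fun z => by simp [hvs z])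
  have huniv : inducedEdges E Finset.univ = E := by ext ⟨u, v⟩; simp [mem_inducedEdges]
  set X := (reconstructTree d f vs).run (pathQuery E) m
  set A : Set (Option (Outcome (Finset (V × V)))) :=
    some '' {o | o.output = E ∧ (o.queries : ℝ) ≤ B ∧ (o.time : ℝ) ≤ B}
  have hpoint : ∀ r ∈ X.support, 1 ≤ A.indicator (fun _ => 1) r + penalty 1 0 r +
      (ENNReal.ofReal B)⁻¹ * penalty 0 1 r := by
    intro r hr
    cases r with
    | none =>
      rw [show penalty 1 0 (none : Option (Outcome (Finset (V × V)))) = 1 by simp [penalty]]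
      exact le_add_right le_add_self
    | some o =>
      by_cases hcost : ((o.queries + o.time : ℕ) : ℝ) ≤ B
      · have hA : some o ∈ A := by
          push_cast at hcost
          have h1 : (0 : ℝ) ≤ o.queries := Nat.cast_nonneg _
          have h2 : (0 : ℝ) ≤ o.time := Nat.cast_nonneg _
          exact ⟨o, ⟨(hsound o hr).trans huniv, by linarith, by linarith⟩, rfl⟩
        rw [Set.indicator_of_mem hA]
        exact le_add_right le_self_add
      · refine le_add_left ?_
        rw [← ENNReal.inv_mul_cancel hB0 ENNReal.ofReal_ne_top]
        gcongr
        rw [penalty, Nat.cast_one, one_mul, ← ENNReal.ofReal_natCast]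
        exact ENNReal.ofReal_le_ofReal (not_le.1 hcost).le
  have hmul : mean (fun r => (ENNReal.ofReal B)⁻¹ * penalty 0 1 r) X =
      (ENNReal.ofReal B)⁻¹ * mean (penalty 0 1) X := by
    simp only [mean, ← ENNReal.tsum_mul_left]
    exact tsum_congr fun a => by ring
  rw [toOuterMeasure_eq_mean, ← hmul, ← mean_add, ← mean_add]
  refine le_trans (mean_const 1 X).symm.le (ENNReal.tsum_le_tsum fun r => ?_)
  by_cases hr : r ∈ X.support
  · gcongr
    exact hpoint r hr
  · rw [X.apply_eq_zero_iff r |>.2 hr]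
    simp

lemma log_two_le_log {n : ℕ} (hn : 2 ≤ n) : (0.69 : ℝ) ≤ Real.log n := by
  have h := Real.log_le_log (by norm_num) (show (2 : ℝ) ≤ n by exact_mod_cast hn)
  have := Real.log_two_gt_d9
  linarith

lemma clog_le_log {n : ℕ} (hn : 2 ≤ n) : (Nat.clog 2 n : ℝ) ≤ 3 * Real.log n := by
  have h1 : 2 ^ (Nat.clog 2 n - 1) < n := Nat.pow_pred_clog_lt_self (by norm_num) hn
  have h2 : ((Nat.clog 2 n - 1 : ℕ) : ℝ) * Real.log 2 ≤ Real.log n := by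
    rw [← Real.log_pow]
    exact Real.log_le_log (by positivity) (by exact_mod_cast h1.le)
  have h3 : (Nat.clog 2 n : ℝ) ≤ ((Nat.clog 2 n - 1 : ℕ) : ℝ) + 1 := by
    norm_cast; omega
  have h4 := log_two_le_log hn
  have h5 := Real.log_two_gt_d9
  have h6 : (0 : ℝ) ≤ ((Nat.clog 2 n - 1 : ℕ) : ℝ) := Nat.cast_nonneg _
  nlinarith

/-- The bound on the mean cost, simplified. -/
lemma cost_bound_le {n d m : ℕ} (hn : 2 ≤ n) (hd : 2 ≤ d) (hm : 1 ≤ m) :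
    (2 * m + 1 : ℝ) * ((26 + 13 * Nat.clog 2 n) * (8192 * d * (n * Real.log n)) + 1) ≤
      2000000 * (m * (d * n * Real.log n ^ 2)) := by
  have h1 := log_two_le_log hn
  have h2 := clog_le_log hn
  have hn' : (2 : ℝ) ≤ n := by exact_mod_cast hn
  have hd' : (2 : ℝ) ≤ d := by exact_mod_cast hd
  have hm' : (1 : ℝ) ≤ m := by exact_mod_cast hm
  set l := Real.log n
  have h3 : 26 + 13 * (Nat.clog 2 n : ℝ) ≤ 80 * l := by linarith
  have h4 : (4 : ℝ) ≤ d * n := by nlinarith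
  have h5 : 1 ≤ d * n * l ^ 2 := by nlinarith
  have h6 : (26 + 13 * (Nat.clog 2 n : ℝ)) * (8192 * d * (n * l)) ≤
      80 * l * (8192 * d * (n * l)) := by gcongr
  have h7 : (26 + 13 * (Nat.clog 2 n : ℝ)) * (8192 * d * (n * l)) + 1 ≤
      655361 * (d * n * l ^ 2) := by
    calc _ ≤ 80 * l * (8192 * d * (n * l)) + d * n * l ^ 2 := add_le_add h6 h5
      _ = _ := by ring
  calc (2 * m + 1 : ℝ) * ((26 + 13 * Nat.clog 2 n) * (8192 * d * (n * l)) + 1)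
      ≤ 3 * m * (655361 * (d * n * l ^ 2)) := by gcongr; linarith
    _ ≤ 2000000 * (m * (d * n * l ^ 2)) := by
      have : 0 ≤ (m : ℝ) * (d * n * l ^ 2) := by positivity
      linarith

/-- The number of repetitions makes the union bound over all pairs work. -/
lemma wrong_votes_bound_le {n d m : ℕ} {ε δ : ℝ} (hn : 2 ≤ n) (hd : 2 ≤ d) (hε : ε < 1 / 2)
    (hδ : 0 < δ) (hδ1 : δ < 1) (hm : voteScale n d ε δ ≤ m) :
    (n : ℝ) ^ 2 * Real.exp (-(2 * (1 / 2 - ε) ^ 2 * m)) ≤ δ / 4 := by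
  have hn' : (0 : ℝ) < n := by exact_mod_cast (by omega : 0 < n)
  have hd' : (2 : ℝ) ≤ d := by exact_mod_cast hd
  have hγ : 0 < (1 / 2 - ε) ^ 2 := pow_pos (by linarith) 2
  have h1 : Real.log d + Real.log n + Real.log (1 / δ) ≤ (1 / 2 - ε) ^ 2 * m := by
    have := mul_le_mul_of_nonneg_left hm hγ.le
    rwa [voteScale, ← mul_assoc, mul_one_div_cancel hγ.ne', one_mul] at this
  have h2 : Real.exp (-(2 * (1 / 2 - ε) ^ 2 * m)) ≤ (δ / (d * n)) ^ 2 := by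
    rw [← Real.exp_log (show 0 < (δ / (d * n)) ^ 2 by positivity), Real.exp_le_exp, Real.log_pow,
      Real.log_div hδ.ne' (by positivity), Real.log_mul (by positivity) hn'.ne']
    rw [one_div, Real.log_inv] at h1
    push_cast
    linarith
  calc (n : ℝ) ^ 2 * Real.exp (-(2 * (1 / 2 - ε) ^ 2 * m)) ≤ n ^ 2 * (δ / (d * n)) ^ 2 := by gcongr
    _ = δ * δ / (d * d) := by field_simp
    _ ≤ δ * 1 / (2 * 2) := by gcongr
    _ = δ / 4 := by ring

lemma voteScale_pos {n d : ℕ} {ε δ : ℝ} (hn : 2 ≤ n) (hd : 2 ≤ d) (hε : ε < 1 / 2)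
    (hδ : 0 < δ) (hδ1 : δ < 1) : 0 < voteScale n d ε δ := by
  have h1 := log_two_le_log hn
  have h2 := log_two_le_log hd
  have h3 : 0 < Real.log (1 / δ) := Real.log_pos ((one_lt_div hδ).2 hδ1)
  have h4 : 0 < 1 / 2 - ε := by linarith
  unfold voteScale
  positivity

/-- With correct answers, and enough iterations allowed, the run is good with probability at least
`1 - δ / 2`. -/
lemma IsRootedTree.exists_fuel {V : Type} [Fintype V] [DecidableEq V] {E : Finset (V × V)}
    (hE : IsRootedTree E) {d m : ℕ} (hn : 2 ≤ Fintype.card V) (hd : 2 ≤ d)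
    (hdeg : ∀ v, degree E v ≤ d) (hm : 1 ≤ m) {vs : List V} (hnd : vs.Nodup)
    (hvs : ∀ v, v ∈ vs) {δ B : ℝ} (hδ : 0 < δ)
    (hB : 2000000 * (m * (d * Fintype.card V * Real.log (Fintype.card V) ^ 2)) ≤ B * (δ / 4)) :
    ∃ f, 1 ≤ ((reconstructTree d f vs).run (pathQuery E) m).toOuterMeasure
        (some '' {o | o.output = E ∧ (o.queries : ℝ) ≤ B ∧ (o.time : ℝ) ≤ B}) +
      ENNReal.ofReal (δ / 2) := by
  have hn' : (2 : ℝ) ≤ Fintype.card V := by exact_mod_cast hn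
  have hB0 : 0 < B := by
    have h1 := log_two_le_log hn
    have h2 : (0 : ℝ) < d := by exact_mod_cast (by omega : 0 < d)
    have h3 : (0 : ℝ) < m := by exact_mod_cast hm
    have h4 : 0 < B * (δ / 4) := lt_of_lt_of_le (by positivity) hB
    exact pos_of_mul_pos_left h4 (by positivity)
  have hpos : (0 : ℝ) < (4 * (Fintype.card V : ℝ) ^ 2) ^ Fintype.card V := by positivity
  obtain ⟨f, hf⟩ := exists_pow_lt_of_lt_one
    (show 0 < δ / 4 / (4 * (Fintype.card V : ℝ) ^ 2) ^ Fintype.card V by positivity)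
    (show 1 - 1 / (2 * (Fintype.card V : ℝ) ^ 2) < 1 by
      have : 0 < 1 / (2 * (Fintype.card V : ℝ) ^ 2) := by positivity
      linarith)
  refine ⟨f, ?_⟩
  rw [lt_div_iff₀' hpos] at hf
  refine (hE.one_le_run_add (by omega : 0 < d) m f hnd hvs hB0).trans ?_
  rw [add_assoc]
  refine add_le_add le_rfl ?_
  rw [show δ / 2 = δ / 4 + δ / 4 by ring, ENNReal.ofReal_add (by positivity) (by positivity)]
  refine add_le_add ((hE.abort_le hd hdeg f hnd hvs).trans (ENNReal.ofReal_le_ofReal hf.le)) ?_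
  have h1 := (hE.mean_cost_le (m := m) hd hdeg f hnd hvs).trans
    (ENNReal.ofReal_le_ofReal ((cost_bound_le hn hd hm).trans hB))
  rw [ENNReal.ofReal_mul hB0.le] at h1
  calc _ ≤ (ENNReal.ofReal B)⁻¹ * (ENNReal.ofReal B * ENNReal.ofReal (δ / 4)) := by gcongr
    _ = _ := by
      rw [← mul_assoc, ENNReal.inv_mul_cancel (ENNReal.ofReal_pos.2 hB0).ne'
        ENNReal.ofReal_ne_top, one_mul]

end Success

end TreeQuery

theorem mainTheorem4 :
    ∃ c₁ : ℝ, 0 < c₁ ∧ ∀ c₂ : ℝ, c₁ ≤ c₂ → ∃ K : ℝ, 0 < K ∧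
      ∀ (V : Type) [Fintype V] [DecidableEq V] (E : Finset (V × V)) (vs : List V)
        (n d m : ℕ) (ε : unitInterval) (δ : ℝ),
        TreeQuery.IsRootedTree E →
        vs.Nodup → (∀ v, v ∈ vs) →
        Fintype.card V = n → 2 ≤ n →
        2 ≤ d → (∀ v, TreeQuery.degree E v ≤ d) →
        (ε : ℝ) < 1 / 2 → 0 < δ → δ < 1 →
        c₁ * TreeQuery.voteScale n d ε δ ≤ m → (m : ℝ) ≤ c₂ * TreeQuery.voteScale n d ε δ →
        ENNReal.ofReal (1 - δ) ≤ TreeQuery.probHalts E ε m d vs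
          {o | o.output = E ∧ (o.queries : ℝ) ≤ K * TreeQuery.costScale n d ε δ ∧
            (o.time : ℝ) ≤ K * TreeQuery.costScale n d ε δ} := by
  -- The mean cost is at most `2000000 * m * d * n * log² n`, and Markov's inequality needs `4 / δ`
  -- times that.
  refine ⟨1, one_pos, fun c₂ hc₂ => ⟨8000000 * c₂, by linarith, ?_⟩⟩
  intro V _ _ E vs n d m ε δ hE hnd hvs hcard hn hd hdeg hε hδ hδ1 hm1 hm2
  subst hcard
  rw [one_mul] at hm1
  have hm : 1 ≤ m := by
    have := (TreeQuery.voteScale_pos hn hd hε hδ hδ1).trans_le hm1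
    exact_mod_cast this
  set B := 8000000 * c₂ * TreeQuery.costScale (Fintype.card V) d ε δ with hB
  have hBm : 2000000 * (m * (d * Fintype.card V * Real.log (Fintype.card V) ^ 2)) ≤
      B * (δ / 4) := by
    calc 2000000 * (m * (d * Fintype.card V * Real.log (Fintype.card V) ^ 2))
        ≤ 2000000 * (c₂ * TreeQuery.voteScale (Fintype.card V) d ε δ *
          (d * Fintype.card V * Real.log (Fintype.card V) ^ 2)) := by gcongr
      _ = B * (δ / 4) := by
        rw [hB, TreeQuery.voteScale, TreeQuery.costScale]
        field_simp
        ring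
  obtain ⟨f, hf⟩ := hE.exists_fuel hn hd hdeg hm hnd hvs hδ hBm
  refine le_trans ?_ (le_iSup _ f)
  set A : Set (Option (TreeQuery.Outcome (Finset (V × V)))) :=
    some '' {o | o.output = E ∧ (o.queries : ℝ) ≤ B ∧ (o.time : ℝ) ≤ B}
  classical
  have hpoint : ∀ η : Fin m × V × V → Bool,
      1 ≤ ((TreeQuery.reconstructTree d f vs).run
          (TreeQuery.majority (TreeQuery.noisyPathQuery E η)) m).toOuterMeasure A +
        (if TreeQuery.majority (TreeQuery.noisyPathQuery E η) = TreeQuery.pathQuery E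
          then 0 else 1) + ENNReal.ofReal (δ / 2) := by
    intro η
    split_ifs with h
    · rw [h, add_zero]; exact hf
    · exact le_add_right le_add_self
  have h1 := TreeQuery.mean_mono (TreeQuery.noiseLaw ε (Fin m × V × V)) hpoint
  rw [TreeQuery.mean_const, TreeQuery.mean_add, TreeQuery.mean_add, TreeQuery.mean_const] at h1
  have h2 := (TreeQuery.mean_wrong_votes_le (E := E) (m := m) ε hε).trans
    (ENNReal.ofReal_le_ofReal (TreeQuery.wrong_votes_bound_le hn hd hε hδ hδ1 hm1))
  have h3 : (TreeQuery.reconstructNoisyTree E ε m d vs f).toOuterMeasure A =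
      TreeQuery.mean (fun η => ((TreeQuery.reconstructTree d f vs).run
        (TreeQuery.majority (TreeQuery.noisyPathQuery E η)) m).toOuterMeasure A)
        (TreeQuery.noiseLaw ε (Fin m × V × V)) := by
    rw [TreeQuery.reconstructNoisyTree, PMF.toOuterMeasure_bind_apply, TreeQuery.mean]
  rw [h3, ENNReal.ofReal_sub 1 hδ.le, ENNReal.ofReal_one, tsub_le_iff_right]
  refine h1.trans ?_
  rw [add_assoc]
  refine add_le_add le_rfl ((add_le_add h2 le_rfl).trans ?_)
  rw [← ENNReal.ofReal_add (by positivity) (by positivity)]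
  exact ENNReal.ofReal_le_ofReal (by linarith)
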